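/- **Theorem 4.9.** A *domain* is a non-empty open connected subset of $\mathbb{C}^n$; $dV$ is Lebesgue measure. For a holomorphic map $\varphi$ between domains of $\mathbb{C}^n$ write $\varphi^\sharp f=(f\circ\varphi)\cdot\det\varphi'$, where $\varphi'$ is the complex derivative. For a domain $\Omega$, a weight $\lambda\ge 0$ on $\Omega$ (defined almost everywhere) and $1\le p<\infty$, let $L^p(\Omega,\lambda)$ be the space of (classes of) measurable $f:\Omega\to\mathbb{C}$ with $\|f\|^p=\int_\Omega|f|^p\lambda\,dV<\infty$, let $A^p(\Omega,\lambda)$ be the subspace of holomorphic functions, and write $L^p(\Omega)$, $A^p(\Omega)$ when $\lambda=1$. The Bergman projection $\boldsymbol{B}_\Omega:L^2(\Omega)\to A^2(\Omega)$ is the orthogonal projection. For a group $G$ of biholomorphic automorphisms of $\Omega$ and a space $\mathfrak{F}$ of functions on $\Omega$, let $[\mathfrak{F}]^G=\{f\in\mathfrak{F}: f=\sigma^\sharp f\text{ for all }\sigma\in G\}$. Let $\Omega_1,\Omega_2\subset\mathbb{C}^n$ be bounded domains and let $\Phi:\Omega_1\to\Omega_2$ be a proper holomorphic map of *quotient type*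 with group $\Gamma\subset\mathrm{Aut}(\Omega_1)$; that is, there are closed lower-dimensional complex-analytic subvarieties $Z_j\subset\Omega_j$ such that $\Phi$ restricts to a covering map $\Omega_1\setminus Z_1\to\Omega_2\setminus Z_2$ and, for each $z\in\Omega_2\setminus Z_2$, the action of $\Gamma$ on $\Omega_1$ restricts to a transitive action on the fiber $\Phi^{-1}(z)$. Let $1\le p<\infty$. The following are equivalent: 1. $\boldsymbol{B}_{\Omega_2}$ gives rise to a bounded operator $L^p(\Omega_2)\to A^p(\Omega_2)$; that is, there is a $C>0$ with $\|\boldsymbol{B}_{\Omega_2}f\|_{L^p(\Omega_2)}\le C\|f\|_{L^p(\Omega_2)}$ for all $f\in L^2(\Omega_2)\cap L^p(\Omega_2)$. 2. $\boldsymbol{B}_{\Omega_1}$ gives rise to a bounded operator $[L^p(\Omega_1,|\det\Phi'|^{2-p})]^\Gamma\to[A^p(\Omega_1,|\det\Phi'|^{2-p})]^\Gamma$; that is, there is a $C>0$ with $\|\boldsymbol{B}_{\Omega_1}f\|_{L^p(\Omega_1,|\det\Phi'|^{2-p})}\le C\|f\|_{L^p(\Omega_1,|\det\Phi'|^{2-p})}$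 for all $f\in[L^2(\Omega_1)]^\Gamma\cap[L^p(\Omega_1,|\det\Phi'|^{2-p})]^\Gamma$. If one of these conditions holds (and hence both hold), then the two projections extend uniquely to bounded operators between the spaces named in 1 and 2; $\Phi^\sharp$ is a linear isomorphism of $L^p(\Omega_2)$ onto $[L^p(\Omega_1,|\det\Phi'|^{2-p})]^\Gamma$ which multiplies norms by a positive constant and which maps $A^p(\Omega_2)$ onto $[A^p(\Omega_1,|\det\Phi'|^{2-p})]^\Gamma$; and the extended projections satisfy $\Phi^\sharp\circ\boldsymbol{B}_{\Omega_2}=\boldsymbol{B}_{\Omega_1}\circ\Phi^\sharp$ on $L^p(\Omega_2)$. -/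

import Mathlib

open MeasureTheory Set Metric Filter Topology
open scoped ENNReal NNReal

/-- Rotations by a unit complex number, followed by translations, preserve volume. -/
theorem measurePreserving_affine_unit {n : ℕ} (z : Fin n → ℂ) (c : ℂ) (hc : ‖c‖ = 1) :
    MeasurePreserving (fun v : Fin n → ℂ => z + c • v) := by
  have h1 : MeasurePreserving (fun v : Fin n → ℂ => c • v) := by
    have := volume_preserving_pi (ι := Fin n) (α' := fun _ => ℂ) (β' := fun _ => ℂ)
      (f := fun _ w => (rotation ⟨c, by simp [Submonoid.unitSphere, hc]⟩) w)
      (fun _ => (rotation ⟨c, by simp [Submonoid.unitSphere, hc]⟩).measurePreserving)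
    exact this
  exact (measurePreserving_add_left volume z).comp h1

/-- The sub-mean value property of holomorphic functions over balls. -/
theorem enorm_mul_volume_ball_le {n : ℕ} {g : (Fin n → ℂ) → ℂ} {z : Fin n → ℂ} {r : ℝ}
    (hg : DifferentiableOn ℂ g (ball z r)) :
    ‖g z‖ₑ * volume (ball (0 : Fin n → ℂ) r) ≤ ∫⁻ x in ball z r, ‖g x‖ₑ := by
  classical
  set G : (Fin n → ℂ) → ℂ := (ball z r).piecewise g 0 with hG
  have hGm : Measurable G :=
    ContinuousOn.measurable_piecewise hg.continuousOn continuousOn_const measurableSet_ball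
  have hGe : ∀ x ∈ ball z r, G x = g x := fun x hx => Set.piecewise_eq_of_mem _ _ _ hx
  have key : ∀ v ∈ ball (0 : Fin n → ℂ) r, ‖g z‖ₑ ≤ ENNReal.ofReal ((2 * Real.pi)⁻¹) *
      ∫⁻ θ in Ioc 0 (2 * Real.pi), ‖G (z + circleMap 0 1 θ • v)‖ₑ := by
    intro v hv
    have hv' : ‖v‖ < r := by simpa using hv
    have hmaps : ∀ t ∈ closedBall (0 : ℂ) 1, z + t • v ∈ ball z r := by
      intro t ht
      have ht' : ‖t‖ ≤ 1 := by simpa using ht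
      simp only [mem_ball, dist_self_add_left, norm_smul]
      nlinarith [norm_nonneg v, norm_nonneg t]
    have hd : DifferentiableOn ℂ (fun t : ℂ => g (z + t • v)) (closedBall 0 1) :=
      hg.comp (by fun_prop) hmaps
    have hav : Real.circleAverage (fun t : ℂ => g (z + t • v)) 0 1 = g z := by
      have := DiffContOnCl.circleAverage (f := fun t : ℂ => g (z + t • v)) (c := 0) (R := 1)
        (by
          rw [abs_one]
          apply DifferentiableOn.diffContOnCl
          rw [closure_ball _ one_ne_zero]
          exact hd)
      simpa using this
    rw [← hav, Real.circleAverage_def, enorm_smul, intervalIntegral.integral_of_le (by positivity),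
      Real.enorm_of_nonneg (by positivity)]
    gcongr
    refine (enorm_integral_le_lintegral_enorm _).trans (le_of_eq ?_)
    refine lintegral_congr fun θ => ?_
    rw [hGe]
    exact hmaps _ (by simp)
  have hpi : ENNReal.ofReal ((2 * Real.pi)⁻¹) * volume (Ioc 0 (2 * Real.pi)) = 1 := by
    rw [Real.volume_Ioc, ← ENNReal.ofReal_mul (by positivity), sub_zero,
      inv_mul_cancel₀ (by positivity), ENNReal.ofReal_one]
  have hjoint : Measurable (fun q : (Fin n → ℂ) × ℝ => ‖G (z + circleMap 0 1 q.2 • q.1)‖ₑ) := by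
    refine (hGm.comp ?_).enorm
    have : Continuous (fun q : (Fin n → ℂ) × ℝ => z + circleMap 0 1 q.2 • q.1) := by fun_prop
    exact this.measurable
  calc ‖g z‖ₑ * volume (ball (0 : Fin n → ℂ) r)
      = ∫⁻ _ in ball (0 : Fin n → ℂ) r, ‖g z‖ₑ := by simp
    _ ≤ ∫⁻ v in ball (0 : Fin n → ℂ) r, ENNReal.ofReal ((2 * Real.pi)⁻¹) *
          ∫⁻ θ in Ioc 0 (2 * Real.pi), ‖G (z + circleMap 0 1 θ • v)‖ₑ :=
        setLIntegral_mono' measurableSet_ball key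
    _ = ENNReal.ofReal ((2 * Real.pi)⁻¹) * ∫⁻ v in ball (0 : Fin n → ℂ) r,
          ∫⁻ θ in Ioc 0 (2 * Real.pi), ‖G (z + circleMap 0 1 θ • v)‖ₑ := by
        rw [lintegral_const_mul' _ _ ENNReal.ofReal_ne_top]
    _ = ENNReal.ofReal ((2 * Real.pi)⁻¹) * ∫⁻ θ in Ioc 0 (2 * Real.pi),
          ∫⁻ v in ball (0 : Fin n → ℂ) r, ‖G (z + circleMap 0 1 θ • v)‖ₑ := by
        rw [lintegral_lintegral_swap]
        exact hjoint.aemeasurable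
    _ = ENNReal.ofReal ((2 * Real.pi)⁻¹) * ∫⁻ _ in Ioc 0 (2 * Real.pi),
          ∫⁻ x in ball z r, ‖g x‖ₑ := by
        congr 1
        refine lintegral_congr fun θ => ?_
        have hc : ‖circleMap 0 1 θ‖ = 1 := by simp
        have hpre : (fun v : Fin n → ℂ => z + circleMap 0 1 θ • v) ⁻¹' ball z r = ball 0 r := by
          ext v
          simp [norm_smul]
        have := (measurePreserving_affine_unit z _ hc).setLIntegral_comp_preimage
          (s := ball z r) measurableSet_ball hGm.enorm
        rw [hpre] at this
        rw [this]
        exact setLIntegral_congr_fun measurableSet_ball fun x hx => by simp only [hGe x hx]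
    _ = ∫⁻ x in ball z r, ‖g x‖ₑ := by
        rw [setLIntegral_const, mul_comm (∫⁻ x in ball z r, ‖g x‖ₑ), ← mul_assoc, hpi, one_mul]

/-- Pointwise values of a holomorphic function are controlled by its `L^p` norm. -/
theorem enorm_le_mul_eLpNorm {n : ℕ} {Ω : Set (Fin n → ℂ)}
    {p : ℝ≥0∞} (hp : 1 ≤ p) {r : ℝ} (hr : 0 < r) :
    ∃ C : ℝ≥0∞, C ≠ ∞ ∧ ∀ g : (Fin n → ℂ) → ℂ, DifferentiableOn ℂ g Ω → ∀ z, ball z r ⊆ Ω →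
      ‖g z‖ₑ ≤ C * eLpNorm g p (volume.restrict Ω) := by
  have hV0 : volume (ball (0 : Fin n → ℂ) r) ≠ 0 := (measure_ball_pos _ _ hr).ne'
  have hVt : volume (ball (0 : Fin n → ℂ) r) ≠ ∞ := measure_ball_lt_top.ne
  set V := volume (ball (0 : Fin n → ℂ) r)
  refine ⟨V ^ (1 / (1 : ℝ≥0∞).toReal - 1 / p.toReal) * V⁻¹, ?_, ?_⟩
  · refine ENNReal.mul_ne_top ?_ (ENNReal.inv_ne_top.2 hV0)
    simp [ENNReal.rpow_eq_top_iff, hV0, hVt]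
  · intro g hg z hz
    have hgz := hg.mono hz
    have h1 := enorm_mul_volume_ball_le hgz
    have h2 := eLpNorm_le_eLpNorm_mul_rpow_measure_univ (μ := volume.restrict (ball z r)) hp
      (hgz.continuousOn.aestronglyMeasurable measurableSet_ball)
    rw [eLpNorm_one_eq_lintegral_enorm, Measure.restrict_apply_univ] at h2
    have hvol : volume (ball z r) = V := by
      rw [Measure.addHaar_ball_center]
    rw [hvol] at h2
    have h3 : eLpNorm g p (volume.restrict (ball z r)) ≤ eLpNorm g p (volume.restrict Ω) :=
      eLpNorm_mono_measure _ (Measure.restrict_mono hz le_rfl)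
    calc ‖g z‖ₑ = ‖g z‖ₑ * V * V⁻¹ := by
          rw [mul_assoc, ENNReal.mul_inv_cancel hV0 hVt, mul_one]
      _ ≤ (eLpNorm g p (volume.restrict Ω) * V ^ (1 / (1 : ℝ≥0∞).toReal - 1 / p.toReal)) * V⁻¹ := by
          have h4 := h1.trans (h2.trans (mul_le_mul_left h3 _))
          gcongr
      _ = _ := by ring

/-- Lebesgue measure on `Ω`. -/
noncomputable abbrev lebesgueOn {n : ℕ} (Ω : TopologicalSpace.Opens (Fin n → ℂ)) :
    Measure (Fin n → ℂ) :=
  volume.restrict (Ω : Set (Fin n → ℂ))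

/-- The Bergman space `A^p(Ω, λ)` inside `L^p(Ω, λ) = Lp ℂ p μ`, where `μ` is the measure `λ dV` on
`Ω`: the classes that have a representative which is holomorphic on `Ω`. -/
def bergmanSpace {n : ℕ} (Ω : TopologicalSpace.Opens (Fin n → ℂ)) (p : ℝ≥0∞)
    (μ : Measure (Fin n → ℂ)) : Submodule ℂ (Lp ℂ p μ) where
  carrier := {f | ∃ g : (Fin n → ℂ) → ℂ, DifferentiableOn ℂ g Ω ∧ f =ᵐ[μ] g}
  zero_mem' := ⟨0, differentiableOn_const 0, Lp.coeFn_zero _ _ _⟩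
  add_mem' := by
    rintro f₁ f₂ ⟨g₁, hg₁, h₁⟩ ⟨g₂, hg₂, h₂⟩
    exact ⟨g₁ + g₂, hg₁.add hg₂, (Lp.coeFn_add f₁ f₂).trans (h₁.add h₂)⟩
  smul_mem' := by
    rintro c f ⟨g, hg, h⟩
    exact ⟨c • g, hg.const_smul c, (Lp.coeFn_smul c f).trans (h.const_smul c)⟩

/-- The unweighted Bergman space is closed in `L^p(Ω)`. -/
theorem isClosed_bergmanSpace {n : ℕ} (Ω : TopologicalSpace.Opens (Fin n → ℂ)) (p : ℝ≥0∞)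
    [hp : Fact (1 ≤ p)] :
    IsClosed (X := Lp ℂ p (lebesgueOn Ω))
      (bergmanSpace Ω p (lebesgueOn Ω)) := by
  refine IsSeqClosed.isClosed fun f F hf hlim => ?_
  choose g hg hfg using hf
  have hball : ∀ z₀ ∈ Ω, ∃ r > 0, ball z₀ (3 * r) ⊆ Ω := by
    intro z₀ hz₀
    obtain ⟨R, hR, h⟩ := Metric.isOpen_iff.1 Ω.isOpen z₀ hz₀
    exact ⟨R / 3, by positivity, by convert h using 2; ring⟩
  have hval : ∀ r > 0, ∃ C : ℝ, 0 ≤ C ∧ ∀ k l z, ball z r ⊆ Ω →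
      ‖g k z - g l z‖ ≤ C * dist (f k) (f l) := by
    intro r hr
    obtain ⟨C, hC, h⟩ := enorm_le_mul_eLpNorm (Ω := (Ω : Set (Fin n → ℂ))) hp.out hr
    refine ⟨C.toReal, ENNReal.toReal_nonneg, fun k l z hz => ?_⟩
    have h1 := h (g k - g l) ((hg k).sub (hg l)) z hz
    have h2 : eLpNorm (g k - g l) p (lebesgueOn Ω) = edist (f k) (f l) := by
      rw [Lp.edist_def]
      exact eLpNorm_congr_ae ((hfg k).sub (hfg l)).symm
    rw [h2] at h1
    have h3 := ENNReal.toReal_mono (ENNReal.mul_ne_top hC (edist_ne_top _ _)) h1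
    rwa [ENNReal.toReal_mul, edist_dist, ENNReal.toReal_ofReal dist_nonneg, toReal_enorm] at h3
  have hcau : CauchySeq f := hlim.cauchySeq
  have hptw : ∀ z ∈ Ω, ∃ w, Tendsto (fun k => g k z) atTop (𝓝 w) := by
    intro z hz
    obtain ⟨r, hr, hsub⟩ := hball z hz
    obtain ⟨C, hC, h⟩ := hval r hr
    refine cauchySeq_tendsto_of_complete (Metric.cauchySeq_iff.2 fun ε hε => ?_)
    obtain ⟨N, hN⟩ := Metric.cauchySeq_iff.1 hcau (ε / (C + 1)) (by positivity)
    refine ⟨N, fun k hk l hl => ?_⟩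
    have h1 := h k l z ((ball_subset_ball (by linarith)).trans hsub)
    rw [dist_eq_norm]
    have h2 := hN k hk l hl
    rw [lt_div_iff₀ (by positivity)] at h2
    nlinarith [dist_nonneg (x := f k) (y := f l)]
  choose! G hG using hptw
  refine ⟨G, fun z₀ hz₀ => ?_, ?_⟩
  · obtain ⟨r, hr, hsub⟩ := hball z₀ hz₀
    obtain ⟨C, hC, h⟩ := hval r hr
    have hdiff : ∀ k, ∀ x ∈ ball z₀ (3 * r), DifferentiableAt ℂ (g k) x := fun k x hx =>
      (hg k).differentiableAt (Ω.isOpen.mem_nhds (hsub hx))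
    have hder : ∀ k l, ∀ x ∈ ball z₀ r,
        ‖fderiv ℂ (g k) x - fderiv ℂ (g l) x‖ ≤ 2 * C * dist (f k) (f l) / r := by
      intro k l x hx
      have hx' : dist x z₀ < r := hx
      have hb : ∀ y ∈ ball x r, ‖g k y - g l y‖ ≤ C * dist (f k) (f l) := by
        intro y hy
        refine h k l y fun w hw => hsub ?_
        have h1 : dist y x < r := hy
        have h2 : dist w y < r := hw
        have h3 := dist_triangle4 w y x z₀
        exact mem_ball.2 (by linarith)
      rw [← fderiv_sub (hdiff k x (ball_subset_ball (by linarith) hx))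
        (hdiff l x (ball_subset_ball (by linarith) hx))]
      refine Complex.norm_fderiv_le_div_of_mapsTo_ball ?_ ?_ hr
      · refine ((hg k).sub (hg l)).mono fun y hy => hsub ?_
        have h1 : dist y x < r := hy
        have h3 := dist_triangle y x z₀
        exact mem_ball.2 (by linarith)
      · intro y hy
        rw [mem_closedBall, dist_eq_norm]
        refine (norm_sub_le _ _).trans ?_
        have h1 := hb y hy
        have h2 := hb x (mem_ball_self hr)
        simp only [Pi.sub_apply]
        linarith
    have hucs : UniformCauchySeqOn (fun k => fderiv ℂ (g k)) atTop (ball z₀ r) := by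
      refine Metric.uniformCauchySeqOn_iff.2 fun ε hε => ?_
      obtain ⟨N, hN⟩ := Metric.cauchySeq_iff.1 hcau (ε * r / (2 * C + 1)) (by positivity)
      refine ⟨N, fun k hk l hl x hx => ?_⟩
      rw [dist_eq_norm]
      refine (hder k l x hx).trans_lt ?_
      have h2 := hN k hk l hl
      rw [lt_div_iff₀ (by positivity)] at h2
      rw [div_lt_iff₀ hr]
      nlinarith [dist_nonneg (x := f k) (y := f l)]
    have hptw' : ∀ x ∈ ball z₀ r, ∃ L, Tendsto (fun k => fderiv ℂ (g k) x) atTop (𝓝 L) :=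
      fun x hx => cauchySeq_tendsto_of_complete (hucs.cauchySeq hx)
    choose! G' hG' using hptw'
    have hsub' : ball z₀ r ⊆ ball z₀ (3 * r) := ball_subset_ball (by linarith)
    exact (hasFDerivAt_of_tendstoUniformlyOn isOpen_ball
      (hucs.tendstoUniformlyOn_of_tendsto hG')
      (fun k x hx => (hdiff k x (hsub' hx)).hasFDerivAt)
      (fun x hx => hG x (hsub (hsub' hx)))
      (mem_ball_self hr)).differentiableAt.differentiableWithinAt
  · obtain ⟨ns, hns, hae⟩ := (tendstoInMeasure_of_tendsto_Lp hlim).exists_seq_tendsto_ae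
    have hall := ae_all_iff.2 hfg
    filter_upwards [hae, hall, ae_restrict_mem Ω.isOpen.measurableSet] with z h1 h2 h3
    refine tendsto_nhds_unique h1 ?_
    simp only [h2]
    exact (hG z h3).comp hns.tendsto_atTop

instance {n : ℕ} (Ω : TopologicalSpace.Opens (Fin n → ℂ)) :
    CompleteSpace (bergmanSpace Ω 2 (lebesgueOn Ω)) :=
  (isClosed_bergmanSpace Ω 2).completeSpace_coe

/-- The Bergman projection `B_Ω : L²(Ω) → A²(Ω)`, the orthogonal projection. -/
noncomputable def bergmanProjection {n : ℕ} (Ω : TopologicalSpace.Opens (Fin n → ℂ)) :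
    Lp ℂ 2 (lebesgueOn Ω) →L[ℂ]
      bergmanSpace Ω 2 (lebesgueOn Ω) :=
  (bergmanSpace Ω 2 (lebesgueOn Ω)).orthogonalProjectionOnto

/-- The pullback `φ^♯ f = (f ∘ φ) · det φ'`, where `φ'` is the complex derivative. -/
noncomputable def sharpPullback {n : ℕ} (φ : (Fin n → ℂ) → (Fin n → ℂ)) (f : (Fin n → ℂ) → ℂ) :
    (Fin n → ℂ) → ℂ :=
  fun z => f (φ z) * (fderiv ℂ φ z).det

/-- The measure `|det Φ'|^{2-p} dV` on `Ω`. For `p > 2` the weight is `∞` at the zeros of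
`det Φ'`. -/
noncomputable def jacobianMeasure {n : ℕ} (Ω : TopologicalSpace.Opens (Fin n → ℂ))
    (Φ : (Fin n → ℂ) → (Fin n → ℂ)) (p : ℝ≥0∞) : Measure (Fin n → ℂ) :=
  (lebesgueOn Ω).withDensity
    fun z => ‖(fderiv ℂ Φ z).det‖ₑ ^ (2 - p.toReal)

/-- The group `Aut(Ω)` of biholomorphic automorphisms of `Ω`. In order to evaluate and
differentiate it as a map of `ℂⁿ`, an automorphism of `Ω` is extended by the identity outside `Ω`;
this identifies `Aut(Ω)` with the permutations of `ℂⁿ` which fix every point outside `Ω` (and hence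
map `Ω` onto itself) and which are holomorphic on `Ω` together with their inverses. -/
def holomorphicAut {n : ℕ} (Ω : TopologicalSpace.Opens (Fin n → ℂ)) :
    Subgroup (Equiv.Perm (Fin n → ℂ)) where
  carrier := {σ | (∀ z ∉ Ω, σ z = z) ∧ DifferentiableOn ℂ σ Ω ∧ DifferentiableOn ℂ σ.symm Ω}
  one_mem' := ⟨fun _ _ => rfl, differentiableOn_id, differentiableOn_id⟩
  inv_mem' := by
    rintro σ ⟨h₁, h₂, h₃⟩
    exact ⟨fun z hz => (Equiv.symm_apply_eq σ).2 (h₁ z hz).symm, h₃, h₂⟩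
  mul_mem' := by
    have key : ∀ σ : Equiv.Perm (Fin n → ℂ), (∀ z ∉ Ω, σ z = z) →
        MapsTo σ (Ω : Set (Fin n → ℂ)) Ω := by
      intro σ h z hz
      by_contra hc
      exact hc (by rwa [σ.injective (h (σ z) hc)])
    rintro σ τ ⟨h₁, h₂, h₃⟩ ⟨k₁, k₂, k₃⟩
    refine ⟨fun z hz => ?_, ?_, ?_⟩
    · rw [Equiv.Perm.mul_apply, k₁ z hz, h₁ z hz]
    · exact h₂.comp k₂ (key τ k₁)
    · exact k₃.comp h₃ (key σ.symm fun z hz => (Equiv.symm_apply_eq σ).2 (h₁ z hz).symm)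

/-- The space `[L^p(Ω, λ)]^Γ` of classes `f` with `f = σ^♯ f` for all `σ ∈ Γ`; the class `σ^♯ f` is
the one obtained from a representative `g` of `f`. -/
def invariantSpace {n : ℕ} (Γ : Subgroup (Equiv.Perm (Fin n → ℂ))) (p : ℝ≥0∞)
    (μ : Measure (Fin n → ℂ)) : Submodule ℂ (Lp ℂ p μ) where
  carrier := {f | ∀ σ ∈ Γ, ∃ g : (Fin n → ℂ) → ℂ, f =ᵐ[μ] g ∧ f =ᵐ[μ] sharpPullback σ g}
  zero_mem' := by
    intro σ _
    refine ⟨0, Lp.coeFn_zero _ _ _, (Lp.coeFn_zero _ _ _).trans (Eventually.of_forall fun z => ?_)⟩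
    simp [sharpPullback]
  add_mem' := by
    intro f₁ f₂ h₁ h₂ σ hσ
    obtain ⟨g₁, a₁, b₁⟩ := h₁ σ hσ
    obtain ⟨g₂, a₂, b₂⟩ := h₂ σ hσ
    refine ⟨g₁ + g₂, (Lp.coeFn_add f₁ f₂).trans (a₁.add a₂),
      ((Lp.coeFn_add f₁ f₂).trans (b₁.add b₂)).trans (Eventually.of_forall fun z => ?_)⟩
    simp [sharpPullback, add_mul]
  smul_mem' := by
    intro c f h σ hσ
    obtain ⟨g, a, b⟩ := h σ hσ
    refine ⟨c • g, (Lp.coeFn_smul c f).trans (a.const_smul c),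
      ((Lp.coeFn_smul c f).trans (b.const_smul c)).trans (Eventually.of_forall fun z => ?_)⟩
    simp [sharpPullback, mul_assoc]

/-- The space `[L^p(Ω, |det Φ'|^{2-p})]^Γ`. -/
noncomputable abbrev weightedInvariantLp {n : ℕ} (Ω : TopologicalSpace.Opens (Fin n → ℂ))
    (Φ : (Fin n → ℂ) → (Fin n → ℂ)) (Γ : Subgroup (Equiv.Perm (Fin n → ℂ))) (p : ℝ≥0∞) :
    Submodule ℂ (Lp ℂ p (jacobianMeasure Ω Φ p)) :=
  invariantSpace Γ p (jacobianMeasure Ω Φ p)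

/-- The space `[A^p(Ω, |det Φ'|^{2-p})]^Γ`. -/
noncomputable abbrev weightedInvariantBergman {n : ℕ} (Ω : TopologicalSpace.Opens (Fin n → ℂ))
    (Φ : (Fin n → ℂ) → (Fin n → ℂ)) (Γ : Subgroup (Equiv.Perm (Fin n → ℂ))) (p : ℝ≥0∞) :
    Submodule ℂ (Lp ℂ p (jacobianMeasure Ω Φ p)) :=
  weightedInvariantLp Ω Φ Γ p ⊓ bergmanSpace Ω p (jacobianMeasure Ω Φ p)

/-- `Z` is a closed complex-analytic subvariety of `Ω` of dimension smaller than `n`: near every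
point of `Ω` it is the common zero set of finitely many holomorphic functions, and it has no
interior points. -/
def IsThinSubvariety {n : ℕ} (Ω : TopologicalSpace.Opens (Fin n → ℂ)) (Z : Set (Fin n → ℂ)) :
    Prop :=
  Z ⊆ Ω ∧ interior Z = ∅ ∧
    ∀ z ∈ Ω, ∃ U : Set (Fin n → ℂ), IsOpen U ∧ z ∈ U ∧ U ⊆ Ω ∧
      ∃ (k : ℕ) (F : Fin k → (Fin n → ℂ) → ℂ), (∀ i, DifferentiableOn ℂ (F i) U) ∧
        Z ∩ U = {w ∈ U | ∀ i, F i w = 0}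

/-- `Φ : Ω₁ → Ω₂` is a proper holomorphic map of quotient type with group `Γ ⊂ Aut(Ω₁)`. -/
structure IsQuotientType {n : ℕ} (Ω₁ Ω₂ : TopologicalSpace.Opens (Fin n → ℂ))
    (Φ : (Fin n → ℂ) → (Fin n → ℂ)) (Γ : Subgroup (Equiv.Perm (Fin n → ℂ))) : Prop where
  mapsTo : MapsTo Φ (Ω₁ : Set (Fin n → ℂ)) Ω₂
  holomorphic : DifferentiableOn ℂ Φ Ω₁
  proper : IsProperMap mapsTo.restrict
  le_aut : Γ ≤ holomorphicAut Ω₁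
  exists_covering : ∃ Z₁ Z₂ : Set (Fin n → ℂ),
    IsThinSubvariety Ω₁ Z₁ ∧ IsThinSubvariety Ω₂ Z₂ ∧
    (∃ h : MapsTo Φ ((Ω₁ : Set (Fin n → ℂ)) \ Z₁) ((Ω₂ : Set (Fin n → ℂ)) \ Z₂),
      IsCoveringMap h.restrict ∧ Function.Surjective h.restrict) ∧
    ∀ w ∈ (Ω₂ : Set (Fin n → ℂ)) \ Z₂,
      (∀ σ ∈ Γ, ∀ z ∈ Ω₁, Φ z = w → Φ (σ z) = w) ∧
      ∀ z ∈ Ω₁, ∀ z' ∈ Ω₁, Φ z = w → Φ z' = w → ∃ σ ∈ Γ, σ z = z'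

/-- The Bergman projection `B_Ω` gives rise to a bounded operator in the norm of `L^p(μ)`, on the
functions of the subspace `S` of `L²(Ω)`: it satisfies an `L^p(μ)` estimate on `S ∩ L^p(μ)`. -/
def BergmanBoundedOn {n : ℕ} (Ω : TopologicalSpace.Opens (Fin n → ℂ)) (p : ℝ≥0∞)
    (μ : Measure (Fin n → ℂ))
    (S : Submodule ℂ (Lp ℂ 2 (lebesgueOn Ω))) : Prop :=
  ∃ C : ℝ≥0, ∀ f ∈ S, MemLp f p μ →
    eLpNorm (bergmanProjection Ω f : Lp ℂ 2 (lebesgueOn Ω)) p μ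
      ≤ C * eLpNorm f p μ

/-- The bounded operator `T` from the subspace `V` of `L^p(μ)` to the subspace `W` of `L^p(μ)`
agrees with the Bergman projection `B_Ω` on `S ∩ V`, where `S` is a subspace of `L²(Ω)`. -/
def ExtendsBergman {n : ℕ} (Ω : TopologicalSpace.Opens (Fin n → ℂ)) {p : ℝ≥0∞} [Fact (1 ≤ p)]
    {μ : Measure (Fin n → ℂ)}
    (S : Submodule ℂ (Lp ℂ 2 (lebesgueOn Ω)))
    {V W : Submodule ℂ (Lp ℂ p μ)} (T : V →L[ℂ] W) : Prop :=
  ∀ f ∈ S, ∀ h : V, (h : Lp ℂ p μ) =ᵐ[lebesgueOn Ω] f →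
    (T h : Lp ℂ p μ) =ᵐ[lebesgueOn Ω]
      (bergmanProjection Ω f : Lp ℂ 2 (lebesgueOn Ω))

/-!
The engine of the proof is the change of variables formula for `Φ`. Off the subvarieties, which are
null sets, `Γ` acts freely and the fibres of `Φ` are its orbits. As these are compact and discrete,
`Γ` is finite (`IsQuotientType.finite_group`), and there is a fundamental domain which `Φ` maps
injectively onto almost all of `Ω₂` (`IsQuotientType.exists_fundamentalDomain`). Hence `Φ` pushes
the measure `|det Φ'|² dV` on `Ω₁` forward to `|Γ| dV` on `Ω₂`; this is recorded in the structure
`PushesVolume`, which automorphisms satisfy as well, with the multiplicity `1`. Since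
`|Φ^♯ f|^p |det Φ'|^{2-p} = (|f|^p ∘ Φ) |det Φ'|²`, the pullback `Φ^♯` multiplies `L^p` norms by
`|Γ|^{1/p}` (`PushesVolume.eLpNorm_sharpPullback`), and it is onto the invariant functions, because
an invariant function is determined by its values on the fundamental domain
(`IsQuotientType.exists_sharpPullback_ae_eq`).

The second ingredient is that `f` is holomorphic as soon as `Φ^♯ f` is
(`PushesVolume.exists_differentiableOn_of_sharpPullback`). This is local on `Ω₂` and clear away from
the branch locus, but the branch locus has to be crossed without any control on its geometry. So the
claim is checked in the sense of distributions: by Weyl's lemma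
(`exists_differentiableOn_of_integral_mul_dbar_eq_zero`) it suffices that `∫ f ∂ψ/∂w̄ⱼ = 0` for
every test function `ψ` on `Ω₂`. Pulled back to `Ω₁` this is the integral of the holomorphic
function `Φ^♯ f` against `((∂ψ/∂w̄ⱼ) ∘ Φ)` times the conjugate of `det Φ'`, which by the chain rule
and Cramer's rule is a combination of the `∂(ψ ∘ Φ)/∂z̄ᵢ` with the conjugates of the entries of the
adjugate of `Φ'` as coefficients. The columns of the adjugate are divergence free
(`sum_fderiv_adjugateField_eq_zero`, the Piola identity), so an integration by parts gives zero;
`ψ ∘ Φ` has compact support because `Φ` is proper.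

These two facts yield `B_{Ω₁} Φ^♯ = Φ^♯ B_{Ω₂}` on `L²(Ω₂)`
(`IsQuotientType.bergmanProjection_sharpPullback`): if `q` is orthogonal to `A²(Ω₂)` and
`a ∈ A²(Ω₁)`, then the inner product of `a` with the invariant function `Φ^♯ q` does not change when
`a` is averaged over `Γ`, and the average is the pullback of an element of `A²(Ω₂)`. The equivalence
of the two estimates follows at once. On `Ω₂`, where the measure is finite and `L² ∩ L^p` is dense
in `L^p`, the estimate gives a unique extension of the projection; existence and uniqueness on `Ω₁`
are deduced by conjugation with the isomorphism `Φ^♯`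
(`IsQuotientType.extendsBergman_transfer`), so no density statement for the weighted space is
needed.
-/

/-! ### Holomorphic functions of several variables -/

/-- A uniformly bounded sequence of holomorphic functions which converges almost everywhere
converges everywhere, and the limit is holomorphic. -/
theorem exists_differentiableOn_of_bounded_of_tendsto_ae {n : ℕ}
    (Ω : TopologicalSpace.Opens (Fin n → ℂ)) (hΩ : volume (Ω : Set (Fin n → ℂ)) ≠ ∞)
    {k : ℕ → (Fin n → ℂ) → ℂ} (hk : ∀ j, DifferentiableOn ℂ (k j) Ω) {M : ℝ}
    (hM : ∀ j, ∀ z ∈ Ω, ‖k j z‖ ≤ M) {f : (Fin n → ℂ) → ℂ}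
    (hf : ∀ᵐ z ∂lebesgueOn Ω, Tendsto (fun j => k j z) atTop (𝓝 (f z))) :
    ∃ g : (Fin n → ℂ) → ℂ, DifferentiableOn ℂ g Ω ∧ f =ᵐ[lebesgueOn Ω] g ∧
      ∀ z ∈ Ω, Tendsto (fun j => k j z) atTop (𝓝 (g z)) := by
  have : IsFiniteMeasure (lebesgueOn Ω) := ⟨by simpa using hΩ.lt_top⟩
  have hmeas : ∀ j, AEStronglyMeasurable (k j) (lebesgueOn Ω) := fun j =>
    (hk j).continuousOn.aestronglyMeasurable Ω.isOpen.measurableSet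
  have hbd : ∀ j, ∀ᵐ z ∂lebesgueOn Ω, ‖k j z‖ ≤ M := fun j => by
    filter_upwards [ae_restrict_mem Ω.isOpen.measurableSet] with z hz using hM j z hz
  have hfm : AEStronglyMeasurable f (lebesgueOn Ω) :=
    aestronglyMeasurable_of_tendsto_ae _ hmeas hf
  have hfb : ∀ᵐ z ∂lebesgueOn Ω, ‖f z‖ ≤ M := by
    filter_upwards [hf, ae_all_iff.2 hbd] with z h1 h2
    exact le_of_tendsto h1.norm (Eventually.of_forall h2)
  have hkL : ∀ j, MemLp (k j) 1 (lebesgueOn Ω) := fun j => MemLp.of_bound (hmeas j) M (hbd j)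
  have hfL : MemLp f 1 (lebesgueOn Ω) := MemLp.of_bound hfm M hfb
  have hlim : Tendsto (fun j => eLpNorm (k j - f) 1 (lebesgueOn Ω)) atTop (𝓝 0) := by
    have h := tendsto_lintegral_norm_of_dominated_convergence (bound := fun _ => M) hmeas
      (hasFiniteIntegral_const M) hbd hf
    refine h.congr fun j => ?_
    rw [eLpNorm_one_eq_lintegral_enorm]
    simp
  have hlimL := (Lp.tendsto_Lp_iff_tendsto_eLpNorm'' k hkL f hfL).2 hlim
  have hmem : hfL.toLp f ∈ bergmanSpace Ω 1 (lebesgueOn Ω) :=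
    (isClosed_bergmanSpace Ω 1).mem_of_tendsto hlimL
      (Eventually.of_forall fun j => ⟨k j, hk j, (hkL j).coeFn_toLp⟩)
  obtain ⟨g, hg, hfg⟩ := hmem
  have hfg' : f =ᵐ[lebesgueOn Ω] g := hfL.coeFn_toLp.symm.trans hfg
  refine ⟨g, hg, hfg', fun z hz => ?_⟩
  obtain ⟨r, hr, hball⟩ := Metric.isOpen_iff.1 Ω.isOpen z hz
  obtain ⟨C, hC, hCz⟩ := enorm_le_mul_eLpNorm (Ω := (Ω : Set (Fin n → ℂ))) (p := 1) le_rfl hr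
  rw [tendsto_iff_edist_tendsto_0]
  have h0 : Tendsto (fun j => C * eLpNorm (k j - f) 1 (lebesgueOn Ω)) atTop (𝓝 0) := by
    have := ENNReal.Tendsto.const_mul (a := C) hlim (Or.inr hC)
    rwa [mul_zero] at this
  refine tendsto_of_tendsto_of_tendsto_of_le_of_le tendsto_const_nhds h0 (fun _ => zero_le)
    fun j => ?_
  have h1 := hCz (k j - g) ((hk j).sub hg) z hball
  rw [eLpNorm_congr_ae (hfg'.mono fun x hx => by simp [hx] : k j - f =ᵐ[lebesgueOn Ω] k j - g)]
  simpa [edist_eq_enorm_sub] using h1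

/-- The derivative of a holomorphic function in a fixed direction is holomorphic: it is a bounded
limit of difference quotients. -/
theorem DifferentiableOn.fderiv_apply_of_complex {n : ℕ} {f : (Fin n → ℂ) → ℂ}
    {U : Set (Fin n → ℂ)} (hU : IsOpen U) (hf : DifferentiableOn ℂ f U) (v : Fin n → ℂ) :
    DifferentiableOn ℂ (fun z => fderiv ℂ f z v) U := by
  intro z₀ hz₀
  have hev : ∀ᶠ z in 𝓝 z₀, z ∈ U ∧ ‖f z‖ < ‖f z₀‖ + 1 :=
    (hU.eventually_mem hz₀).and
      (((hf.differentiableAt (hU.mem_nhds hz₀)).continuousAt.norm).eventually_lt_const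
        (by linarith : ‖f z₀‖ < ‖f z₀‖ + 1))
  obtain ⟨R, hR, hball⟩ := Metric.eventually_nhds_iff_ball.1 hev
  set M := ‖f z₀‖ + 1
  have hM : 0 < M := by positivity
  obtain ⟨r, hr, rfl⟩ : ∃ r > 0, R = 3 * r := ⟨R / 3, by positivity, by ring⟩
  have hd : ∀ x ∈ ball z₀ (3 * r), DifferentiableAt ℂ f x := fun x hx =>
    hf.differentiableAt (hU.mem_nhds (hball x hx).1)
  have hder : ∀ x ∈ ball z₀ (2 * r), ‖fderiv ℂ f x‖ ≤ 2 * M / r := by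
    intro x hx
    have hsub : ball x r ⊆ ball z₀ (3 * r) := ball_subset_ball' (by
      have := mem_ball.1 hx; linarith)
    refine Complex.norm_fderiv_le_div_of_mapsTo_ball
      (fun y hy => (hd y (hsub hy)).differentiableWithinAt) (fun y hy => ?_) hr
    rw [mem_closedBall, dist_eq_norm]
    refine (norm_sub_le _ _).trans ?_
    have h1 := (hball y (hsub hy)).2
    have h2 := (hball x (hsub (mem_ball_self hr))).2
    linarith
  set t : ℕ → ℂ := fun j => ((r / (‖v‖ + 1) * (1 / ((j : ℝ) + 1)) : ℝ) : ℂ) with ht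
  have htn : ∀ j, ‖t j‖ = r / (‖v‖ + 1) * (1 / ((j : ℝ) + 1)) := fun j => by
    rw [ht, Complex.norm_real, Real.norm_of_nonneg (by positivity)]
  have ht0 : ∀ j, t j ≠ 0 := fun j => by
    rw [← norm_pos_iff, htn]; positivity
  have htlim : Tendsto t atTop (𝓝[≠] 0) := by
    refine tendsto_nhdsWithin_iff.2 ⟨?_, Eventually.of_forall ht0⟩
    rw [tendsto_zero_iff_norm_tendsto_zero]
    simp only [htn]
    simpa using tendsto_one_div_add_atTop_nhds_zero_nat.const_mul (r / (‖v‖ + 1))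
  have htv : ∀ j, ‖t j • v‖ < r := fun j => by
    rw [norm_smul, htn]
    have h1 : 1 / ((j : ℝ) + 1) ≤ 1 := by
      rw [div_le_one (by positivity)]; linarith [(Nat.cast_nonneg j : (0 : ℝ) ≤ j)]
    have h2 : r / (‖v‖ + 1) * ‖v‖ < r := by
      rw [div_mul_eq_mul_div, div_lt_iff₀ (by positivity)]; nlinarith [norm_nonneg v]
    calc _ ≤ r / (‖v‖ + 1) * 1 * ‖v‖ := by gcongr
      _ < r := by rwa [mul_one]
  have hshift : ∀ j, ∀ x ∈ ball z₀ r, x + t j • v ∈ ball z₀ (2 * r) := fun j x hx => by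
    have h1 := mem_ball.1 hx
    have h2 := htv j
    rw [mem_ball, dist_eq_norm] at *
    calc ‖x + t j • v - z₀‖ = ‖(x - z₀) + t j • v‖ := by congr 1; abel
      _ ≤ _ := norm_add_le _ _
      _ < 2 * r := by linarith
  have h13 : ball z₀ r ⊆ ball z₀ (3 * r) := ball_subset_ball (by linarith)
  have h23 : ball z₀ (2 * r) ⊆ ball z₀ (3 * r) := ball_subset_ball (by linarith)
  have h12 : ball z₀ r ⊆ ball z₀ (2 * r) := ball_subset_ball (by linarith)
  set k : ℕ → (Fin n → ℂ) → ℂ := fun j x => (t j)⁻¹ • (f (x + t j • v) - f x) with hk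
  have hkd : ∀ j, DifferentiableOn ℂ (k j) (ball z₀ r) := by
    intro j x hx
    have h1 : DifferentiableAt ℂ (fun x => f (x + t j • v)) x :=
      (hd _ (h23 (hshift j x hx))).comp x (by fun_prop)
    exact ((h1.sub (hd x (h13 hx))).const_smul (t j)⁻¹).differentiableWithinAt
  have hkM : ∀ j, ∀ x ∈ ball z₀ r, ‖k j x‖ ≤ 2 * M / r * ‖v‖ := by
    intro j x hx
    have h1 := (convex_ball z₀ (2 * r)).norm_image_sub_le_of_norm_fderiv_le (𝕜 := ℂ)
      (fun y hy => hd y (h23 hy)) hder (h12 hx) (hshift j x hx)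
    rw [add_sub_cancel_left, norm_smul] at h1
    rw [hk, norm_smul, norm_inv, inv_mul_le_iff₀ (norm_pos_iff.2 (ht0 j))]
    calc _ ≤ _ := h1
      _ = _ := by ring
  have hklim : ∀ x ∈ ball z₀ r, Tendsto (fun j => k j x) atTop (𝓝 (fderiv ℂ f x v)) :=
    fun x hx => ((hd x (h13 hx)).hasFDerivAt.hasLineDerivAt v).tendsto_slope_zero.comp htlim
  obtain ⟨g, hg, -, hgl⟩ := exists_differentiableOn_of_bounded_of_tendsto_ae
    (f := fun x => fderiv ℂ f x v) ⟨ball z₀ r, isOpen_ball⟩ measure_ball_lt_top.ne hkd hkM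
    (by filter_upwards [ae_restrict_mem measurableSet_ball] with x hx using hklim x hx)
  have hgat := (hg.differentiableAt (isOpen_ball.mem_nhds (mem_ball_self hr)))
  refine (hgat.congr_of_eventuallyEq ?_).differentiableWithinAt
  filter_upwards [isOpen_ball.mem_nhds (mem_ball_self hr)] with x hx
  exact tendsto_nhds_unique (hklim x hx) (hgl x hx)

/-- The derivative of a holomorphic map is holomorphic. -/
theorem DifferentiableOn.fderiv_of_complex {n m : ℕ} {f : (Fin n → ℂ) → (Fin m → ℂ)}
    {U : Set (Fin n → ℂ)} (hU : IsOpen U) (hf : DifferentiableOn ℂ f U) :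
    DifferentiableOn ℂ (fderiv ℂ f) U := by
  have h1 : ∀ i j, DifferentiableOn ℂ (fun z => fderiv ℂ f z (Pi.single j 1) i) U := by
    intro i j
    refine (DifferentiableOn.fderiv_apply_of_complex hU (differentiableOn_pi.1 hf i)
      (Pi.single j 1)).congr fun z hz => ?_
    rw [fderiv_apply (hf.differentiableAt (hU.mem_nhds hz))]
    rfl
  have h2 : fderiv ℂ f = fun z => ∑ j, (ContinuousLinearMap.proj (R := ℂ)
      (φ := fun _ : Fin n => ℂ) j).smulRight (fderiv ℂ f z (Pi.single j 1)) := by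
    ext1 z
    ext w i
    have hw : w = ∑ j, w j • (Pi.single j 1 : Fin n → ℂ) := by
      ext j
      simp [Pi.single_apply]
    have h := congrFun (congrArg (fderiv ℂ f z) hw) i
    rw [map_sum] at h
    simpa using h
  rw [h2]
  refine DifferentiableOn.fun_sum fun j _ => ?_
  have h3 : DifferentiableOn ℂ (fun z => fderiv ℂ f z (Pi.single j 1)) U :=
    differentiableOn_pi.2 fun i => h1 i j
  exact ((ContinuousLinearMap.smulRightL ℂ (Fin n → ℂ) (Fin m → ℂ)
    (ContinuousLinearMap.proj j)).differentiable.comp_differentiableOn h3)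

/-- If a function is holomorphic on a ball and does not vanish at some point of it, then its zeros
have measure zero: on almost all complex lines through that point there are countably many. -/
theorem volume_zeros_inter_ball_eq_zero {n : ℕ} {f : (Fin n → ℂ) → ℂ} {b a : Fin n → ℂ} {r : ℝ}
    (hf : DifferentiableOn ℂ f (ball b r)) (ha : a ∈ ball b r) (hfa : f a ≠ 0) :
    volume (ball b r ∩ {z | f z = 0}) = 0 := by
  classical
  set N := ball b r ∩ {z | f z = 0} with hN
  have hNm : MeasurableSet N := by
    set G : (Fin n → ℂ) → ℂ := (ball b r).piecewise f 1
    have hGm : Measurable G :=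
      ContinuousOn.measurable_piecewise hf.continuousOn continuousOn_const measurableSet_ball
    have : N = ball b r ∩ G ⁻¹' {0} := by
      ext z
      simp only [hN, mem_inter_iff, mem_ofPred_eq, mem_preimage, mem_singleton_iff]
      refine and_congr_right fun hz => ?_
      rw [show G z = f z from Set.piecewise_eq_of_mem _ _ _ hz]
    rw [this]
    exact measurableSet_ball.inter (hGm (measurableSet_singleton 0))
  have hline : ∀ v : Fin n → ℂ, volume {t : ℂ | a + t • v ∈ N} = 0 := by
    intro v
    set S : Set ℂ := {t : ℂ | a + t • v ∈ ball b r}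
    have hSo : IsOpen S := isOpen_ball.preimage (by fun_prop : Continuous fun t : ℂ => a + t • v)
    have hSc : IsPreconnected S := by
      refine Convex.isPreconnected ?_
      intro x hx y hy α β hα hβ hαβ
      have := convex_ball b r hx hy hα hβ hαβ
      change a + (α • x + β • y) • v ∈ ball b r
      convert this using 1
      rw [smul_add, smul_add, add_add_add_comm, ← add_smul, hαβ, one_smul, add_smul,
        smul_assoc, smul_assoc]
    have hS0 : (0 : ℂ) ∈ S := by simpa [S] using ha
    have han : AnalyticOnNhd ℂ (fun t : ℂ => f (a + t • v)) S :=
      DifferentiableOn.analyticOnNhd (hf.comp (by fun_prop) fun t ht => ht) hSo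
    have hcod := AnalyticOnNhd.preimage_zero_mem_codiscreteWithin (x := 0) han (by simpa using hfa)
      hS0 ⟨⟨0, hS0⟩, hSc⟩
    have hae := ae_restrict_le_codiscreteWithin (μ := (volume : Measure ℂ)) hSo.measurableSet hcod
    have h2 := (mem_ae_iff.1 hae)
    rw [← preimage_compl, compl_compl, Measure.restrict_apply' hSo.measurableSet] at h2
    refine measure_mono_null (fun t ht => ?_) h2
    exact ⟨by simpa using ht.2, ht.1⟩
  have hjm : MeasurableSet {q : ℂ × (Fin n → ℂ) | a + q.1 • q.2 ∈ N} :=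
    (by fun_prop : Continuous fun q : ℂ × (Fin n → ℂ) => a + q.1 • q.2).measurable hNm
  have hprod : (volume.prod volume) {q : ℂ × (Fin n → ℂ) | a + q.1 • q.2 ∈ N} = 0 := by
    rw [Measure.prod_apply_symm hjm]
    simp only [preimage_ofPred_eq, hline, lintegral_zero]
  rw [Measure.measure_prod_null hjm] at hprod
  have hne : ∀ᵐ t : ℂ, t ≠ 0 := by simp [ae_iff]
  -- By Fubini, for some `t ≠ 0` the set of vectors `v` with `a + t • v ∈ N` is null, and `N` is the
  -- image of that set under an invertible affine map.
  obtain ⟨t, ht, ht0⟩ := (hprod.and hne).exists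
  simp only [preimage_ofPred_eq, Pi.zero_apply] at ht
  have himg : N = (fun x => a + x) '' ((fun v => t • v) '' {v : Fin n → ℂ | a + t • v ∈ N}) := by
    ext z
    simp only [mem_image, mem_ofPred_eq, exists_exists_and_eq_and]
    refine ⟨fun hz => ⟨t⁻¹ • (z - a), ?_, ?_⟩, ?_⟩
    · simpa [smul_smul, mul_inv_cancel₀ ht0] using hz
    · simp [smul_smul, mul_inv_cancel₀ ht0]
    · rintro ⟨v, hv, rfl⟩
      exact hv
  have hsm : volume ((fun v => t • v) '' {v : Fin n → ℂ | a + t • v ∈ N}) = 0 := by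
    have hlin := Measure.addHaar_image_linearMap (volume : Measure (Fin n → ℂ))
      ((t • LinearMap.id : (Fin n → ℂ) →ₗ[ℂ] (Fin n → ℂ)).restrictScalars ℝ)
      {v : Fin n → ℂ | a + t • v ∈ N}
    rw [ht, mul_zero] at hlin
    exact hlin
  rw [himg, image_add_left, measure_preimage_add, hsm]

/-- A holomorphic function on a connected open set either vanishes identically or has a zero set of
measure zero. -/
theorem eqOn_zero_or_volume_zeros_eq_zero {n : ℕ} {f : (Fin n → ℂ) → ℂ} {U : Set (Fin n → ℂ)}
    (hU : IsOpen U) (hc : IsPreconnected U) (hf : DifferentiableOn ℂ f U) :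
    (∀ z ∈ U, f z = 0) ∨ volume (U ∩ {z | f z = 0}) = 0 := by
  set S : Set (Fin n → ℂ) := {z | ∃ r > 0, ball z r ⊆ U ∧ ∀ x ∈ ball z r, f x = 0}
  set T : Set (Fin n → ℂ) :=
    {z | ∃ r > 0, ball z r ⊆ U ∧ volume (ball z r ∩ {x | f x = 0}) = 0}
  have hsubb : ∀ {z x : Fin n → ℂ} {r : ℝ}, x ∈ ball z r → ball x (r - dist x z) ⊆ ball z r :=
    fun hx => ball_subset_ball' (by linarith)
  have hSo : IsOpen S := by
    refine Metric.isOpen_iff.2 fun z hz => ?_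
    obtain ⟨r, hr, h1, h2⟩ := hz
    refine ⟨r, hr, fun x hx => ⟨r - dist x z, by simpa using hx, (hsubb hx).trans h1, ?_⟩⟩
    exact fun y hy => h2 y (hsubb hx hy)
  have hTo : IsOpen T := by
    refine Metric.isOpen_iff.2 fun z hz => ?_
    obtain ⟨r, hr, h1, h2⟩ := hz
    refine ⟨r, hr, fun x hx => ⟨r - dist x z, by simpa using hx, (hsubb hx).trans h1, ?_⟩⟩
    exact measure_mono_null (inter_subset_inter_left _ (hsubb hx)) h2
  have hcov : U ⊆ S ∪ T := by
    intro z hz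
    obtain ⟨r, hr, hb⟩ := Metric.isOpen_iff.1 hU z hz
    by_cases h : ∀ x ∈ ball z r, f x = 0
    · exact Or.inl ⟨r, hr, hb, h⟩
    · push Not at h
      obtain ⟨a, ha, hfa⟩ := h
      exact Or.inr ⟨r, hr, hb, volume_zeros_inter_ball_eq_zero (hf.mono hb) ha hfa⟩
  have hdisj : S ∩ T = ∅ := by
    ext z
    simp only [mem_inter_iff, mem_empty_iff_false, iff_false]
    rintro ⟨⟨r, hr, -, h1⟩, ⟨s, hs, -, h2⟩⟩
    have : ball z (min r s) ⊆ ball z s ∩ {x | f x = 0} := fun x hx =>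
      ⟨ball_subset_ball (min_le_right _ _) hx, h1 x (ball_subset_ball (min_le_left _ _) hx)⟩
    exact (measure_ball_pos volume z (lt_min hr hs)).ne' (measure_mono_null this h2)
  rcases isPreconnected_iff_subset_of_disjoint.1 hc S T hSo hTo hcov (by simp [hdisj]) with h | h
  · left
    intro z hz
    obtain ⟨r, hr, -, h1⟩ := h hz
    exact h1 z (mem_ball_self hr)
  · right
    refine measure_null_of_locally_null _ fun z hz => ?_
    obtain ⟨r, hr, -, h1⟩ := h hz.1
    exact ⟨ball z r ∩ (U ∩ {x | f x = 0}),
      inter_mem (mem_nhdsWithin_of_mem_nhds (ball_mem_nhds z hr)) self_mem_nhdsWithin,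
      measure_mono_null (inter_subset_inter_right _ inter_subset_right) h1⟩

/-! ### Complex Jacobians and change of variables -/

theorem ContinuousLinearMap.det_eq_det_single {n : ℕ} (L : (Fin n → ℂ) →L[ℂ] (Fin n → ℂ)) :
    L.det = Matrix.det (Matrix.of fun i j => L (Pi.single j 1) i) := by
  rw [ContinuousLinearMap.det, ← LinearMap.det_toMatrix']
  congr 1

/-- The real Jacobian of a complex linear map is the square modulus of the complex one. -/
theorem ofReal_abs_det_restrictScalars {n : ℕ} (L : (Fin n → ℂ) →L[ℂ] (Fin n → ℂ)) :
    ENNReal.ofReal |(L.restrictScalars ℝ).det| = ‖L.det‖ₑ ^ 2 := by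
  have h : (L.restrictScalars ℝ).det = ‖L.det‖ ^ 2 := by
    change (((L : (Fin n → ℂ) →ₗ[ℂ] (Fin n → ℂ)).restrictScalars ℝ)).det = _
    rw [LinearMap.det_restrictScalars, Algebra.norm_complex_eq]
    exact Complex.normSq_eq_norm_sq _
  rw [h, abs_of_nonneg (by positivity), ENNReal.ofReal_pow (norm_nonneg _), ofReal_norm]

theorem DifferentiableOn.det_fderiv {n : ℕ} {φ : (Fin n → ℂ) → (Fin n → ℂ)}
    {U : Set (Fin n → ℂ)} (hU : IsOpen U) (hφ : DifferentiableOn ℂ φ U) :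
    DifferentiableOn ℂ (fun z => (fderiv ℂ φ z).det) U := by
  have h := DifferentiableOn.fderiv_of_complex hU hφ
  simp only [ContinuousLinearMap.det_eq_det_single, Matrix.det_apply, Matrix.of_apply]
  refine DifferentiableOn.fun_sum fun σ _ => DifferentiableOn.const_smul ?_ _
  have h1 : ∀ i, DifferentiableOn ℂ (fun z => fderiv ℂ φ z (Pi.single i 1) (σ i)) U := fun i =>
    differentiableOn_pi.1 (h.clm_apply (differentiableOn_const _)) (σ i)
  exact fun z hz => (HasFDerivWithinAt.finsetProd
    fun i _ => (h1 i z hz).hasFDerivWithinAt).differentiableWithinAt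

theorem measurable_det_fderiv {n : ℕ} (φ : (Fin n → ℂ) → (Fin n → ℂ)) :
    Measurable fun z => (fderiv ℂ φ z).det :=
  ContinuousLinearMap.continuous_det.measurable.comp (measurable_fderiv ℂ φ)

/-- The change of variables formula for an injective holomorphic map, as an equality of measures. -/
theorem map_withDensity_enorm_det_sq {n : ℕ} {φ : (Fin n → ℂ) → (Fin n → ℂ)}
    {E : Set (Fin n → ℂ)} (hE : MeasurableSet E) (hφ : ∀ z ∈ E, DifferentiableAt ℂ φ z)
    (hinj : InjOn φ E) :
    Measure.map φ ((volume.restrict E).withDensity fun z => ‖(fderiv ℂ φ z).det‖ₑ ^ 2) =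
      volume.restrict (φ '' E) := by
  rw [← map_withDensity_abs_det_fderiv_eq_addHaar volume hE.nullMeasurableSet
    (f' := fun z => (fderiv ℂ φ z).restrictScalars ℝ)
    (fun z hz => ((hφ z hz).hasFDerivAt.restrictScalars ℝ).hasFDerivWithinAt) hinj]
  simp only [ofReal_abs_det_restrictScalars]

/-! ### Thin subvarieties and automorphisms -/

theorem IsThinSubvariety.isOpen_diff {n : ℕ} {Ω : TopologicalSpace.Opens (Fin n → ℂ)}
    {Z : Set (Fin n → ℂ)} (hZ : IsThinSubvariety Ω Z) :
    IsOpen ((Ω : Set (Fin n → ℂ)) \ Z) := by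
  refine isOpen_iff_mem_nhds.2 fun z hz => ?_
  obtain ⟨U, hU, hzU, hUΩ, k, F, hF, hZU⟩ := hZ.2.2 z hz.1
  have hex : ∃ i, F i z ≠ 0 := by
    by_contra! h
    have : z ∈ Z ∩ U := by rw [hZU]; exact ⟨hzU, h⟩
    exact hz.2 this.1
  obtain ⟨i, hi⟩ := hex
  filter_upwards [hU.mem_nhds hzU,
    ((hF i).continuousOn.continuousAt (hU.mem_nhds hzU)).eventually_ne hi] with w hw hwi
  refine ⟨hUΩ hw, fun hwZ => ?_⟩
  have : w ∈ Z ∩ U := ⟨hwZ, hw⟩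
  rw [hZU] at this
  exact hwi (this.2 i)

theorem IsThinSubvariety.volume_eq_zero {n : ℕ} {Ω : TopologicalSpace.Opens (Fin n → ℂ)}
    {Z : Set (Fin n → ℂ)} (hZ : IsThinSubvariety Ω Z) : volume Z = 0 := by
  refine measure_null_of_locally_null _ fun z hz => ?_
  obtain ⟨U, hU, hzU, hUΩ, k, F, hF, hZU⟩ := hZ.2.2 z (hZ.1 hz)
  obtain ⟨r, hr, hball⟩ := Metric.isOpen_iff.1 hU z hzU
  refine ⟨ball z r ∩ Z,
    inter_mem (mem_nhdsWithin_of_mem_nhds (ball_mem_nhds z hr)) self_mem_nhdsWithin, ?_⟩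
  have hZU' : ∀ w ∈ ball z r, (w ∈ Z ↔ ∀ i, F i w = 0) := by
    intro w hw
    have : w ∈ Z ∩ U ↔ w ∈ U ∧ ∀ i, F i w = 0 := by rw [hZU]; rfl
    simpa [hball hw] using this
  have hex : ∃ i, ∃ a ∈ ball z r, F i a ≠ 0 := by
    by_contra! h
    have hsub : ball z r ⊆ interior Z :=
      interior_maximal (fun w hw => (hZU' w hw).2 fun i => h i w hw) isOpen_ball
    rw [hZ.2.1] at hsub
    exact hsub (mem_ball_self hr)
  obtain ⟨i, a, ha, hia⟩ := hex
  refine measure_mono_null (fun w hw => ?_)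
    (volume_zeros_inter_ball_eq_zero ((hF i).mono hball) ha hia)
  exact ⟨hw.1, (hZU' w hw.1).1 hw.2 i⟩

section holomorphicAut

variable {n : ℕ} {Ω : TopologicalSpace.Opens (Fin n → ℂ)} {σ : Equiv.Perm (Fin n → ℂ)}

theorem mapsTo_of_mem_holomorphicAut (hσ : σ ∈ holomorphicAut Ω) :
    MapsTo σ (Ω : Set (Fin n → ℂ)) Ω := by
  intro z hz
  by_contra hc
  exact hc (by rwa [σ.injective (hσ.1 (σ z) hc)])

theorem differentiableAt_of_mem_holomorphicAut (hσ : σ ∈ holomorphicAut Ω) {z : Fin n → ℂ}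
    (hz : z ∈ Ω) : DifferentiableAt ℂ σ z :=
  hσ.2.1.differentiableAt (Ω.isOpen.mem_nhds hz)

theorem image_of_mem_holomorphicAut (hσ : σ ∈ holomorphicAut Ω) :
    σ '' (Ω : Set (Fin n → ℂ)) = Ω := by
  refine Subset.antisymm (mapsTo_of_mem_holomorphicAut hσ).image_subset fun z hz => ?_
  have h := mapsTo_of_mem_holomorphicAut (inv_mem hσ) hz
  exact ⟨σ⁻¹ z, h, by simp⟩

/-- The image of an open subset of `Ω` under an automorphism of `Ω` is open. -/
theorem isOpen_image_of_mem_holomorphicAut (hσ : σ ∈ holomorphicAut Ω) {V : Set (Fin n → ℂ)}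
    (hV : IsOpen V) (hVΩ : V ⊆ Ω) : IsOpen (σ '' V) := by
  have h : σ '' V = (Ω : Set (Fin n → ℂ)) ∩ σ.symm ⁻¹' V := by
    ext z
    rw [Equiv.image_eq_preimage_symm, mem_inter_iff, mem_preimage]
    refine ⟨fun h => ⟨?_, h⟩, fun h => h.2⟩
    have := mapsTo_of_mem_holomorphicAut hσ (hVΩ h)
    simpa using this
  rw [h]
  exact hσ.2.2.continuousOn.isOpen_inter_preimage Ω.isOpen hV

theorem det_fderiv_ne_zero_of_mem_holomorphicAut (hσ : σ ∈ holomorphicAut Ω) {z : Fin n → ℂ}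
    (hz : z ∈ Ω) : (fderiv ℂ σ z).det ≠ 0 := by
  have h1 := (differentiableAt_of_mem_holomorphicAut hσ hz).hasFDerivAt
  have h2 := (differentiableAt_of_mem_holomorphicAut (inv_mem hσ)
    (mapsTo_of_mem_holomorphicAut hσ hz)).hasFDerivAt
  have h3 := h2.comp z h1
  have h4 : (⇑(σ⁻¹) ∘ σ) = id := by ext1 x; simp
  rw [h4] at h3
  have h5 := congrArg ContinuousLinearMap.det (h3.unique (hasFDerivAt_id z))
  intro h0
  have h6 : ((fderiv ℂ (⇑σ⁻¹) (σ z)).comp (fderiv ℂ σ z)).det =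
      (fderiv ℂ (⇑σ⁻¹) (σ z)).det * (fderiv ℂ σ z).det :=
    LinearMap.det_comp _ _
  rw [h6, h0, mul_zero] at h5
  have h7 : (ContinuousLinearMap.id ℂ (Fin n → ℂ)).det = 1 := LinearMap.det_id
  rw [h7] at h5
  exact zero_ne_one h5

end holomorphicAut

/-! ### Maps of quotient type: the group and a fundamental domain -/

namespace IsQuotientType

variable {n : ℕ} {Ω₁ Ω₂ : TopologicalSpace.Opens (Fin n → ℂ)} {Φ : (Fin n → ℂ) → (Fin n → ℂ)}
  {Γ : Subgroup (Equiv.Perm (Fin n → ℂ))}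

/-- The elements of `Γ` are deck transformations on all of `Ω₁`. -/
theorem apply_eq (hΦ : IsQuotientType Ω₁ Ω₂ Φ Γ) {σ : Equiv.Perm (Fin n → ℂ)} (hσ : σ ∈ Γ)
    {z : Fin n → ℂ} (hz : z ∈ Ω₁) : Φ (σ z) = Φ z := by
  obtain ⟨Z₁, Z₂, hZ₁, hZ₂, ⟨hm, -, -⟩, hfib⟩ := hΦ.exists_covering
  have haut := hΦ.le_aut hσ
  have heq : EqOn (fun z => Φ (σ z)) Φ ((Ω₁ : Set (Fin n → ℂ)) \ Z₁) := fun x hx =>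
    (hfib (Φ x) (hm hx)).1 σ hσ x hx.1 rfl
  have hcl : (Ω₁ : Set (Fin n → ℂ)) ⊆ closure ((Ω₁ : Set (Fin n → ℂ)) \ Z₁) := by
    intro x hx
    have h1 : x ∈ closure Z₁ᶜ := by
      rw [closure_compl, hZ₁.2.1]
      simp
    exact Ω₁.isOpen.inter_closure ⟨hx, h1⟩
  exact heq.of_subset_closure
    (hΦ.holomorphic.continuousOn.comp haut.2.1.continuousOn (mapsTo_of_mem_holomorphicAut haut))
    hΦ.holomorphic.continuousOn sdiff_subset hcl hz

theorem differentiableAt (hΦ : IsQuotientType Ω₁ Ω₂ Φ Γ) {z : Fin n → ℂ} (hz : z ∈ Ω₁) :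
    DifferentiableAt ℂ Φ z :=
  hΦ.holomorphic.differentiableAt (Ω₁.isOpen.mem_nhds hz)

theorem det_fderiv_mul (hΦ : IsQuotientType Ω₁ Ω₂ Φ Γ) {σ : Equiv.Perm (Fin n → ℂ)} (hσ : σ ∈ Γ)
    {z : Fin n → ℂ} (hz : z ∈ Ω₁) :
    (fderiv ℂ Φ (σ z)).det * (fderiv ℂ σ z).det = (fderiv ℂ Φ z).det := by
  have haut := hΦ.le_aut hσ
  have h1 := (differentiableAt_of_mem_holomorphicAut haut hz).hasFDerivAt
  have h2 := (hΦ.differentiableAt (mapsTo_of_mem_holomorphicAut haut hz)).hasFDerivAt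
  have h3 : HasFDerivAt Φ ((fderiv ℂ Φ (σ z)).comp (fderiv ℂ σ z)) z := by
    refine (h2.comp z h1).congr_of_eventuallyEq ?_
    filter_upwards [Ω₁.isOpen.mem_nhds hz] with x hx using (hΦ.apply_eq hσ hx).symm
  rw [h3.fderiv]
  exact (LinearMap.det_comp _ _).symm

/-- An element of `Γ` is the identity if it fixes a point near which `Φ` is injective. -/
theorem eq_one_of_fixed (hc₁ : IsConnected (Ω₁ : Set (Fin n → ℂ)))
    (hΦ : IsQuotientType Ω₁ Ω₂ Φ Γ) {σ : Equiv.Perm (Fin n → ℂ)} (hσ : σ ∈ Γ)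
    {V : Set (Fin n → ℂ)} (hV : IsOpen V) (hVΩ : V ⊆ Ω₁) (hinj : InjOn Φ V) {z : Fin n → ℂ}
    (hz : z ∈ V) (hfix : σ z = z) : σ = 1 := by
  have haut := hΦ.le_aut hσ
  have hev : ∀ᶠ x in 𝓝 z, σ x = x := by
    have hcont : ContinuousAt σ z := (differentiableAt_of_mem_holomorphicAut haut
      (hVΩ hz)).continuousAt
    filter_upwards [hV.mem_nhds hz, hcont.preimage_mem_nhds (hV.mem_nhds (by rwa [hfix]))]
      with x hx hx'
    exact hinj hx' hx (hΦ.apply_eq hσ (hVΩ hx))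
  obtain ⟨r, hr, hball⟩ := Metric.eventually_nhds_iff_ball.1
    (hev.and (Ω₁.isOpen.eventually_mem (hVΩ hz)))
  have hall : ∀ x ∈ Ω₁, σ x = x := by
    intro x hx
    ext i
    have hd : DifferentiableOn ℂ (fun x => σ x i - x i) Ω₁ :=
      (differentiableOn_pi.1 haut.2.1 i).sub (by fun_prop)
    rcases eqOn_zero_or_volume_zeros_eq_zero Ω₁.isOpen hc₁.isPreconnected hd with h | h
    · exact sub_eq_zero.1 (h x hx)
    · have hsub : ball z r ⊆ (Ω₁ : Set (Fin n → ℂ)) ∩ {x | σ x i - x i = 0} := fun y hy =>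
        ⟨(hball y hy).2, by simp [(hball y hy).1]⟩
      exact absurd (measure_mono_null hsub h) (measure_ball_pos volume z hr).ne'
  ext1 x
  by_cases hx : x ∈ Ω₁
  · exact hall x hx
  · exact haut.1 x hx

/-- The map `Φ` is locally injective off the subvariety `Z₁`. -/
theorem exists_injOn_of_isCoveringMap {Z₁ Z₂ : Set (Fin n → ℂ)}
    (ho : IsOpen ((Ω₁ : Set (Fin n → ℂ)) \ Z₁))
    (hm : MapsTo Φ ((Ω₁ : Set (Fin n → ℂ)) \ Z₁) ((Ω₂ : Set (Fin n → ℂ)) \ Z₂))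
    (hcov : IsCoveringMap hm.restrict) {z : Fin n → ℂ} (hz : z ∈ (Ω₁ : Set (Fin n → ℂ)) \ Z₁) :
    ∃ V : Set (Fin n → ℂ), IsOpen V ∧ z ∈ V ∧ V ⊆ (Ω₁ : Set (Fin n → ℂ)) \ Z₁ ∧ InjOn Φ V := by
  obtain ⟨U, hU, hzU, hinj⟩ := hcov.isLocalHomeomorph.isLocallyInjective ⟨z, hz⟩
  refine ⟨Subtype.val '' U, ho.isOpenMap_subtype_val U hU, ⟨⟨z, hz⟩, hzU, rfl⟩, ?_, ?_⟩
  · rintro _ ⟨x, -, rfl⟩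
    exact x.2
  · rintro _ ⟨x, hx, rfl⟩ _ ⟨y, hy, rfl⟩ hxy
    exact congrArg Subtype.val (hinj hx hy (Subtype.ext hxy))

/-- The group `Γ` is finite: it acts simply transitively on a fibre, which is compact because `Φ`
is proper, and discrete because `Φ` is locally injective at one of its points. -/
theorem finite_group (hc₁ : IsConnected (Ω₁ : Set (Fin n → ℂ)))
    (hc₂ : IsConnected (Ω₂ : Set (Fin n → ℂ))) (hΦ : IsQuotientType Ω₁ Ω₂ Φ Γ) : Finite Γ := by
  obtain ⟨Z₁, Z₂, hZ₁, hZ₂, ⟨hm, hcov, hsurj⟩, hfib⟩ := hΦ.exists_covering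
  obtain ⟨w, hw⟩ : ((Ω₂ : Set (Fin n → ℂ)) \ Z₂).Nonempty := by
    by_contra h
    rw [not_nonempty_iff_eq_empty, sdiff_eq_empty] at h
    have := interior_maximal h Ω₂.isOpen
    rw [hZ₂.2.1] at this
    exact this hc₂.nonempty.some_mem
  obtain ⟨⟨z₀, hz₀⟩, hzw⟩ := hsurj ⟨w, hw⟩
  have hzw : Φ z₀ = w := congrArg Subtype.val hzw
  obtain ⟨V, hV, hzV, hVsub, hinj⟩ := exists_injOn_of_isCoveringMap hZ₁.isOpen_diff hm hcov hz₀
  have hVΩ : V ⊆ (Ω₁ : Set (Fin n → ℂ)) := hVsub.trans sdiff_subset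
  have hK : IsCompact {z | z ∈ Ω₁ ∧ Φ z = w} := by
    have h1 := (hΦ.proper.isCompact_preimage
      (isCompact_singleton (x := (⟨w, hw.1⟩ : (Ω₂ : Set (Fin n → ℂ)))))).image
      continuous_subtype_val
    convert h1 using 1
    ext z
    constructor
    · rintro ⟨h2, h3⟩
      exact ⟨⟨z, h2⟩, Subtype.ext h3, rfl⟩
    · rintro ⟨⟨y, hy⟩, h2, rfl⟩
      exact ⟨hy, congrArg Subtype.val h2⟩
  obtain ⟨t, ht⟩ := hK.elim_finite_subcover (fun σ : Γ => (σ : Equiv.Perm (Fin n → ℂ)) '' V)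
    (fun σ => isOpen_image_of_mem_holomorphicAut (hΦ.le_aut σ.2) hV hVΩ) (by
      rintro z ⟨hz, hzw'⟩
      obtain ⟨σ, hσ, h⟩ := (hfib w hw).2 z₀ hz₀.1 z hz hzw hzw'
      exact mem_iUnion.2 ⟨⟨σ, hσ⟩, z₀, hzV, h⟩)
  refine Set.finite_univ_iff.1 (t.finite_toSet.subset fun τ _ => ?_)
  have hτ := mapsTo_of_mem_holomorphicAut (hΦ.le_aut τ.2) hz₀.1
  obtain ⟨σ, hσt, v, hv, hvτ⟩ := by
    simpa only [mem_iUnion, exists_prop] using ht ⟨hτ, (hΦ.apply_eq τ.2 hz₀.1).trans hzw⟩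
  have h1 : v = z₀ := by
    refine hinj hv hzV ?_
    rw [← hΦ.apply_eq σ.2 (hVΩ hv), hvτ, hΦ.apply_eq τ.2 hz₀.1]
  have h2 : (τ⁻¹ * σ : Γ) = 1 := by
    have := hΦ.eq_one_of_fixed hc₁ (τ⁻¹ * σ : Γ).2 hV hVΩ hinj hzV (by
      rw [h1] at hvτ
      simp [hvτ])
    exact Subtype.ext this
  rw [inv_mul_eq_one] at h2
  rw [h2]
  exact hσt

/-- There is a Borel fundamental domain `D` for the action of `Γ`, which `Φ` maps injectively onto
almost all of `Ω₂`. -/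
theorem exists_fundamentalDomain (hc₁ : IsConnected (Ω₁ : Set (Fin n → ℂ)))
    (hΦ : IsQuotientType Ω₁ Ω₂ Φ Γ) :
    ∃ D : Set (Fin n → ℂ), MeasurableSet D ∧ D ⊆ Ω₁ ∧ InjOn Φ D ∧
      Φ '' D =ᵐ[volume] (Ω₂ : Set (Fin n → ℂ)) ∧
      Pairwise (Function.onFun Disjoint fun σ : Γ => (σ : Equiv.Perm (Fin n → ℂ)) '' D) ∧
      (⋃ σ : Γ, (σ : Equiv.Perm (Fin n → ℂ)) '' D) =ᵐ[volume] (Ω₁ : Set (Fin n → ℂ)) := by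
  obtain ⟨Z₁, Z₂, hZ₁, hZ₂, ⟨hm, hcov, hsurj⟩, hfib⟩ := hΦ.exists_covering
  set G : Set (Fin n → ℂ) := (Ω₁ : Set (Fin n → ℂ)) \ Z₁ with hG
  set W : Set (Fin n → ℂ) := (Ω₂ : Set (Fin n → ℂ)) \ Z₂ with hW
  have hGΩ : G ⊆ Ω₁ := sdiff_subset
  -- `Φ` is injective on each of countably many open sets that cover `Ω₁ \ Z₁`; `D` consists of the
  -- points of the `i`-th set whose image is not already covered by the image of an earlier set.
  obtain ⟨V, hVo, hVinj, hVG, hVcov⟩ : ∃ V : ℕ → Set (Fin n → ℂ), (∀ i, IsOpen (V i)) ∧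
      (∀ i, InjOn Φ (V i)) ∧ (∀ i, V i ⊆ G) ∧ ∀ z ∈ G, ∃ i, z ∈ V i := by
    set S := {b ∈ TopologicalSpace.countableBasis (Fin n → ℂ) | b ⊆ G ∧ InjOn Φ b}
    have hSc : (insert ∅ S).Countable :=
      ((TopologicalSpace.countable_countableBasis _).mono (sep_subset _ _)).insert _
    obtain ⟨V, hV⟩ := hSc.exists_eq_range (insert_nonempty _ _)
    have hVS : ∀ i, V i = ∅ ∨ V i ∈ S := fun i => by
      have : V i ∈ insert ∅ S := by rw [hV]; exact mem_range_self i
      simpa using this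
    refine ⟨V, fun i => ?_, fun i => ?_, fun i => ?_, fun z hz => ?_⟩
    · rcases hVS i with h | h
      · rw [h]; exact isOpen_empty
      · exact TopologicalSpace.isOpen_of_mem_countableBasis h.1
    · rcases hVS i with h | h
      · rw [h]; exact injOn_empty _
      · exact h.2.2
    · rcases hVS i with h | h
      · rw [h]; exact empty_subset _
      · exact h.2.1
    · obtain ⟨U, hU, hzU, hUG, hUinj⟩ := exists_injOn_of_isCoveringMap hZ₁.isOpen_diff hm hcov hz
      obtain ⟨b, hb, hzb, hbU⟩ := (TopologicalSpace.isBasis_countableBasis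
        (Fin n → ℂ)).exists_subset_of_mem_open hzU hU
      have hbS : b ∈ insert ∅ S := Or.inr ⟨hb, hbU.trans hUG, hUinj.mono hbU⟩
      rw [hV] at hbS
      obtain ⟨i, rfl⟩ := hbS
      exact ⟨i, hzb⟩
  have hcont : ContinuousOn Φ G := hΦ.holomorphic.continuousOn.mono hGΩ
  have hVim : ∀ i, MeasurableSet (Φ '' V i) := fun i =>
    (hVo i).measurableSet.image_of_continuousOn_injOn (hcont.mono (hVG i)) (hVinj i)
  set D : Set (Fin n → ℂ) := ⋃ i, V i ∩ Φ ⁻¹' (⋃ j < i, Φ '' V j)ᶜ with hD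
  have hDm : MeasurableSet D := by
    refine MeasurableSet.iUnion fun i => ?_
    have h1 : MeasurableSet ((⋃ j < i, Φ '' V j)ᶜ) :=
      (MeasurableSet.iUnion fun j => MeasurableSet.iUnion fun _ => hVim j).compl
    have h2 : Measurable ((V i).domRestrict Φ) :=
      (hcont.mono (hVG i)).domRestrict.measurable
    have h3 := (hVo i).measurableSet.subtype_image (h2 h1)
    convert h3 using 1
    ext z
    simp [and_comm]
  have hDG : D ⊆ G := iUnion_subset fun i => inter_subset_left.trans (hVG i)
  have hDinj : InjOn Φ D := by
    intro x hx y hy hxy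
    obtain ⟨i, hxi, hxi'⟩ := mem_iUnion.1 hx
    obtain ⟨j, hyj, hyj'⟩ := mem_iUnion.1 hy
    rcases lt_trichotomy i j with h | h | h
    · refine absurd ?_ hyj'
      exact mem_iUnion₂.2 ⟨i, h, x, hxi, hxy⟩
    · subst h
      exact hVinj i hxi hyj hxy
    · refine absurd ?_ hxi'
      exact mem_iUnion₂.2 ⟨j, h, y, hyj, hxy.symm⟩
  have hDim : Φ '' D = W := by
    refine Subset.antisymm ?_ fun w hw => ?_
    · rintro _ ⟨z, hz, rfl⟩
      exact hm (hDG hz)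
    · classical
      obtain ⟨⟨z, hz⟩, hzw⟩ := hsurj ⟨w, hw⟩
      have hzw : Φ z = w := congrArg Subtype.val hzw
      have hex : ∃ i, w ∈ Φ '' V i := by
        obtain ⟨i, hi⟩ := hVcov z hz
        exact ⟨i, z, hi, hzw⟩
      obtain ⟨x, hx, hxw⟩ := Nat.find_spec hex
      refine ⟨x, mem_iUnion.2 ⟨Nat.find hex, hx, ?_⟩, hxw⟩
      rw [mem_preimage, mem_compl_iff, mem_iUnion₂, hxw]
      rintro ⟨j, hj, hj'⟩
      exact Nat.find_min hex hj hj'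
  refine ⟨D, hDm, hDG.trans hGΩ, hDinj, ?_, ?_, ?_⟩
  · rw [hDim]
    exact sdiff_null_ae_eq_self hZ₂.volume_eq_zero
  · intro σ τ hne
    refine Set.disjoint_left.2 ?_
    rintro _ ⟨x, hx, rfl⟩ ⟨y, hy, hxy⟩
    have hyx : y = x := by
      refine hDinj hy hx ?_
      rw [← hΦ.apply_eq τ.2 (hGΩ (hDG hy)), hxy, hΦ.apply_eq σ.2 (hGΩ (hDG hx))]
    obtain ⟨U, hU, hxU, hUG, hUinj⟩ :=
      exists_injOn_of_isCoveringMap hZ₁.isOpen_diff hm hcov (hDG hx)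
    have h1 : (σ⁻¹ * τ : Γ) = 1 := Subtype.ext <|
      hΦ.eq_one_of_fixed hc₁ (σ⁻¹ * τ : Γ).2 hU (hUG.trans hGΩ) hUinj hxU (by
        rw [hyx] at hxy
        simp [hxy])
    exact hne (inv_mul_eq_one.1 h1)
  · have hsub : (⋃ σ : Γ, (σ : Equiv.Perm (Fin n → ℂ)) '' D) ⊆ Ω₁ := by
      refine iUnion_subset fun σ => ?_
      rintro _ ⟨x, hx, rfl⟩
      exact mapsTo_of_mem_holomorphicAut (hΦ.le_aut σ.2) (hGΩ (hDG hx))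
    have hsup : G ⊆ ⋃ σ : Γ, (σ : Equiv.Perm (Fin n → ℂ)) '' D := by
      intro z hz
      have hzW := hm hz
      rw [← hDim] at hzW
      obtain ⟨x, hx, hxz⟩ := hzW
      obtain ⟨σ, hσ, h⟩ := (hfib (Φ z) (hm hz)).2 x (hGΩ (hDG hx)) z (hGΩ hz) hxz rfl
      exact mem_iUnion.2 ⟨⟨σ, hσ⟩, x, hx, h⟩
    have hGae : G =ᵐ[volume] (Ω₁ : Set (Fin n → ℂ)) := sdiff_null_ae_eq_self hZ₁.volume_eq_zero
    exact (LE.le.eventuallyLE hsub).antisymm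
      (hGae.symm.le.trans (LE.le.eventuallyLE hsup))

end IsQuotientType

/-! ### Pullback by maps which push forward the volume -/

/-- The holomorphic map `φ : Ω₁ → Ω₂` has nonzero Jacobian almost everywhere and is almost
everywhere `m`-to-one, in the sense that it pushes `|det φ'|² dV` forward to `m dV`. Both the
quotient map `Φ` (with `m = |Γ|`) and the automorphisms (with `m = 1`) are of this kind. -/
structure PushesVolume {n : ℕ} (Ω₁ Ω₂ : TopologicalSpace.Opens (Fin n → ℂ))
    (φ : (Fin n → ℂ) → (Fin n → ℂ)) (m : ℕ) : Prop where
  holomorphic : DifferentiableOn ℂ φ Ω₁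
  mapsTo : MapsTo φ (Ω₁ : Set (Fin n → ℂ)) Ω₂
  pos : 0 < m
  map_eq : Measure.map φ ((lebesgueOn Ω₁).withDensity fun z => ‖(fderiv ℂ φ z).det‖ₑ ^ 2) =
    (m : ℝ≥0∞) • lebesgueOn Ω₂
  det_ne_zero : ∀ᵐ z ∂lebesgueOn Ω₁, (fderiv ℂ φ z).det ≠ 0

theorem pushesVolume_of_mem_holomorphicAut {n : ℕ} {Ω : TopologicalSpace.Opens (Fin n → ℂ)}
    {σ : Equiv.Perm (Fin n → ℂ)} (hσ : σ ∈ holomorphicAut Ω) : PushesVolume Ω Ω σ 1 where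
  holomorphic := hσ.2.1
  mapsTo := mapsTo_of_mem_holomorphicAut hσ
  pos := one_pos
  map_eq := by
    rw [map_withDensity_enorm_det_sq Ω.isOpen.measurableSet
      (fun z hz => differentiableAt_of_mem_holomorphicAut hσ hz) σ.injective.injOn,
      image_of_mem_holomorphicAut hσ, Nat.cast_one, one_smul]
  det_ne_zero := by
    filter_upwards [ae_restrict_mem Ω.isOpen.measurableSet] with z hz
    exact det_fderiv_ne_zero_of_mem_holomorphicAut hσ hz

/-- A map of quotient type pushes `|det Φ'|² dV` forward to `|Γ| dV`, since it maps each of the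
translates of a fundamental domain injectively onto almost all of `Ω₂`. -/
theorem IsQuotientType.pushesVolume {n : ℕ} {Ω₁ Ω₂ : TopologicalSpace.Opens (Fin n → ℂ)}
    {Φ : (Fin n → ℂ) → (Fin n → ℂ)} {Γ : Subgroup (Equiv.Perm (Fin n → ℂ))}
    (hc₁ : IsConnected (Ω₁ : Set (Fin n → ℂ))) (hc₂ : IsConnected (Ω₂ : Set (Fin n → ℂ)))
    (hΦ : IsQuotientType Ω₁ Ω₂ Φ Γ) : PushesVolume Ω₁ Ω₂ Φ (Nat.card Γ) := by
  have hfin : Finite Γ := hΦ.finite_group hc₁ hc₂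
  obtain ⟨D, hDm, hDΩ, hDinj, hDim, hDdisj, hDcov⟩ := hΦ.exists_fundamentalDomain hc₁
  have hσΩ : ∀ σ : Γ, (σ : Equiv.Perm (Fin n → ℂ)) '' D ⊆ Ω₁ := fun σ => by
    rintro _ ⟨x, hx, rfl⟩
    exact mapsTo_of_mem_holomorphicAut (hΦ.le_aut σ.2) (hDΩ hx)
  have hσm : ∀ σ : Γ, MeasurableSet ((σ : Equiv.Perm (Fin n → ℂ)) '' D) := fun σ =>
    hDm.image_of_continuousOn_injOn ((hΦ.le_aut σ.2).2.1.continuousOn.mono hDΩ)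
      (Equiv.injective _).injOn
  have hσinj : ∀ σ : Γ, InjOn Φ ((σ : Equiv.Perm (Fin n → ℂ)) '' D) := by
    rintro σ _ ⟨x, hx, rfl⟩ _ ⟨y, hy, rfl⟩ hxy
    rw [hΦ.apply_eq σ.2 (hDΩ hx), hΦ.apply_eq σ.2 (hDΩ hy)] at hxy
    rw [hDinj hx hy hxy]
  have hσim : ∀ σ : Γ, Φ '' ((σ : Equiv.Perm (Fin n → ℂ)) '' D) = Φ '' D := fun σ => by
    rw [image_image]
    exact image_congr fun x hx => hΦ.apply_eq σ.2 (hDΩ hx)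
  have hmeas : AEMeasurable Φ (lebesgueOn Ω₁) :=
    hΦ.holomorphic.continuousOn.aemeasurable Ω₁.isOpen.measurableSet
  have hrestr : lebesgueOn Ω₁ =
      Measure.sum fun σ : Γ => volume.restrict ((σ : Equiv.Perm (Fin n → ℂ)) '' D) := by
    rw [← Measure.restrict_iUnion hDdisj hσm, Measure.restrict_congr_set hDcov]
  have hmap : Measure.map Φ
      ((lebesgueOn Ω₁).withDensity fun z => ‖(fderiv ℂ Φ z).det‖ₑ ^ 2) =
      (Nat.card Γ : ℝ≥0∞) • lebesgueOn Ω₂ := by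
    have hac := hmeas.mono_ac (withDensity_absolutelyContinuous (lebesgueOn Ω₁)
      fun z => ‖(fderiv ℂ Φ z).det‖ₑ ^ 2)
    rw [hrestr, withDensity_sum] at hac ⊢
    rw [Measure.map_sum hac]
    have : ∀ σ : Γ, Measure.map Φ ((volume.restrict
        ((σ : Equiv.Perm (Fin n → ℂ)) '' D)).withDensity fun z => ‖(fderiv ℂ Φ z).det‖ₑ ^ 2) =
        lebesgueOn Ω₂ := fun σ => by
      rw [map_withDensity_enorm_det_sq (hσm σ) (fun z hz => hΦ.differentiableAt (hσΩ σ hz))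
        (hσinj σ), hσim, Measure.restrict_congr_set hDim]
    simp only [this]
    have := Fintype.ofFinite Γ
    rw [Measure.sum_fintype, Finset.sum_const, Finset.card_univ, Nat.card_eq_fintype_card,
      Nat.cast_smul_eq_nsmul]
  refine ⟨hΦ.holomorphic, hΦ.mapsTo, Nat.card_pos, hmap, ?_⟩
  rcases eqOn_zero_or_volume_zeros_eq_zero Ω₁.isOpen hc₁.isPreconnected
    (hΦ.holomorphic.det_fderiv Ω₁.isOpen) with h | h
  · exfalso
    have h0 : (lebesgueOn Ω₁).withDensity (fun z => ‖(fderiv ℂ Φ z).det‖ₑ ^ 2) = 0 := by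
      rw [withDensity_eq_zero_iff (by
        exact ((measurable_det_fderiv Φ).enorm.pow_const 2).aemeasurable)]
      filter_upwards [ae_restrict_mem Ω₁.isOpen.measurableSet] with z hz
      simp [h z hz]
    rw [h0, Measure.map_zero] at hmap
    have h1 := congrArg (fun μ : Measure (Fin n → ℂ) => μ univ) hmap
    have h2 : volume (Ω₂ : Set (Fin n → ℂ)) ≠ 0 := (Ω₂.isOpen.measure_pos _ hc₂.nonempty).ne'
    simp [h2, Nat.card_pos.ne'] at h1
  · rw [ae_iff, Measure.restrict_apply' Ω₁.isOpen.measurableSet]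
    simpa [inter_comm, Set.inter_def] using h

namespace PushesVolume

variable {n : ℕ} {Ω₁ Ω₂ : TopologicalSpace.Opens (Fin n → ℂ)} {φ : (Fin n → ℂ) → (Fin n → ℂ)}
  {m : ℕ}

theorem measurable_weight (φ : (Fin n → ℂ) → (Fin n → ℂ)) :
    Measurable fun z => ‖(fderiv ℂ φ z).det‖ₑ ^ 2 :=
  (measurable_det_fderiv φ).enorm.pow_const 2

theorem aemeasurable (h : PushesVolume Ω₁ Ω₂ φ m) : AEMeasurable φ (lebesgueOn Ω₁) :=
  h.holomorphic.continuousOn.aemeasurable Ω₁.isOpen.measurableSet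

theorem aemeasurable_withDensity (h : PushesVolume Ω₁ Ω₂ φ m) :
    AEMeasurable φ ((lebesgueOn Ω₁).withDensity fun z => ‖(fderiv ℂ φ z).det‖ₑ ^ 2) :=
  h.aemeasurable.mono_ac (withDensity_absolutelyContinuous _ _)

theorem absolutelyContinuous_withDensity (h : PushesVolume Ω₁ Ω₂ φ m) :
    lebesgueOn Ω₁ ≪ (lebesgueOn Ω₁).withDensity fun z => ‖(fderiv ℂ φ z).det‖ₑ ^ 2 := by
  refine withDensity_absolutelyContinuous' (measurable_weight φ).aemeasurable ?_
  filter_upwards [h.det_ne_zero] with z hz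
  simpa using hz

theorem map_absolutelyContinuous (h : PushesVolume Ω₁ Ω₂ φ m) :
    Measure.map φ (lebesgueOn Ω₁) ≪ lebesgueOn Ω₂ := by
  have h1 := h.absolutelyContinuous_withDensity
  have h2 : Measure.map φ (lebesgueOn Ω₁) ≪ Measure.map φ
      ((lebesgueOn Ω₁).withDensity fun z => ‖(fderiv ℂ φ z).det‖ₑ ^ 2) := by
    refine Measure.AbsolutelyContinuous.mk fun s hs h0 => ?_
    rw [Measure.map_apply_of_aemeasurable h.aemeasurable hs]
    rw [Measure.map_apply_of_aemeasurable h.aemeasurable_withDensity hs] at h0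
    exact h1 h0
  rw [h.map_eq] at h2
  exact h2.trans (Measure.smul_absolutelyContinuous)

theorem ae_comp (h : PushesVolume Ω₁ Ω₂ φ m) {P : (Fin n → ℂ) → Prop}
    (hP : ∀ᵐ w ∂lebesgueOn Ω₂, P w) : ∀ᵐ z ∂lebesgueOn Ω₁, P (φ z) :=
  ae_of_ae_map h.aemeasurable (h.map_absolutelyContinuous.ae_le hP)

theorem sharpPullback_congr (h : PushesVolume Ω₁ Ω₂ φ m) {f g : (Fin n → ℂ) → ℂ}
    (hfg : f =ᵐ[lebesgueOn Ω₂] g) :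
    sharpPullback φ f =ᵐ[lebesgueOn Ω₁] sharpPullback φ g := by
  filter_upwards [h.ae_comp hfg] with z hz
  simp only [sharpPullback, hz]

theorem aestronglyMeasurable_comp (h : PushesVolume Ω₁ Ω₂ φ m) {f : (Fin n → ℂ) → ℂ}
    (hf : AEStronglyMeasurable f (lebesgueOn Ω₂)) :
    AEStronglyMeasurable (fun z => f (φ z)) (lebesgueOn Ω₁) :=
  (hf.mono_ac h.map_absolutelyContinuous).comp_aemeasurable h.aemeasurable

theorem aestronglyMeasurable_sharpPullback (h : PushesVolume Ω₁ Ω₂ φ m) {f : (Fin n → ℂ) → ℂ}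
    (hf : AEStronglyMeasurable f (lebesgueOn Ω₂)) :
    AEStronglyMeasurable (sharpPullback φ f) (lebesgueOn Ω₁) :=
  (h.aestronglyMeasurable_comp hf).mul (measurable_det_fderiv φ).aestronglyMeasurable

theorem lintegral_comp (h : PushesVolume Ω₁ Ω₂ φ m) {F : (Fin n → ℂ) → ℝ≥0∞}
    (hF : AEMeasurable F (lebesgueOn Ω₂)) :
    ∫⁻ z, F (φ z) * ‖(fderiv ℂ φ z).det‖ₑ ^ 2 ∂lebesgueOn Ω₁ = m * ∫⁻ w, F w ∂lebesgueOn Ω₂ := by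
  have hF' : AEMeasurable F ((m : ℝ≥0∞) • lebesgueOn Ω₂) :=
    hF.mono_ac Measure.smul_absolutelyContinuous
  have h1 := congrArg (fun μ => ∫⁻ w, F w ∂μ) h.map_eq
  rw [lintegral_map' (by rwa [h.map_eq]) h.aemeasurable_withDensity,
    lintegral_withDensity_eq_lintegral_mul₀ (g := fun z => F (φ z))
      (measurable_weight φ).aemeasurable
      ((hF.mono_ac h.map_absolutelyContinuous).comp_aemeasurable h.aemeasurable)] at h1
  simpa [mul_comm] using h1

theorem integral_comp (h : PushesVolume Ω₁ Ω₂ φ m) {F : (Fin n → ℂ) → ℂ}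
    (hF : AEStronglyMeasurable F (lebesgueOn Ω₂)) :
    ∫ z, F (φ z) * ((‖(fderiv ℂ φ z).det‖ ^ 2 : ℝ) : ℂ) ∂lebesgueOn Ω₁ =
      m * ∫ w, F w ∂lebesgueOn Ω₂ := by
  have hF' : AEStronglyMeasurable F ((m : ℝ≥0∞) • lebesgueOn Ω₂) :=
    hF.mono_ac Measure.smul_absolutelyContinuous
  have h1 := congrArg (fun μ => ∫ w, F w ∂μ) h.map_eq
  rw [integral_map h.aemeasurable_withDensity (by rwa [h.map_eq])] at h1
  have h2 : (fun z => ‖(fderiv ℂ φ z).det‖ₑ ^ 2) =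
      fun z => ((‖(fderiv ℂ φ z).det‖₊ ^ 2 : ℝ≥0) : ℝ≥0∞) := by
    ext1 z
    simp [enorm_eq_nnnorm]
  rw [h2, integral_withDensity_eq_integral_smul
    (by exact (measurable_det_fderiv φ).nnnorm.pow_const 2)] at h1
  simp only [NNReal.smul_def, NNReal.coe_pow, coe_nnnorm, Complex.real_smul] at h1
  simp_rw [mul_comm (F _)]
  rw [h1]
  simp

/-- The measure `|det φ'|^{2-p} dV` has the same null sets as Lebesgue measure on `Ω₁`. -/
theorem jacobianMeasure_absolutelyContinuous (Ω₁ : TopologicalSpace.Opens (Fin n → ℂ))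
    (φ : (Fin n → ℂ) → (Fin n → ℂ)) (p : ℝ≥0∞) : jacobianMeasure Ω₁ φ p ≪ lebesgueOn Ω₁ :=
  withDensity_absolutelyContinuous _ _

theorem absolutelyContinuous_jacobianMeasure (h : PushesVolume Ω₁ Ω₂ φ m) (p : ℝ≥0∞) :
    lebesgueOn Ω₁ ≪ jacobianMeasure Ω₁ φ p := by
  refine withDensity_absolutelyContinuous'
    (by exact ((measurable_det_fderiv φ).enorm.pow_const _).aemeasurable) ?_
  filter_upwards [h.det_ne_zero] with z hz
  rw [Ne, ENNReal.rpow_eq_zero_iff]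
  simp [hz]

theorem ae_jacobianMeasure (h : PushesVolume Ω₁ Ω₂ φ m) (p : ℝ≥0∞) :
    ae (jacobianMeasure Ω₁ φ p) = ae (lebesgueOn Ω₁) :=
  le_antisymm (jacobianMeasure_absolutelyContinuous Ω₁ φ p).ae_le
    (h.absolutelyContinuous_jacobianMeasure p).ae_le

theorem _root_.jacobianMeasure_two (Ω₁ : TopologicalSpace.Opens (Fin n → ℂ))
    (φ : (Fin n → ℂ) → (Fin n → ℂ)) : jacobianMeasure Ω₁ φ 2 = lebesgueOn Ω₁ := by
  simp [jacobianMeasure]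

/-- The pullback multiplies norms by `m^{1/p}`: on the source, the weight turns the factor
`|det φ'|^p` into the real Jacobian `|det φ'|²`. -/
theorem eLpNorm_sharpPullback (h : PushesVolume Ω₁ Ω₂ φ m) {p : ℝ≥0∞} (hp0 : p ≠ 0) (hp : p ≠ ∞)
    {f : (Fin n → ℂ) → ℂ} (hf : AEStronglyMeasurable f (lebesgueOn Ω₂)) :
    eLpNorm (sharpPullback φ f) p (jacobianMeasure Ω₁ φ p) =
      (m : ℝ≥0∞) ^ (1 / p.toReal) * eLpNorm f p (lebesgueOn Ω₂) := by
  have hp' : 0 < p.toReal := ENNReal.toReal_pos hp0 hp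
  rw [eLpNorm_eq_lintegral_rpow_enorm_toReal hp0 hp, eLpNorm_eq_lintegral_rpow_enorm_toReal hp0 hp,
    ← ENNReal.mul_rpow_of_nonneg _ _ (by positivity)]
  congr 1
  rw [jacobianMeasure, lintegral_withDensity_eq_lintegral_mul₀
    (by exact ((measurable_det_fderiv φ).enorm.pow_const _).aemeasurable)
    ((h.aestronglyMeasurable_sharpPullback hf).enorm.pow_const _),
    ← h.lintegral_comp (hf.enorm.pow_const _)]
  refine lintegral_congr_ae ?_
  filter_upwards [h.det_ne_zero] with z hz
  have h1 : ‖(fderiv ℂ φ z).det‖ₑ ≠ 0 := by simpa using hz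
  simp only [Pi.mul_apply, sharpPullback, enorm_mul]
  rw [ENNReal.mul_rpow_of_nonneg _ _ hp'.le, mul_left_comm,
    ← ENNReal.rpow_add _ _ h1 enorm_ne_top]
  simp

theorem memLp_sharpPullback_iff (h : PushesVolume Ω₁ Ω₂ φ m) {p : ℝ≥0∞} (hp0 : p ≠ 0)
    (hp : p ≠ ∞) {f : (Fin n → ℂ) → ℂ} (hf : AEStronglyMeasurable f (lebesgueOn Ω₂)) :
    MemLp (sharpPullback φ f) p (jacobianMeasure Ω₁ φ p) ↔ MemLp f p (lebesgueOn Ω₂) := by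
  have h1 : (m : ℝ≥0∞) ^ (1 / p.toReal) ≠ 0 := by
    rw [Ne, ENNReal.rpow_eq_zero_iff]
    simp [h.pos.ne']
  have h2 : (m : ℝ≥0∞) ^ (1 / p.toReal) ≠ ∞ :=
    ENNReal.rpow_ne_top_of_nonneg (by positivity) (by simp)
  have h3 : AEStronglyMeasurable (sharpPullback φ f) (jacobianMeasure Ω₁ φ p) :=
    (h.aestronglyMeasurable_sharpPullback hf).mono_ac (jacobianMeasure_absolutelyContinuous _ _ _)
  rw [MemLp, MemLp, h.eLpNorm_sharpPullback hp0 hp hf, ENNReal.mul_lt_top_iff]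
  simp only [h3, hf, true_and]
  constructor
  · rintro (h4 | h4 | h4)
    · exact h4.2
    · exact absurd h4 h1
    · simp [h4]
  · exact fun h4 => Or.inl ⟨h2.lt_top, h4⟩

/-- The pullback is injective on classes of functions. -/
theorem ae_eq_of_sharpPullback_ae_eq (h : PushesVolume Ω₁ Ω₂ φ m) {f g : (Fin n → ℂ) → ℂ}
    (hf : AEStronglyMeasurable f (lebesgueOn Ω₂)) (hg : AEStronglyMeasurable g (lebesgueOn Ω₂))
    (hfg : sharpPullback φ f =ᵐ[lebesgueOn Ω₁] sharpPullback φ g) : f =ᵐ[lebesgueOn Ω₂] g := by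
  have h1 := h.lintegral_comp (hf.sub hg).enorm
  have h2 : ∫⁻ z, ‖(f - g) (φ z)‖ₑ * ‖(fderiv ℂ φ z).det‖ₑ ^ 2 ∂lebesgueOn Ω₁ = 0 := by
    rw [← lintegral_zero (μ := lebesgueOn Ω₁)]
    refine lintegral_congr_ae ?_
    filter_upwards [hfg, h.det_ne_zero] with z hz hz'
    simp only [sharpPullback] at hz
    simp [mul_right_cancel₀ hz' hz]
  rw [h2] at h1
  have h3 : ∫⁻ w, ‖(f - g) w‖ₑ ∂lebesgueOn Ω₂ = 0 := by
    rcases mul_eq_zero.1 h1.symm with h4 | h4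
    · exact absurd h4 (by simp [h.pos.ne'])
    · exact h4
  rw [lintegral_eq_zero_iff' (hf.sub hg).enorm] at h3
  filter_upwards [h3] with w hw
  simpa [sub_eq_zero] using hw

/-- The pullback of a holomorphic function is holomorphic. -/
theorem differentiableOn_sharpPullback (h : PushesVolume Ω₁ Ω₂ φ m) {f : (Fin n → ℂ) → ℂ}
    (hf : DifferentiableOn ℂ f Ω₂) : DifferentiableOn ℂ (sharpPullback φ f) Ω₁ :=
  (hf.comp h.holomorphic h.mapsTo).mul (h.holomorphic.det_fderiv Ω₁.isOpen)

/-- The pullback multiplies inner products by `m`. -/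
theorem integral_sharpPullback_mul_conj (h : PushesVolume Ω₁ Ω₂ φ m) {f g : (Fin n → ℂ) → ℂ}
    (hf : AEStronglyMeasurable f (lebesgueOn Ω₂)) (hg : AEStronglyMeasurable g (lebesgueOn Ω₂)) :
    ∫ z, sharpPullback φ f z * star (sharpPullback φ g z) ∂lebesgueOn Ω₁ =
      m * ∫ w, f w * star (g w) ∂lebesgueOn Ω₂ := by
  rw [← h.integral_comp (F := fun w => f w * star (g w))
    (hf.mul (continuous_star.comp_aestronglyMeasurable hg))]
  refine integral_congr_ae (Eventually.of_forall fun z => ?_)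
  simp only [sharpPullback, star_mul']
  have : ((‖(fderiv ℂ φ z).det‖ ^ 2 : ℝ) : ℂ) =
      (fderiv ℂ φ z).det * star (fderiv ℂ φ z).det := by
    push_cast
    exact (Complex.mul_conj' _).symm
  rw [this]
  ring

end PushesVolume

/-! ### The Cauchy-Riemann operator -/

/-- Twice the value of the `(0,1)`-form `∂̄F` at `z` on the vector `v`. -/
noncomputable def dbar {n : ℕ} (F : (Fin n → ℂ) → ℂ) (z v : Fin n → ℂ) : ℂ :=
  fderiv ℝ F z v + Complex.I * fderiv ℝ F z (Complex.I • v)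

section dbar

variable {n : ℕ} {F G : (Fin n → ℂ) → ℂ} {z : Fin n → ℂ}

/-- The form `∂̄F` is conjugate linear. -/
theorem dbar_smul_right (F : (Fin n → ℂ) → ℂ) (z : Fin n → ℂ) (c : ℂ) (v : Fin n → ℂ) :
    dbar F z (c • v) = star c * dbar F z v := by
  have h1 : c • v = c.re • v + c.im • (Complex.I • v) := by
    conv_lhs => rw [← Complex.re_add_im c]
    rw [add_smul, mul_smul, Complex.coe_smul, Complex.coe_smul]
  have h2 : Complex.I • (c • v) = c.re • (Complex.I • v) - c.im • v := by
    rw [h1, smul_add, smul_comm Complex.I c.re v, smul_comm Complex.I c.im, smul_smul,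
      Complex.I_mul_I, neg_one_smul, smul_neg, sub_eq_add_neg]
  have h3 : star c = (c.re : ℂ) - c.im * Complex.I := by
    apply Complex.ext <;> simp
  rw [dbar, dbar, h2, h1, h3]
  simp only [map_add, map_sub, map_smul, Complex.real_smul]
  linear_combination (c.im : ℂ) * fderiv ℝ F z (Complex.I • v) * Complex.I_mul_I

theorem dbar_sum_right {ι : Type*} (s : Finset ι) (v : ι → Fin n → ℂ) (F : (Fin n → ℂ) → ℂ)
    (z : Fin n → ℂ) : dbar F z (∑ i ∈ s, v i) = ∑ i ∈ s, dbar F z (v i) := by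
  simp only [dbar, Finset.smul_sum, map_sum, Finset.mul_sum, Finset.sum_add_distrib]

theorem dbar_mul (hF : DifferentiableAt ℝ F z) (hG : DifferentiableAt ℝ G z) (v : Fin n → ℂ) :
    dbar (fun x => F x * G x) z v = F z * dbar G z v + G z * dbar F z v := by
  simp only [dbar, fderiv_fun_mul hF hG, add_apply, smul_apply, smul_eq_mul]
  ring

theorem dbar_eq_zero (hF : DifferentiableAt ℂ F z) (v : Fin n → ℂ) : dbar F z v = 0 := by
  rw [dbar, hF.fderiv_restrictScalars ℝ]
  simp only [ContinuousLinearMap.coe_restrictScalars', map_smul, smul_eq_mul]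
  linear_combination fderiv ℂ F z v * Complex.I_mul_I

theorem dbar_star (hF : DifferentiableAt ℂ F z) (v : Fin n → ℂ) :
    dbar (fun x => star (F x)) z v = 2 * star (fderiv ℂ F z v) := by
  have h1 : HasFDerivAt (fun x => star (F x))
      ((starL' ℝ : ℂ ≃L[ℝ] ℂ).toContinuousLinearMap.comp ((fderiv ℂ F z).restrictScalars ℝ)) z :=
    (starL' ℝ : ℂ ≃L[ℝ] ℂ).toContinuousLinearMap.hasFDerivAt.comp z
      (hF.hasFDerivAt.restrictScalars ℝ)
  rw [dbar, h1.fderiv]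
  simp only [ContinuousLinearMap.comp_apply, ContinuousLinearMap.coe_restrictScalars', map_smul,
    ContinuousLinearEquiv.coe_coe, starL'_apply, smul_eq_mul, star_mul', Complex.star_def,
    Complex.conj_I]
  linear_combination -(starRingEnd ℂ (fderiv ℂ F z v)) * Complex.I_mul_I

theorem dbar_comp {Φ : (Fin n → ℂ) → (Fin n → ℂ)} (hΦ : DifferentiableAt ℂ Φ z)
    (hF : DifferentiableAt ℝ F (Φ z)) (v : Fin n → ℂ) :
    dbar (fun x => F (Φ x)) z v = dbar F (Φ z) (fderiv ℂ Φ z v) := by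
  have h1 : HasFDerivAt (fun x => F (Φ x))
      ((fderiv ℝ F (Φ z)).comp ((fderiv ℂ Φ z).restrictScalars ℝ)) z :=
    hF.hasFDerivAt.comp z (hΦ.hasFDerivAt.restrictScalars ℝ)
  rw [dbar, h1.fderiv, dbar]
  simp

/-- A real differentiable function is complex differentiable at the points where `∂̄` vanishes. -/
theorem differentiableAt_of_dbar_eq_zero (hF : DifferentiableAt ℝ F z)
    (h : ∀ v, dbar F z v = 0) : DifferentiableAt ℂ F z := by
  rw [differentiableAt_iff_restrictScalars ℝ hF]
  have hI : ∀ v, fderiv ℝ F z (Complex.I • v) = Complex.I * fderiv ℝ F z v := fun v => by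
    have := h v
    rw [dbar] at this
    linear_combination -Complex.I * this + fderiv ℝ F z (Complex.I • v) * Complex.I_mul_I
  refine ⟨⟨⟨⟨fderiv ℝ F z, map_add _⟩, fun c v => ?_⟩, (fderiv ℝ F z).continuous⟩, ?_⟩
  · have h1 : c • v = c.re • v + c.im • (Complex.I • v) := by
      conv_lhs => rw [← Complex.re_add_im c]
      rw [add_smul, mul_smul, Complex.coe_smul, Complex.coe_smul]
    simp only [RingHom.id_apply, smul_eq_mul]
    rw [h1, map_add, map_smul, map_smul, hI, Complex.real_smul, Complex.real_smul]
    conv_rhs => rw [← Complex.re_add_im c]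
    ring
  · ext v
    rfl

end dbar

/-! ### The adjugate vector field and Piola's identity -/

/-- The image of the constant vector field `v` under the adjugate of `Φ'`. -/
noncomputable def adjugateField {n : ℕ} (Φ : (Fin n → ℂ) → (Fin n → ℂ)) (v z : Fin n → ℂ) :
    Fin n → ℂ :=
  fun k => Matrix.detRowAlternating (Function.update (fun j => fderiv ℂ Φ z (Pi.single j 1)) k v)

theorem fderiv_adjugateField {n : ℕ} (Φ : (Fin n → ℂ) → (Fin n → ℂ)) (v z : Fin n → ℂ) :
    fderiv ℂ Φ z (adjugateField Φ v z) = (fderiv ℂ Φ z).det • v := by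
  set B : Matrix (Fin n) (Fin n) ℂ := Matrix.of fun j => fderiv ℂ Φ z (Pi.single j 1) with hB
  have h1 : adjugateField Φ v z = Matrix.cramer B.transpose v := by
    ext k
    rw [Matrix.cramer_transpose_apply]
    rfl
  have h2 : (fderiv ℂ Φ z).det = B.transpose.det := by
    rw [ContinuousLinearMap.det_eq_det_single]
    rfl
  have h3 : ∀ w, fderiv ℂ Φ z w = B.transpose.mulVec w := fun w => by
    have hw : w = ∑ j, w j • (Pi.single j 1 : Fin n → ℂ) := by
      ext j
      simp [Pi.single_apply]
    conv_lhs => rw [hw]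
    ext i
    simp [Matrix.mulVec, dotProduct, hB, mul_comm]
  rw [h3, h1, Matrix.mulVec_cramer, h2]

/-- The determinant as a continuous multilinear function of the rows. -/
noncomputable def detContinuousMultilinear (n : ℕ) :
    ContinuousMultilinearMap ℂ (fun _ : Fin n => (Fin n → ℂ)) ℂ :=
  { toMultilinearMap := (Matrix.detRowAlternating (R := ℂ) (n := Fin n)).toMultilinearMap
    cont := by
      exact Continuous.matrix_det (A := fun M : Fin n → Fin n → ℂ => Matrix.of M) continuous_id }

theorem differentiableAt_and_fderiv_adjugateField {n : ℕ} {Φ : (Fin n → ℂ) → (Fin n → ℂ)}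
    {v z : Fin n → ℂ}
    (hΦ : DifferentiableAt ℂ (fderiv ℂ Φ) z) (k : Fin n) (e : Fin n → ℂ) :
    DifferentiableAt ℂ (fun x => adjugateField Φ v x k) z ∧
      fderiv ℂ (fun x => adjugateField Φ v x k) z e =
        ∑ j, if j = k then 0 else Matrix.detRowAlternating (Function.update
          (Function.update (fun j => fderiv ℂ Φ z (Pi.single j 1)) k v) j
            (fderiv ℂ (fderiv ℂ Φ) z e (Pi.single j 1))) := by
  have h1 : ∀ j, HasFDerivAt
      (fun x => Function.update (fun j => fderiv ℂ Φ x (Pi.single j 1)) k v j)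
      (if j = k then (0 : (Fin n → ℂ) →L[ℂ] (Fin n → ℂ)) else
        (ContinuousLinearMap.apply ℂ (Fin n → ℂ) (Pi.single j 1 : Fin n → ℂ)).comp
          (fderiv ℂ (fderiv ℂ Φ) z)) z := by
    intro j
    split_ifs with hj
    · subst hj
      simp only [Function.update_self]
      exact hasFDerivAt_const v z
    · simp only [Function.update_of_ne hj]
      exact (ContinuousLinearMap.apply ℂ (Fin n → ℂ)
        (Pi.single j 1 : Fin n → ℂ)).hasFDerivAt.comp z hΦ.hasFDerivAt
  have h2 := HasFDerivAt.multilinear_comp (f := detContinuousMultilinear n) h1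
  refine ⟨h2.differentiableAt, ?_⟩
  have h3 : fderiv ℂ (fun x => adjugateField Φ v x k) z = _ := h2.fderiv
  rw [h3, sum_apply]
  refine Finset.sum_congr rfl fun j _ => ?_
  split_ifs with hj
  · simp
  · rfl

/-- **Piola's identity**: the adjugate field of a holomorphic map is divergence free. The terms
with second derivatives cancel in pairs, as these are symmetric and the determinant alternates. -/
theorem sum_fderiv_adjugateField_eq_zero {n : ℕ} {Φ : (Fin n → ℂ) → (Fin n → ℂ)}
    {U : Set (Fin n → ℂ)} (hU : IsOpen U) (hΦ : DifferentiableOn ℂ Φ U) (v : Fin n → ℂ)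
    {z : Fin n → ℂ} (hz : z ∈ U) :
    ∑ k, fderiv ℂ (fun x => adjugateField Φ v x k) z (Pi.single k 1) = 0 := by
  have hΦ' : DifferentiableAt ℂ (fderiv ℂ Φ) z :=
    (hΦ.fderiv_of_complex hU).differentiableAt (hU.mem_nhds hz)
  have hsymm : ∀ a b, fderiv ℂ (fderiv ℂ Φ) z a b = fderiv ℂ (fderiv ℂ Φ) z b a := fun a b => by
    refine second_derivative_symmetric_of_eventually (f := Φ) ?_ hΦ'.hasFDerivAt a b
    filter_upwards [hU.mem_nhds hz] with x hx
    exact (hΦ.differentiableAt (hU.mem_nhds hx)).hasFDerivAt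
  simp only [(differentiableAt_and_fderiv_adjugateField hΦ' _ _).2]
  set A : Fin n → Fin n → ℂ := fun j => fderiv ℂ Φ z (Pi.single j 1)
  set H : Fin n → Fin n → Fin n → ℂ := fun k j =>
    fderiv ℂ (fderiv ℂ Φ) z (Pi.single k 1) (Pi.single j 1)
  set T : Fin n → Fin n → ℂ := fun k j => if j = k then 0 else
    Matrix.detRowAlternating (Function.update (Function.update A k v) j (H k j)) with hT
  have hanti : ∀ k j, T k j = -T j k := by
    intro k j
    by_cases hjk : j = k
    · simp [hT, hjk]
    · simp only [hT, if_neg hjk, if_neg (Ne.symm hjk)]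
      rw [← AlternatingMap.map_swap _ _ hjk]
      congr 1
      ext1 i
      simp only [Function.comp_apply]
      by_cases hij : i = j
      · rw [hij, Equiv.swap_apply_left, Function.update_self, Function.update_self]
        exact hsymm _ _
      · by_cases hik : i = k
        · rw [hik, Equiv.swap_apply_right, Function.update_of_ne (Ne.symm hjk),
            Function.update_of_ne hjk, Function.update_self, Function.update_self]
        · rw [Equiv.swap_apply_of_ne_of_ne hij hik, Function.update_of_ne hij,
            Function.update_of_ne hik, Function.update_of_ne hik, Function.update_of_ne hij]
  have h1 : ∑ k, ∑ j, T k j = -∑ k, ∑ j, T k j := by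
    conv_lhs => rw [Finset.sum_comm]
    rw [← Finset.sum_neg_distrib]
    refine Finset.sum_congr rfl fun k _ => ?_
    rw [← Finset.sum_neg_distrib]
    exact Finset.sum_congr rfl fun j _ => hanti j k
  exact self_eq_neg.1 h1

/-! ### Weak solutions of the Cauchy-Riemann equations -/

/-- The bump function at the origin which vanishes off the ball of radius `1 / (j + 1)`. -/
noncomputable def mollifier (n j : ℕ) : ContDiffBump (0 : Fin n → ℂ) where
  rIn := 1 / (2 * ((j : ℝ) + 1))
  rOut := 1 / ((j : ℝ) + 1)
  rIn_pos := by positivity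
  rIn_lt_rOut := by
    apply one_div_lt_one_div_of_lt <;> linarith [(Nat.cast_nonneg j : (0 : ℝ) ≤ j)]

/-- The convolution of `f` with a bump function. -/
noncomputable def mollify {n : ℕ} (f : (Fin n → ℂ) → ℂ) (j : ℕ) (z : Fin n → ℂ) : ℂ :=
  convolution ((mollifier n j).normed volume) f (ContinuousLinearMap.lsmul ℝ ℝ) volume z

section mollify

variable {n : ℕ} {f : (Fin n → ℂ) → ℂ}

theorem mollify_eq (f : (Fin n → ℂ) → ℂ) (j : ℕ) (z : Fin n → ℂ) :
    mollify f j z = ∫ t, ((mollifier n j).normed volume (z - t) : ℂ) * f t := by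
  rw [mollify, convolution_eq_swap]
  simp

theorem ae_tendsto_mollify (hf : Integrable f) :
    ∀ᵐ z, Tendsto (fun j => mollify f j z) atTop (𝓝 (f z)) := by
  refine ContDiffBump.ae_convolution_tendsto_right_of_locallyIntegrable (K := 2)
    (φ := fun j => mollifier n j) tendsto_one_div_add_atTop_nhds_zero_nat
    (Eventually.of_forall fun j => ?_) hf.locallyIntegrable
  simp only [mollifier]
  refine le_of_eq ?_
  field_simp

theorem differentiableAt_and_fderiv_mollify (hf : Integrable f) (j : ℕ) (z : Fin n → ℂ) :
    DifferentiableAt ℝ (mollify f j) z ∧ ∀ v, fderiv ℝ (mollify f j) z v =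
      ∫ t, (fderiv ℝ ((mollifier n j).normed volume) (z - t) v : ℂ) * f t := by
  set ρ := (mollifier n j).normed volume
  have hρc : HasCompactSupport ρ := (mollifier n j).hasCompactSupport_normed
  have hρd : ContDiff ℝ 1 ρ := (mollifier n j).contDiff_normed
  have h1 : HasFDerivAt (mollify f j) _ z :=
    hρc.hasFDerivAt_convolution_left (ContinuousLinearMap.lsmul ℝ ℝ) hρd hf.locallyIntegrable z
  refine ⟨h1.differentiableAt, fun v => ?_⟩
  have h2 := ((hρc.fderiv ℝ).convolutionExists_left
    ((ContinuousLinearMap.lsmul ℝ ℝ : ℝ →L[ℝ] ℂ →L[ℝ] ℂ).precompL (Fin n → ℂ))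
    (hρd.continuous_fderiv one_ne_zero) hf.locallyIntegrable z).integrable_swap
  rw [h1.fderiv, convolution_eq_swap, ContinuousLinearMap.integral_apply h2]
  refine integral_congr_ae (Eventually.of_forall fun t => ?_)
  simp [ContinuousLinearMap.precompL]

theorem integrable_fderiv_mollifier_mul (hf : Integrable f) (j : ℕ) (z v : Fin n → ℂ) :
    Integrable fun t => (fderiv ℝ ((mollifier n j).normed volume) (z - t) v : ℂ) * f t := by
  set ρ := (mollifier n j).normed volume
  have hρc : HasCompactSupport ρ := (mollifier n j).hasCompactSupport_normed
  have hρd : ContDiff ℝ 1 ρ := (mollifier n j).contDiff_normed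
  have h2 := ((hρc.fderiv ℝ).convolutionExists_left
    ((ContinuousLinearMap.lsmul ℝ ℝ : ℝ →L[ℝ] ℂ →L[ℝ] ℂ).precompL (Fin n → ℂ))
    (hρd.continuous_fderiv one_ne_zero) hf.locallyIntegrable z).integrable_swap
  refine (h2.apply_continuousLinearMap v).congr (Eventually.of_forall fun t => ?_)
  simp [ContinuousLinearMap.precompL]

/-- Convolution does not increase the `L¹` norm. -/
theorem lintegral_enorm_mollify_le (hf : Integrable f) (j : ℕ) :
    ∫⁻ z, ‖mollify f j z‖ₑ ≤ ∫⁻ t, ‖f t‖ₑ := by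
  set ρ := (mollifier n j).normed volume with hρ
  have hρ1 : ∀ t, ∫⁻ z, ‖((ρ (z - t) : ℝ) : ℂ)‖ₑ = 1 := by
    intro t
    rw [lintegral_sub_right_eq_self (fun z => ‖((ρ z : ℝ) : ℂ)‖ₑ) t]
    have h1 : ∀ z, ‖((ρ z : ℝ) : ℂ)‖ₑ = ENNReal.ofReal (ρ z) := fun z => by
      rw [← ofReal_norm, Complex.norm_real, Real.norm_of_nonneg ((mollifier n j).nonneg_normed z)]
    simp only [h1]
    rw [← ofReal_integral_eq_lintegral_ofReal (mollifier n j).integrable_normed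
      (Eventually.of_forall fun z => (mollifier n j).nonneg_normed z),
      (mollifier n j).integral_normed, ENNReal.ofReal_one]
  calc ∫⁻ z, ‖mollify f j z‖ₑ ≤ ∫⁻ z, ∫⁻ t, ‖((ρ (z - t) : ℝ) : ℂ)‖ₑ * ‖f t‖ₑ := by
        refine lintegral_mono fun z => ?_
        rw [mollify_eq]
        refine (enorm_integral_le_lintegral_enorm _).trans (le_of_eq ?_)
        simp only [enorm_mul, hρ]
    _ = ∫⁻ t, ∫⁻ z, ‖((ρ (z - t) : ℝ) : ℂ)‖ₑ * ‖f t‖ₑ := by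
        refine lintegral_lintegral_swap (AEMeasurable.mul ?_ hf.1.comp_snd.enorm)
        have : Continuous fun q : (Fin n → ℂ) × (Fin n → ℂ) => ‖((ρ (q.1 - q.2) : ℝ) : ℂ)‖ₑ :=
          (Complex.continuous_ofReal.comp ((mollifier n j).continuous_normed.comp
            (continuous_fst.sub continuous_snd))).enorm
        exact this.measurable.aemeasurable
    _ = ∫⁻ t, ‖f t‖ₑ := by
        refine lintegral_congr fun t => ?_
        rw [lintegral_mul_const' _ _ enorm_ne_top, hρ1, one_mul]

end mollify

/-- **Weyl's lemma** for the Cauchy-Riemann operator: an integrable function which is annihilated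
by `∂̄` in the sense of distributions is holomorphic up to a null set. Its mollifications are
holomorphic and locally bounded in terms of the `L¹` norm, and converge to it almost everywhere. -/
theorem exists_differentiableOn_of_integral_mul_dbar_eq_zero {n : ℕ}
    (Ω : TopologicalSpace.Opens (Fin n → ℂ)) {f : (Fin n → ℂ) → ℂ}
    (hf : Integrable f (lebesgueOn Ω))
    (hw : ∀ χ : (Fin n → ℂ) → ℂ, ContDiff ℝ 1 χ → HasCompactSupport χ →
      tsupport χ ⊆ Ω → ∀ v, ∫ x, f x * dbar χ x v ∂lebesgueOn Ω = 0) :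
    ∃ g : (Fin n → ℂ) → ℂ, DifferentiableOn ℂ g Ω ∧ f =ᵐ[lebesgueOn Ω] g := by
  set f₀ : (Fin n → ℂ) → ℂ := (Ω : Set (Fin n → ℂ)).indicator f with hf₀
  have hf₀i : Integrable f₀ := (integrable_indicator_iff Ω.isOpen.measurableSet).2 hf
  have hhol : ∀ (j : ℕ) (z), closedBall z (1 / ((j : ℝ) + 1)) ⊆ Ω →
      DifferentiableAt ℂ (mollify f₀ j) z := by
    intro j z hz
    obtain ⟨hd, hder⟩ := differentiableAt_and_fderiv_mollify hf₀i j z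
    refine differentiableAt_of_dbar_eq_zero hd fun v => ?_
    set ρ := (mollifier n j).normed volume with hρ
    have hρd : ContDiff ℝ 1 ρ := (mollifier n j).contDiff_normed
    set χ : (Fin n → ℂ) → ℂ := fun t => ((ρ (z - t) : ℝ) : ℂ) with hχ
    have hχd : ContDiff ℝ 1 χ := Complex.ofRealCLM.contDiff.comp
      (hρd.comp (contDiff_const.sub contDiff_id))
    have hsupp : Function.support χ ⊆ closedBall z (1 / ((j : ℝ) + 1)) := by
      intro t ht
      have h1 : z - t ∈ Function.support ρ := by simpa [hχ] using ht
      rw [(mollifier n j).support_normed_eq] at h1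
      have h2 : ‖z - t‖ < 1 / ((j : ℝ) + 1) := by simpa [mollifier] using h1
      rw [mem_closedBall, dist_comm, dist_eq_norm]
      exact h2.le
    have hχc : HasCompactSupport χ :=
      HasCompactSupport.of_support_subset_isCompact (isCompact_closedBall _ _) hsupp
    have hχs : tsupport χ ⊆ Ω := (closure_minimal hsupp isClosed_closedBall).trans hz
    have hχ' : ∀ t v, fderiv ℝ χ t v = -((fderiv ℝ ρ (z - t) v : ℝ) : ℂ) := by
      intro t v
      have h1 : HasFDerivAt χ (Complex.ofRealCLM.comp ((fderiv ℝ ρ (z - t)).comp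
          (-(ContinuousLinearMap.id ℝ (Fin n → ℂ))))) t := by
        refine Complex.ofRealCLM.hasFDerivAt.comp t
          ((hρd.differentiable one_ne_zero _).hasFDerivAt.comp t ?_)
        exact (hasFDerivAt_id t).const_sub z
      rw [h1.fderiv]
      simp
    have h0 := hw χ hχd hχc hχs v
    have h1 : ∫ x, f x * dbar χ x v ∂lebesgueOn Ω = ∫ x, f₀ x * dbar χ x v := by
      rw [← integral_indicator Ω.isOpen.measurableSet]
      refine integral_congr_ae (Eventually.of_forall fun x => ?_)
      by_cases hx : x ∈ (Ω : Set (Fin n → ℂ)) <;> simp [hf₀, hx]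
    rw [h1] at h0
    rw [dbar, hder, hder, ← integral_const_mul, ← integral_add
      (integrable_fderiv_mollifier_mul hf₀i j z v)
      ((integrable_fderiv_mollifier_mul hf₀i j z _).const_mul _), ← neg_eq_zero, ← integral_neg,
      ← h0]
    refine integral_congr_ae (Eventually.of_forall fun t => ?_)
    simp only [dbar, hχ', hρ]
    ring
  set g : (Fin n → ℂ) → ℂ := fun z => limUnder atTop fun j => mollify f₀ j z with hg
  have hloc : ∀ z₀ ∈ Ω, ∃ r > 0, ball z₀ r ⊆ Ω ∧ DifferentiableOn ℂ g (ball z₀ r) ∧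
      ∀ᵐ z ∂volume.restrict (ball z₀ r), f z = g z := by
    intro z₀ hz₀
    obtain ⟨R, hR, hball⟩ := Metric.isOpen_iff.1 Ω.isOpen z₀ hz₀
    obtain ⟨r, hr, rfl⟩ : ∃ r > 0, R = 3 * r := ⟨R / 3, by positivity, by ring⟩
    obtain ⟨N, hN⟩ := exists_nat_one_div_lt hr
    have hd : ∀ j, DifferentiableOn ℂ (mollify f₀ (j + N)) (ball z₀ (2 * r)) := by
      intro j z hz
      refine (hhol _ z ?_).differentiableWithinAt
      have h1 : 1 / (((j + N : ℕ) : ℝ) + 1) ≤ 1 / ((N : ℝ) + 1) := by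
        apply one_div_le_one_div_of_le (by positivity)
        push_cast
        linarith [(Nat.cast_nonneg j : (0 : ℝ) ≤ j)]
      refine (closedBall_subset_ball' ?_).trans hball
      have h2 := mem_ball.1 hz
      linarith
    obtain ⟨C, hC, hCz⟩ := enorm_le_mul_eLpNorm (Ω := ball z₀ (2 * r)) (p := 1) le_rfl hr
    have hb : ∀ j, ∀ z ∈ ball z₀ r,
        ‖mollify f₀ (j + N) z‖ ≤ (C * ∫⁻ t, ‖f₀ t‖ₑ).toReal := by
      intro j z hz
      have h1 := hCz _ (hd j) z (ball_subset_ball' (by have := mem_ball.1 hz; linarith))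
      rw [eLpNorm_one_eq_lintegral_enorm] at h1
      have h2 : ‖mollify f₀ (j + N) z‖ₑ ≤ C * ∫⁻ t, ‖f₀ t‖ₑ := by
        exact h1.trans (mul_le_mul' le_rfl
          ((setLIntegral_le_lintegral _ _).trans (lintegral_enorm_mollify_le hf₀i _)))
      rw [← toReal_enorm]
      exact ENNReal.toReal_mono (ENNReal.mul_ne_top hC hf₀i.2.ne) h2
    have hrr : ball z₀ r ⊆ ball z₀ (2 * r) := ball_subset_ball (by linarith)
    have hrΩ : ball z₀ r ⊆ Ω := (ball_subset_ball (by linarith)).trans hball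
    have hae : ∀ᵐ z ∂volume.restrict (ball z₀ r),
        Tendsto (fun j => mollify f₀ (j + N) z) atTop (𝓝 (f z)) := by
      filter_upwards [ae_restrict_of_ae (ae_tendsto_mollify hf₀i),
        ae_restrict_mem measurableSet_ball] with z h1 h2
      rw [hf₀, Set.indicator_of_mem (hrΩ h2), ← hf₀] at h1
      exact h1.comp (tendsto_add_atTop_nat N)
    obtain ⟨G, hG, hfG, hGl⟩ := exists_differentiableOn_of_bounded_of_tendsto_ae
      ⟨ball z₀ r, isOpen_ball⟩ measure_ball_lt_top.ne (fun j => (hd j).mono hrr) hb hae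
    have hgG : ∀ z ∈ ball z₀ r, g z = G z := fun z hz =>
      ((tendsto_add_atTop_iff_nat N).1 (hGl z hz)).limUnder_eq
    refine ⟨r, hr, hrΩ, hG.congr hgG, ?_⟩
    filter_upwards [hfG, ae_restrict_mem measurableSet_ball] with z h1 h2
    rw [h1, hgG z h2]
  refine ⟨g, fun z hz => ?_, ?_⟩
  · obtain ⟨r, hr, -, h1, -⟩ := hloc z hz
    exact (h1.differentiableAt (ball_mem_nhds z hr)).differentiableWithinAt
  · rw [EventuallyEq, ae_restrict_iff'₀ Ω.isOpen.measurableSet.nullMeasurableSet, ae_iff]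
    refine measure_null_of_locally_null _ fun z hz => ?_
    have hzΩ : z ∈ Ω := by
      by_contra h
      exact hz fun h' => absurd h' h
    obtain ⟨r, hr, -, -, h1⟩ := hloc z hzΩ
    rw [ae_restrict_iff' measurableSet_ball, ae_iff] at h1
    refine ⟨_, inter_mem (mem_nhdsWithin_of_mem_nhds (ball_mem_nhds z hr)) self_mem_nhdsWithin,
      measure_mono_null (fun x hx => ?_) h1⟩
    intro h
    exact hx.2 fun _ => h hx.1

/-! ### Descent of holomorphy along a proper map -/

theorem DifferentiableOn.contDiffOn_real_of_complex {n m : ℕ} {f : (Fin n → ℂ) → (Fin m → ℂ)}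
    {U : Set (Fin n → ℂ)} (hU : IsOpen U) (hf : DifferentiableOn ℂ f U) :
    ContDiffOn ℝ 1 f U := by
  have h : ContDiffOn ℂ 1 f U := by
    have h1 := (contDiffOn_succ_iff_fderiv_of_isOpen (𝕜 := ℂ) (n := 0) hU).2
      ⟨hf, by simp, contDiffOn_zero.2 (hf.fderiv_of_complex hU).continuousOn⟩
    simpa using h1
  exact h.restrict_scalars ℝ

theorem DifferentiableOn.contDiffOn_real_of_complex_scalar {n : ℕ} {f : (Fin n → ℂ) → ℂ}
    {U : Set (Fin n → ℂ)} (hU : IsOpen U) (hf : DifferentiableOn ℂ f U) :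
    ContDiffOn ℝ 1 f U :=
  contDiffOn_pi.1 (DifferentiableOn.contDiffOn_real_of_complex (m := 1)
    (f := fun z _ => f z) hU (differentiableOn_pi.2 fun _ => hf)) 0

theorem continuous_dbar {n : ℕ} {F : (Fin n → ℂ) → ℂ} (hF : ContDiff ℝ 1 F) (v : Fin n → ℂ) :
    Continuous fun z => dbar F z v := by
  have h := hF.continuous_fderiv one_ne_zero
  exact (h.clm_apply continuous_const).add (continuous_const.mul (h.clm_apply continuous_const))

theorem Filter.EventuallyEq.dbar_eq {n : ℕ} {F G : (Fin n → ℂ) → ℂ} {z : Fin n → ℂ}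
    (h : F =ᶠ[𝓝 z] G) (v : Fin n → ℂ) : dbar F z v = dbar G z v := by
  rw [dbar, dbar, h.fderiv_eq]

theorem integral_fderiv_eq_zero_of_hasCompactSupport {n : ℕ} {G : (Fin n → ℂ) → ℂ}
    (hG : ContDiff ℝ 1 G) (hc : HasCompactSupport G) (v : Fin n → ℂ) :
    Integrable (fun x => fderiv ℝ G x v) ∧ ∫ x, fderiv ℝ G x v = 0 := by
  have h1 : Integrable fun x => fderiv ℝ G x v :=
    ((hG.continuous_fderiv one_ne_zero).clm_apply continuous_const).integrable_of_hasCompactSupport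
      (hc.fderiv_apply ℝ v)
  have h2 : Integrable G := hG.continuous.integrable_of_hasCompactSupport hc
  have h3 := integral_mul_fderiv_eq_neg_fderiv_mul_of_integrable (μ := volume)
    (f := fun _ : Fin n → ℂ => (1 : ℂ)) (g := G) (v := v) (by simp) (by simpa using h1)
    (by simpa using h2) (fun x _ => differentiableAt_const _)
    (fun x _ => hG.differentiable one_ne_zero x)
  exact ⟨h1, by simpa using h3⟩

theorem integral_dbar_eq_zero_of_hasCompactSupport {n : ℕ} {G : (Fin n → ℂ) → ℂ}
    (hG : ContDiff ℝ 1 G) (hc : HasCompactSupport G) (v : Fin n → ℂ) :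
    Integrable (fun x => dbar G x v) ∧ ∫ x, dbar G x v = 0 := by
  obtain ⟨h1, h2⟩ := integral_fderiv_eq_zero_of_hasCompactSupport hG hc v
  obtain ⟨h3, h4⟩ := integral_fderiv_eq_zero_of_hasCompactSupport hG hc (Complex.I • v)
  refine ⟨h1.add (h3.const_mul _), ?_⟩
  simp only [dbar]
  rw [integral_add h1 (h3.const_mul _), integral_const_mul, h2, h4]
  simp

theorem isCompact_inter_preimage_of_isProperMap {X Y : Type*} [TopologicalSpace X]
    [TopologicalSpace Y] {φ : X → Y} {S : Set X} {T : Set Y} {hm : MapsTo φ S T}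
    (hφ : IsProperMap hm.restrict) {K : Set Y} (hK : IsCompact K) (hKT : K ⊆ T) :
    IsCompact (S ∩ φ ⁻¹' K) := by
  have hK' : IsCompact (Subtype.val ⁻¹' K : Set T) := by
    rw [Subtype.isCompact_iff, Subtype.image_preimage_coe, inter_eq_right.2 hKT]
    exact hK
  convert (hφ.isCompact_preimage hK').image continuous_subtype_val using 1
  ext z
  constructor
  · rintro ⟨h1, h2⟩
    exact ⟨⟨z, h1⟩, h2, rfl⟩
  · rintro ⟨⟨y, hy⟩, h2, rfl⟩
    exact ⟨hy, h2⟩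

namespace PushesVolume

variable {n : ℕ} {Ω₁ Ω₂ : TopologicalSpace.Opens (Fin n → ℂ)} {φ : (Fin n → ℂ) → (Fin n → ℂ)}
  {m : ℕ}

/-- If the pullback of `f` is holomorphic, then `∂̄f = 0` in the sense of distributions. After
pulling the integral back to `Ω₁` the integrand is the divergence of a compactly supported field,
namely of the test function times the conjugate of the adjugate field times the pullback of `f`. -/
theorem integral_mul_dbar_eq_zero (h : PushesVolume Ω₁ Ω₂ φ m)
    (hφ : IsProperMap h.mapsTo.restrict) {f g : (Fin n → ℂ) → ℂ}
    (hf : AEStronglyMeasurable f (lebesgueOn Ω₂)) (hg : DifferentiableOn ℂ g Ω₁)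
    (hfg : sharpPullback φ f =ᵐ[lebesgueOn Ω₁] g) {χ : (Fin n → ℂ) → ℂ} (hχ : ContDiff ℝ 1 χ)
    (hχc : HasCompactSupport χ) (hχs : tsupport χ ⊆ Ω₂) (v : Fin n → ℂ) :
    ∫ w, f w * dbar χ w v ∂lebesgueOn Ω₂ = 0 := by
  set K := (Ω₁ : Set (Fin n → ℂ)) ∩ φ ⁻¹' tsupport χ with hK
  have hKc : IsCompact K := isCompact_inter_preimage_of_isProperMap hφ hχc hχs
  have hKΩ : K ⊆ Ω₁ := inter_subset_left
  set W : (Fin n → ℂ) → Fin n → ℂ := adjugateField φ v with hW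
  have hWd : ∀ k, DifferentiableOn ℂ (fun z => W z k) Ω₁ := fun k z hz =>
    (differentiableAt_and_fderiv_adjugateField
      ((h.holomorphic.fderiv_of_complex Ω₁.isOpen).differentiableAt
        (Ω₁.isOpen.mem_nhds hz)) k 0).1.differentiableWithinAt
  -- `G` extends `G₀` by zero. It is of class `C¹` as `G₀` vanishes on `Ω₁` off the compact set `K`.
  set G₀ : Fin n → (Fin n → ℂ) → ℂ := fun k z => χ (φ z) * g z * star (W z k) with hG₀
  set G : Fin n → (Fin n → ℂ) → ℂ := fun k => (Ω₁ : Set (Fin n → ℂ)).indicator (G₀ k) with hG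
  have hGG₀ : ∀ k, ∀ z ∈ Ω₁, G k =ᶠ[𝓝 z] G₀ k := fun k z hz => by
    filter_upwards [Ω₁.isOpen.mem_nhds hz] with x hx using Set.indicator_of_mem hx _
  have hG0 : ∀ k, ∀ z ∉ K, G k z = 0 := fun k z hz => by
    by_cases hzΩ : z ∈ (Ω₁ : Set (Fin n → ℂ))
    · have : χ (φ z) = 0 := image_eq_zero_of_notMem_tsupport fun h' => hz ⟨hzΩ, h'⟩
      simp [hG, hG₀, this]
    · exact Set.indicator_of_notMem hzΩ _
  have hG0' : ∀ k, ∀ z ∉ K, G k =ᶠ[𝓝 z] fun _ => 0 := fun k z hz => by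
    filter_upwards [hKc.isClosed.isOpen_compl.mem_nhds hz] with x hx using hG0 k x hx
  have hGd : ∀ k, ContDiff ℝ 1 (G k) := fun k => by
    refine contDiff_iff_contDiffAt.2 fun z => ?_
    by_cases hz : z ∈ Ω₁
    · refine ContDiffAt.congr_of_eventuallyEq ?_ (hGG₀ k z hz)
      have hzn := Ω₁.isOpen.mem_nhds hz
      have h1 := (h.holomorphic.contDiffOn_real_of_complex Ω₁.isOpen).contDiffAt hzn
      have h2 := (hg.contDiffOn_real_of_complex_scalar Ω₁.isOpen).contDiffAt hzn
      have h3 := ((hWd k).contDiffOn_real_of_complex_scalar Ω₁.isOpen).contDiffAt hzn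
      exact ((hχ.contDiffAt.comp z h1).mul h2).mul
        ((starL' ℝ : ℂ ≃L[ℝ] ℂ).contDiff.contDiffAt.comp z h3)
    · exact contDiffAt_const.congr_of_eventuallyEq (hG0' k z fun h' => hz (hKΩ h'))
  have hGc : ∀ k, HasCompactSupport (G k) := fun k =>
    HasCompactSupport.of_support_subset_isCompact hKc fun z hz => by
      by_contra h'
      exact hz (hG0 k z h')
  have hint := fun k => integral_dbar_eq_zero_of_hasCompactSupport (hGd k) (hGc k) (Pi.single k 1)
  have hsum : ∫ z, ∑ k, dbar (G k) z (Pi.single k 1) ∂lebesgueOn Ω₁ = 0 := by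
    rw [setIntegral_eq_integral_of_forall_compl_eq_zero, integral_finsetSum]
    · exact Finset.sum_eq_zero fun k _ => (hint k).2
    · exact fun k _ => (hint k).1
    · intro z hz
      refine Finset.sum_eq_zero fun k _ => ?_
      rw [(hG0' k z fun h' => hz (hKΩ h')).dbar_eq]
      exact dbar_eq_zero (differentiableAt_const _) _
  have hpt : ∀ z ∈ Ω₁, ∑ k, dbar (G k) z (Pi.single k 1) =
      g z * (star (fderiv ℂ φ z).det * dbar χ (φ z) v) := by
    intro z hz
    have hzn := Ω₁.isOpen.mem_nhds hz
    have hφz := h.holomorphic.differentiableAt hzn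
    have hgz := hg.differentiableAt hzn
    have hχz := hχ.differentiable one_ne_zero (φ z)
    have hχφ : DifferentiableAt ℝ (fun x => χ (φ x)) z :=
      hχz.comp z (hφz.restrictScalars ℝ)
    have hWz : ∀ k, DifferentiableAt ℂ (fun x => W x k) z := fun k => (hWd k).differentiableAt hzn
    have hstar : ∀ k, DifferentiableAt ℝ (fun x => star (W x k)) z := fun k =>
      (starL' ℝ : ℂ ≃L[ℝ] ℂ).differentiableAt.comp z ((hWz k).restrictScalars ℝ)
    have h1 : ∀ k, dbar (G k) z (Pi.single k 1) =
        g z * dbar (fun x => χ (φ x)) z (W z k • Pi.single k 1) +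
        χ (φ z) * g z * 2 * star (fderiv ℂ (fun x => W x k) z (Pi.single k 1)) := fun k => by
      rw [(hGG₀ k z hz).dbar_eq, hG₀,
        dbar_mul (hχφ.fun_mul (hgz.restrictScalars ℝ)) (hstar k), dbar_star (hWz k),
        dbar_mul hχφ (hgz.restrictScalars ℝ), dbar_eq_zero hgz, dbar_smul_right]
      ring
    have h2 : ∑ k, W z k • (Pi.single k 1 : Fin n → ℂ) = W z := by
      ext j
      simp [Pi.single_apply]
    simp only [h1]
    rw [Finset.sum_add_distrib, ← Finset.mul_sum, ← Finset.mul_sum, ← dbar_sum_right, h2,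
      ← star_sum, sum_fderiv_adjugateField_eq_zero Ω₁.isOpen h.holomorphic v hz,
      dbar_comp hφz hχz, hW, fderiv_adjugateField, dbar_smul_right]
    simp
  have hmain := h.integral_comp (F := fun w => f w * dbar χ w v)
    (hf.mul (continuous_dbar hχ v).aestronglyMeasurable)
  have hcongr : ∫ z, f (φ z) * dbar χ (φ z) v * ((‖(fderiv ℂ φ z).det‖ ^ 2 : ℝ) : ℂ)
      ∂lebesgueOn Ω₁ = ∫ z, ∑ k, dbar (G k) z (Pi.single k 1) ∂lebesgueOn Ω₁ := by
    refine integral_congr_ae ?_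
    filter_upwards [hfg, ae_restrict_mem Ω₁.isOpen.measurableSet] with z h1 h2
    rw [hpt z h2, ← h1, sharpPullback]
    have : ((‖(fderiv ℂ φ z).det‖ ^ 2 : ℝ) : ℂ) =
        (fderiv ℂ φ z).det * star (fderiv ℂ φ z).det := by
      push_cast
      exact (Complex.mul_conj' _).symm
    rw [this]
    ring
  rw [hcongr, hsum] at hmain
  rcases mul_eq_zero.1 hmain.symm with h0 | h0
  · exact absurd (Nat.cast_eq_zero.1 h0) h.pos.ne'
  · exact h0

/-- A function with holomorphic pullback under a proper map is holomorphic, up to a null set. -/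
theorem exists_differentiableOn_of_sharpPullback (h : PushesVolume Ω₁ Ω₂ φ m)
    (hφ : IsProperMap h.mapsTo.restrict) {f g : (Fin n → ℂ) → ℂ}
    (hf : Integrable f (lebesgueOn Ω₂)) (hg : DifferentiableOn ℂ g Ω₁)
    (hfg : sharpPullback φ f =ᵐ[lebesgueOn Ω₁] g) :
    ∃ k : (Fin n → ℂ) → ℂ, DifferentiableOn ℂ k Ω₂ ∧ f =ᵐ[lebesgueOn Ω₂] k :=
  exists_differentiableOn_of_integral_mul_dbar_eq_zero Ω₂ hf fun _ hχ hχc hχs v =>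
    h.integral_mul_dbar_eq_zero hφ hf.1 hg hfg hχ hχc hχs v

end PushesVolume

/-! ### Invariant functions and the Bergman projections -/

theorem isFiniteMeasure_lebesgueOn {n : ℕ} {Ω : TopologicalSpace.Opens (Fin n → ℂ)}
    (hb : Bornology.IsBounded (Ω : Set (Fin n → ℂ))) : IsFiniteMeasure (lebesgueOn Ω) :=
  ⟨by simpa using hb.measure_lt_top⟩

theorem mem_invariantSpace_iff {n : ℕ} {Ω : TopologicalSpace.Opens (Fin n → ℂ)}
    {Γ : Subgroup (Equiv.Perm (Fin n → ℂ))} (hΓ : Γ ≤ holomorphicAut Ω) {p : ℝ≥0∞}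
    {μ : Measure (Fin n → ℂ)} (hμ : ae μ = ae (lebesgueOn Ω)) {f : Lp ℂ p μ} :
    f ∈ invariantSpace Γ p μ ↔ ∀ σ ∈ Γ, f =ᵐ[lebesgueOn Ω] sharpPullback σ f := by
  constructor
  · intro hf σ hσ
    obtain ⟨g, h1, h2⟩ := hf σ hσ
    rw [EventuallyEq, hμ] at h1 h2
    exact EventuallyEq.trans h2 ((pushesVolume_of_mem_holomorphicAut (hΓ hσ)).sharpPullback_congr
      (EventuallyEq.symm h1))
  · intro hf σ hσ
    refine ⟨f, EventuallyEq.rfl, ?_⟩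
    rw [EventuallyEq, hμ]
    exact hf σ hσ

theorem sharpPullback_comp_apply {n : ℕ} {φ ψ : (Fin n → ℂ) → (Fin n → ℂ)}
    {f : (Fin n → ℂ) → ℂ} {z : Fin n → ℂ} (hψ : DifferentiableAt ℂ ψ z)
    (hφ : DifferentiableAt ℂ φ (ψ z)) :
    sharpPullback ψ (sharpPullback φ f) z = sharpPullback (φ ∘ ψ) f z := by
  have h : (fderiv ℂ (φ ∘ ψ) z).det = (fderiv ℂ φ (ψ z)).det * (fderiv ℂ ψ z).det := by
    rw [fderiv_comp z hφ hψ]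
    exact LinearMap.det_comp _ _
  simp only [sharpPullback, h, Function.comp_apply, mul_assoc]

theorem memLp_two_sharpPullback_iff {n m : ℕ} {Ω₁ Ω₂ : TopologicalSpace.Opens (Fin n → ℂ)}
    {φ : (Fin n → ℂ) → (Fin n → ℂ)} (h : PushesVolume Ω₁ Ω₂ φ m) {f : (Fin n → ℂ) → ℂ}
    (hf : AEStronglyMeasurable f (lebesgueOn Ω₂)) :
    MemLp (sharpPullback φ f) 2 (lebesgueOn Ω₁) ↔ MemLp f 2 (lebesgueOn Ω₂) := by
  have := h.memLp_sharpPullback_iff two_ne_zero ENNReal.ofNat_ne_top hf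
  rwa [jacobianMeasure_two] at this

/-- The values of the Bergman projection, as an element of the ambient space `L²(Ω)`. -/
theorem bergmanProjection_eq_of_inner_eq_zero {n : ℕ} {Ω : TopologicalSpace.Opens (Fin n → ℂ)}
    {f b : Lp ℂ 2 (lebesgueOn Ω)} (hb : b ∈ bergmanSpace Ω 2 (lebesgueOn Ω))
    (hfb : ∀ a ∈ bergmanSpace Ω 2 (lebesgueOn Ω),
      ∫ z, a z * star ((f - b : Lp ℂ 2 (lebesgueOn Ω)) z) ∂lebesgueOn Ω = 0) :
    (bergmanProjection Ω f : Lp ℂ 2 (lebesgueOn Ω)) = b := by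
  have h1 := Submodule.eq_starProjection_of_mem_of_inner_eq_zero (u := f) hb fun a ha => by
    rw [L2.inner_def, ← hfb a ha]
    refine integral_congr_ae (Eventually.of_forall fun z => ?_)
    exact RCLike.inner_apply _ _
  rw [← h1]
  rfl

theorem integral_mul_star_sub_bergmanProjection {n : ℕ}
    {Ω : TopologicalSpace.Opens (Fin n → ℂ)} (f : Lp ℂ 2 (lebesgueOn Ω))
    {a : Lp ℂ 2 (lebesgueOn Ω)} (ha : a ∈ bergmanSpace Ω 2 (lebesgueOn Ω)) :
    ∫ z, a z * star ((f - (bergmanProjection Ω f : Lp ℂ 2 (lebesgueOn Ω)) :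
      Lp ℂ 2 (lebesgueOn Ω)) z) ∂lebesgueOn Ω = 0 := by
  have h1 := Submodule.starProjection_inner_eq_zero (K := bergmanSpace Ω 2 (lebesgueOn Ω)) f a ha
  rw [L2.inner_def] at h1
  rw [← h1]
  refine integral_congr_ae (Eventually.of_forall fun z => ?_)
  exact (RCLike.inner_apply _ _).symm

namespace IsQuotientType

variable {n : ℕ} {Ω₁ Ω₂ : TopologicalSpace.Opens (Fin n → ℂ)} {Φ : (Fin n → ℂ) → (Fin n → ℂ)}
  {Γ : Subgroup (Equiv.Perm (Fin n → ℂ))}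

/-- Pullbacks by `Φ` are invariant under `Γ`. -/
theorem sharpPullback_sharpPullback (hΦ : IsQuotientType Ω₁ Ω₂ Φ Γ)
    {σ : Equiv.Perm (Fin n → ℂ)} (hσ : σ ∈ Γ) (f : (Fin n → ℂ) → ℂ) {z : Fin n → ℂ}
    (hz : z ∈ Ω₁) : sharpPullback σ (sharpPullback Φ f) z = sharpPullback Φ f z := by
  simp only [sharpPullback, hΦ.apply_eq hσ hz, mul_assoc, hΦ.det_fderiv_mul hσ hz]

/-- Every `Γ`-invariant function on `Ω₁` is a pullback. On a fundamental domain `D` the factor `f`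
is forced to be `(h / det Φ') ∘ (Φ|D)⁻¹`, and invariance propagates the identity to all of `Ω₁`. -/
theorem exists_sharpPullback_ae_eq (hc₁ : IsConnected (Ω₁ : Set (Fin n → ℂ)))
    (hc₂ : IsConnected (Ω₂ : Set (Fin n → ℂ))) (hΦ : IsQuotientType Ω₁ Ω₂ Φ Γ)
    {h : (Fin n → ℂ) → ℂ} (hm : AEStronglyMeasurable h (lebesgueOn Ω₁))
    (hinv : ∀ σ ∈ Γ, h =ᵐ[lebesgueOn Ω₁] sharpPullback σ h) :
    ∃ f : (Fin n → ℂ) → ℂ, Measurable f ∧ sharpPullback Φ f =ᵐ[lebesgueOn Ω₁] h := by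
  have hfin : Finite Γ := hΦ.finite_group hc₁ hc₂
  have hpush := hΦ.pushesVolume hc₁ hc₂
  obtain ⟨D, hDm, hDΩ, hDinj, -, -, hDcov⟩ := hΦ.exists_fundamentalDomain hc₁
  have hemb : MeasurableEmbedding (D.domRestrict Φ) :=
    (hΦ.holomorphic.continuousOn.mono hDΩ).measurableEmbedding hDm hDinj
  have hq : Measurable fun x : D => hm.mk h x / (fderiv ℂ Φ x).det :=
    (hm.stronglyMeasurable_mk.measurable.comp measurable_subtype_coe).div
      ((measurable_det_fderiv Φ).comp measurable_subtype_coe)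
  obtain ⟨f, hf, hfD⟩ := hemb.exists_measurable_extend hq fun _ => ⟨0⟩
  refine ⟨f, hf, ?_⟩
  have h1 : ∀ᵐ x ∂lebesgueOn Ω₁, h x = hm.mk h x ∧ (fderiv ℂ Φ x).det ≠ 0 :=
    hm.ae_eq_mk.and hpush.det_ne_zero
  have h2 : ∀ᵐ z ∂lebesgueOn Ω₁, ∀ σ : Γ, (h ((σ : Equiv.Perm (Fin n → ℂ)) z) =
      hm.mk h ((σ : Equiv.Perm (Fin n → ℂ)) z) ∧
      (fderiv ℂ Φ ((σ : Equiv.Perm (Fin n → ℂ)) z)).det ≠ 0) ∧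
      h z = sharpPullback (σ : Equiv.Perm (Fin n → ℂ)) h z :=
    ae_all_iff.2 fun σ =>
      ((pushesVolume_of_mem_holomorphicAut (hΦ.le_aut σ.2)).ae_comp h1).and (hinv σ σ.2)
  have h3 : ∀ᵐ z ∂lebesgueOn Ω₁, z ∈ ⋃ σ : Γ, (σ : Equiv.Perm (Fin n → ℂ)) '' D := by
    filter_upwards [ae_restrict_of_ae hDcov.mem_iff, ae_restrict_mem Ω₁.isOpen.measurableSet]
      with z h4 h5 using h4.2 h5
  filter_upwards [h2, h3, ae_restrict_mem Ω₁.isOpen.measurableSet] with z h4 h5 hz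
  obtain ⟨σ, x, hx, rfl⟩ := mem_iUnion.1 h5
  obtain ⟨⟨h6, h7⟩, h8⟩ := h4 σ⁻¹
  have hback : ((σ⁻¹ : Γ) : Equiv.Perm (Fin n → ℂ)) ((σ : Equiv.Perm (Fin n → ℂ)) x) = x := by
    simp
  rw [hback] at h6 h7
  have h9 : f (Φ x) = hm.mk h x / (fderiv ℂ Φ x).det := congrFun hfD ⟨x, hx⟩
  rw [← hΦ.sharpPullback_sharpPullback (σ⁻¹ : Γ).2 f hz, h8]
  simp only [sharpPullback, hback, h9, h6]
  rw [div_mul_cancel₀ _ h7]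

/-- The projection formula `B_{Ω₁} Φ^♯ = Φ^♯ B_{Ω₂}` on `L²(Ω₂)`. The pullback of a function
orthogonal to `A²(Ω₂)` is orthogonal to `A²(Ω₁)`: as it is invariant, its product with `a` equals
its product with the average of `a` over `Γ`, which is the pullback of an element of `A²(Ω₂)`. -/
theorem bergmanProjection_sharpPullback (hc₁ : IsConnected (Ω₁ : Set (Fin n → ℂ)))
    (hc₂ : IsConnected (Ω₂ : Set (Fin n → ℂ)))
    (hb₂ : Bornology.IsBounded (Ω₂ : Set (Fin n → ℂ)))
    (hΦ : IsQuotientType Ω₁ Ω₂ Φ Γ) {k : Lp ℂ 2 (lebesgueOn Ω₂)} {K : Lp ℂ 2 (lebesgueOn Ω₁)}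
    (hK : K =ᵐ[lebesgueOn Ω₁] sharpPullback Φ k) :
    (bergmanProjection Ω₁ K : Lp ℂ 2 (lebesgueOn Ω₁)) =ᵐ[lebesgueOn Ω₁]
      sharpPullback Φ (bergmanProjection Ω₂ k : Lp ℂ 2 (lebesgueOn Ω₂)) := by
  have hfin : Finite Γ := hΦ.finite_group hc₁ hc₂
  have := Fintype.ofFinite Γ
  have := isFiniteMeasure_lebesgueOn hb₂
  have hpush := hΦ.pushesVolume hc₁ hc₂
  set b : Lp ℂ 2 (lebesgueOn Ω₂) := (bergmanProjection Ω₂ k : Lp ℂ 2 (lebesgueOn Ω₂)) with hb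
  have hbL : MemLp (sharpPullback Φ b) 2 (lebesgueOn Ω₁) :=
    (memLp_two_sharpPullback_iff hpush (Lp.aestronglyMeasurable b)).2 (Lp.memLp b)
  obtain ⟨b', hb', hbb'⟩ := (bergmanProjection Ω₂ k).2
  have hBmem : hbL.toLp _ ∈ bergmanSpace Ω₁ 2 (lebesgueOn Ω₁) :=
    ⟨_, hpush.differentiableOn_sharpPullback hb',
      hbL.coeFn_toLp.trans (hpush.sharpPullback_congr hbb')⟩
  rw [bergmanProjection_eq_of_inner_eq_zero hBmem]
  · exact hbL.coeFn_toLp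
  intro a ha
  set q : (Fin n → ℂ) → ℂ := ⇑(k - b) with hq
  set Q : (Fin n → ℂ) → ℂ := ⇑(K - hbL.toLp _) with hQ
  have hQL : MemLp Q 2 (lebesgueOn Ω₁) := Lp.memLp _
  have hqm : AEStronglyMeasurable q (lebesgueOn Ω₂) := Lp.aestronglyMeasurable _
  have hQq : Q =ᵐ[lebesgueOn Ω₁] sharpPullback Φ q := by
    filter_upwards [Lp.coeFn_sub K (hbL.toLp _), hbL.coeFn_toLp, hK,
      hpush.ae_comp (Lp.coeFn_sub k b)] with z h1 h2 h3 h4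
    rw [hQ, h1, Pi.sub_apply, h2, h3, hq]
    simp only [sharpPullback, h4, Pi.sub_apply]
    ring
  have hQinv : ∀ σ ∈ Γ, sharpPullback σ Q =ᵐ[lebesgueOn Ω₁] Q := fun σ hσ => by
    refine ((pushesVolume_of_mem_holomorphicAut (hΦ.le_aut hσ)).sharpPullback_congr hQq).trans
      (EventuallyEq.trans ?_ hQq.symm)
    filter_upwards [ae_restrict_mem Ω₁.isOpen.measurableSet] with z hz
    exact hΦ.sharpPullback_sharpPullback hσ q hz
  obtain ⟨g, hg, hag⟩ := ha
  have hgL : MemLp g 2 (lebesgueOn Ω₁) := (memLp_congr_ae hag).1 (Lp.memLp a)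
  have hσg : ∀ σ : Γ, MemLp (sharpPullback (σ : Equiv.Perm (Fin n → ℂ)) g) 2 (lebesgueOn Ω₁) :=
    fun σ => (memLp_two_sharpPullback_iff
      (pushesVolume_of_mem_holomorphicAut (hΦ.le_aut σ.2)) hgL.1).2 hgL
  have hterm : ∀ σ : Γ, ∫ z, sharpPullback (σ : Equiv.Perm (Fin n → ℂ)) g z * star (Q z)
      ∂lebesgueOn Ω₁ = ∫ z, g z * star (Q z) ∂lebesgueOn Ω₁ := fun σ => by
    have h1 := (pushesVolume_of_mem_holomorphicAut
      (hΦ.le_aut σ.2)).integral_sharpPullback_mul_conj hgL.1 hQL.1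
    rw [Nat.cast_one, one_mul] at h1
    rw [← h1]
    refine integral_congr_ae ?_
    filter_upwards [hQinv σ σ.2] with z hz
    rw [hz]
  -- The average of `g` over `Γ`, up to a factor, descends to an element of `A²(Ω₂)`.
  set A : (Fin n → ℂ) → ℂ := fun z => ∑ σ : Γ, sharpPullback (σ : Equiv.Perm (Fin n → ℂ)) g z
    with hA
  have hAd : DifferentiableOn ℂ A Ω₁ := DifferentiableOn.fun_sum fun σ _ =>
    (pushesVolume_of_mem_holomorphicAut (hΦ.le_aut σ.2)).differentiableOn_sharpPullback hg
  have hAL : MemLp A 2 (lebesgueOn Ω₁) := memLp_finsetSum _ fun σ _ => hσg σ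
  have hAinv : ∀ τ ∈ Γ, A =ᵐ[lebesgueOn Ω₁] sharpPullback τ A := fun τ hτ => by
    filter_upwards [ae_restrict_mem Ω₁.isOpen.measurableSet] with z hz
    have h1 : sharpPullback τ A z = ∑ σ : Γ,
        sharpPullback τ (sharpPullback (σ : Equiv.Perm (Fin n → ℂ)) g) z := by
      simp only [sharpPullback, hA, Finset.sum_mul]
    rw [h1]
    have h2 : ∀ σ : Γ, sharpPullback τ (sharpPullback (σ : Equiv.Perm (Fin n → ℂ)) g) z =
        sharpPullback ((σ * ⟨τ, hτ⟩ : Γ) : Equiv.Perm (Fin n → ℂ)) g z := fun σ => by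
      rw [sharpPullback_comp_apply (differentiableAt_of_mem_holomorphicAut (hΦ.le_aut hτ) hz)
        (differentiableAt_of_mem_holomorphicAut (hΦ.le_aut σ.2)
          (mapsTo_of_mem_holomorphicAut (hΦ.le_aut hτ) hz))]
      rfl
    simp only [h2]
    exact (Equiv.sum_comp (Equiv.mulRight (⟨τ, hτ⟩ : Γ))
      fun σ : Γ => sharpPullback (σ : Equiv.Perm (Fin n → ℂ)) g z).symm
  obtain ⟨c, hcm, hcA⟩ := hΦ.exists_sharpPullback_ae_eq hc₁ hc₂ hAL.1 hAinv
  have hcL : MemLp c 2 (lebesgueOn Ω₂) :=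
    (memLp_two_sharpPullback_iff hpush hcm.aestronglyMeasurable).1 ((memLp_congr_ae hcA).2 hAL)
  obtain ⟨c', hc', hcc'⟩ := hpush.exists_differentiableOn_of_sharpPullback hΦ.proper
    (hcL.integrable one_le_two) hAd hcA
  have hcmem : hcL.toLp c ∈ bergmanSpace Ω₂ 2 (lebesgueOn Ω₂) :=
    ⟨c', hc', hcL.coeFn_toLp.trans hcc'⟩
  have hzero : ∫ z, A z * star (Q z) ∂lebesgueOn Ω₁ = 0 := by
    have h1 := hpush.integral_sharpPullback_mul_conj hcm.aestronglyMeasurable hqm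
    have h2 := integral_mul_star_sub_bergmanProjection k hcmem
    have h3 : ∫ w, c w * star (q w) ∂lebesgueOn Ω₂ = 0 := by
      rw [← h2]
      refine integral_congr_ae ?_
      filter_upwards [hcL.coeFn_toLp] with w hw
      rw [hw]
    rw [h3, mul_zero] at h1
    rw [← h1]
    refine integral_congr_ae ?_
    filter_upwards [hcA, hQq] with z h4 h5
    rw [h4, h5]
  have hsum : ∫ z, A z * star (Q z) ∂lebesgueOn Ω₁ =
      Fintype.card Γ * ∫ z, g z * star (Q z) ∂lebesgueOn Ω₁ := by
    simp only [hA, Finset.sum_mul]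
    rw [integral_finsetSum]
    · simp only [hterm, Finset.sum_const, Finset.card_univ, nsmul_eq_mul]
    · exact fun σ _ => (hσg σ).integrable_mul hQL.star
  rw [hzero] at hsum
  have hfinal : ∫ z, g z * star (Q z) ∂lebesgueOn Ω₁ = 0 := by
    rcases mul_eq_zero.1 hsum.symm with h1 | h1
    · exact absurd (Nat.cast_eq_zero.1 h1) Fintype.card_ne_zero
    · exact h1
  rw [← hfinal]
  refine integral_congr_ae ?_
  filter_upwards [hag] with z hz
  rw [hz]

end IsQuotientType

/-! ### The pullback as an isomorphism of `L^p` spaces -/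

namespace IsQuotientType

variable {n : ℕ} {Ω₁ Ω₂ : TopologicalSpace.Opens (Fin n → ℂ)} {Φ : (Fin n → ℂ) → (Fin n → ℂ)}
  {Γ : Subgroup (Equiv.Perm (Fin n → ℂ))}

/-- The pullback by `Φ` is an isomorphism of `L^p(Ω₂)` onto the invariant part of the weighted
space, and it multiplies norms by `|Γ|^{1/p}`. -/
theorem exists_pullbackEquiv (hc₁ : IsConnected (Ω₁ : Set (Fin n → ℂ)))
    (hc₂ : IsConnected (Ω₂ : Set (Fin n → ℂ))) (hΦ : IsQuotientType Ω₁ Ω₂ Φ Γ) (p : ℝ≥0∞)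
    [hp1 : Fact (1 ≤ p)] (hp : p ≠ ∞) :
    ∃ P : Lp ℂ p (lebesgueOn Ω₂) ≃L[ℂ] weightedInvariantLp Ω₁ Φ Γ p,
      (∀ f : Lp ℂ p (lebesgueOn Ω₂),
        (P f : Lp ℂ p (jacobianMeasure Ω₁ Φ p)) =ᵐ[lebesgueOn Ω₁] sharpPullback Φ f) ∧
      ∃ c : ℝ, 0 < c ∧ ∀ f : Lp ℂ p (lebesgueOn Ω₂), ‖P f‖ = c * ‖f‖ := by
  have hp0 : p ≠ 0 := (zero_lt_one.trans_le hp1.out).ne'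
  have hpush := hΦ.pushesVolume hc₁ hc₂
  have hae := hpush.ae_jacobianMeasure p
  have hL : ∀ f : Lp ℂ p (lebesgueOn Ω₂),
      MemLp (sharpPullback Φ f) p (jacobianMeasure Ω₁ Φ p) := fun f =>
    (hpush.memLp_sharpPullback_iff hp0 hp (Lp.aestronglyMeasurable f)).2 (Lp.memLp f)
  have hcoe : ∀ f, (hL f).toLp _ =ᵐ[lebesgueOn Ω₁] sharpPullback Φ f := fun f => by
    have := (hL f).coeFn_toLp
    rwa [EventuallyEq, hae] at this
  have hmem : ∀ f, (hL f).toLp _ ∈ weightedInvariantLp Ω₁ Φ Γ p := fun f => by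
    rw [weightedInvariantLp, mem_invariantSpace_iff hΦ.le_aut hae]
    intro σ hσ
    refine (hcoe f).trans (EventuallyEq.trans ?_ ((pushesVolume_of_mem_holomorphicAut
      (hΦ.le_aut hσ)).sharpPullback_congr (hcoe f)).symm)
    filter_upwards [ae_restrict_mem Ω₁.isOpen.measurableSet] with z hz
    exact (hΦ.sharpPullback_sharpPullback hσ f hz).symm
  let L : Lp ℂ p (lebesgueOn Ω₂) →ₗ[ℂ] weightedInvariantLp Ω₁ Φ Γ p :=
    { toFun := fun f => ⟨(hL f).toLp _, hmem f⟩
      map_add' := fun f g => by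
        refine Subtype.ext (Lp.ext ?_)
        change (hL (f + g)).toLp _ =ᵐ[_] ⇑((hL f).toLp _ + (hL g).toLp _)
        rw [EventuallyEq, hae]
        have h0 := Lp.coeFn_add ((hL f).toLp _) ((hL g).toLp _)
        rw [EventuallyEq, hae] at h0
        filter_upwards [h0, hcoe f, hcoe g, hcoe (f + g),
          hpush.ae_comp (Lp.coeFn_add f g)] with z h1 h2 h3 h4 h5
        rw [h1, h4, Pi.add_apply, h2, h3]
        simp only [sharpPullback, h5, Pi.add_apply, add_mul]
      map_smul' := fun c f => by
        refine Subtype.ext (Lp.ext ?_)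
        change (hL (c • f)).toLp _ =ᵐ[_] ⇑(c • (hL f).toLp _)
        rw [EventuallyEq, hae]
        have h0 := Lp.coeFn_smul c ((hL f).toLp _)
        rw [EventuallyEq, hae] at h0
        filter_upwards [h0, hcoe f, hcoe (c • f), hpush.ae_comp (Lp.coeFn_smul c f)]
          with z h1 h2 h3 h4
        rw [h1, h3, Pi.smul_apply, h2]
        simp only [sharpPullback, h4, Pi.smul_apply, smul_eq_mul, mul_assoc] }
  have hLcoe : ∀ f, (L f : Lp ℂ p (jacobianMeasure Ω₁ Φ p)) =ᵐ[lebesgueOn Ω₁]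
      sharpPullback Φ f := hcoe
  set c : ℝ := (Nat.card Γ : ℝ) ^ (1 / p.toReal) with hc
  have hc0 : 0 < c := Real.rpow_pos_of_pos (Nat.cast_pos.2 hpush.pos) _
  have hnorm : ∀ f, ‖L f‖ = c * ‖f‖ := fun f => by
    change ‖(hL f).toLp _‖ = _
    rw [Lp.norm_toLp, hpush.eLpNorm_sharpPullback hp0 hp (Lp.aestronglyMeasurable f),
      ENNReal.toReal_mul, ← Lp.norm_def, ← ENNReal.toReal_rpow, ENNReal.toReal_natCast]
  have hinj : Function.Injective L := by
    refine (injective_iff_map_eq_zero L).2 fun f hf => ?_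
    have := hnorm f
    rw [hf, norm_zero] at this
    exact norm_eq_zero.1 ((mul_eq_zero.1 this.symm).resolve_left hc0.ne')
  have hsurj : Function.Surjective L := by
    rintro ⟨h, hh⟩
    have hinv := (mem_invariantSpace_iff hΦ.le_aut hae).1 hh
    have hhm : AEStronglyMeasurable h (lebesgueOn Ω₁) :=
      (Lp.aestronglyMeasurable h).mono_ac (hpush.absolutelyContinuous_jacobianMeasure p)
    obtain ⟨f, hf, hfh⟩ := hΦ.exists_sharpPullback_ae_eq hc₁ hc₂ hhm hinv
    have hfh' : sharpPullback Φ f =ᵐ[jacobianMeasure Ω₁ Φ p] h := by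
      rw [EventuallyEq, hae]
      exact hfh
    have hfL : MemLp f p (lebesgueOn Ω₂) :=
      (hpush.memLp_sharpPullback_iff hp0 hp hf.aestronglyMeasurable).1
        ((memLp_congr_ae hfh').2 (Lp.memLp h))
    refine ⟨hfL.toLp f, Subtype.ext (Lp.ext ?_)⟩
    rw [EventuallyEq, hae]
    exact EventuallyEq.trans (hLcoe _)
      ((hpush.sharpPullback_congr hfL.coeFn_toLp).trans hfh)
  let e := LinearEquiv.ofBijective L ⟨hinj, hsurj⟩
  refine ⟨e.toContinuousLinearEquivOfBounds c c⁻¹ (fun f => (hnorm f).le) fun h => ?_,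
    hLcoe, c, hc0, hnorm⟩
  have h1 : ‖h‖ = c * ‖e.symm h‖ := by
    rw [← hnorm (e.symm h)]
    exact congrArg norm (e.apply_symm_apply h).symm
  rw [h1, inv_mul_cancel_left₀ hc0.ne']

end IsQuotientType

/-! ### Extension of the Bergman projection -/

section extension

variable {n : ℕ} {Ω : TopologicalSpace.Opens (Fin n → ℂ)} {p : ℝ≥0∞} [hp1 : Fact (1 ≤ p)]

/-- The intersection of `L^p(Ω)` with `L²(Ω)`, as a subspace of `L^p(Ω)`. -/
noncomputable def lpInterL2 (Ω : TopologicalSpace.Opens (Fin n → ℂ)) (p : ℝ≥0∞) :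
    Submodule ℂ (Lp ℂ p (lebesgueOn Ω)) where
  carrier := {f | MemLp f 2 (lebesgueOn Ω)}
  zero_mem' := (memLp_congr_ae (Lp.coeFn_zero _ _ _)).2 MemLp.zero
  add_mem' := fun {f g} hf hg => (memLp_congr_ae (Lp.coeFn_add f g)).2 (hf.add hg)
  smul_mem' := fun c f hf => (memLp_congr_ae (Lp.coeFn_smul c f)).2 (hf.const_smul c)

theorem dense_lpInterL2 (hb : Bornology.IsBounded (Ω : Set (Fin n → ℂ))) (hp : p ≠ ∞) :
    Dense (lpInterL2 Ω p : Set (Lp ℂ p (lebesgueOn Ω))) := by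
  have := isFiniteMeasure_lebesgueOn hb
  refine (Lp.simpleFunc.denseRange (E := ℂ) (μ := lebesgueOn Ω) hp).mono ?_
  rintro _ ⟨f, rfl⟩
  exact (memLp_congr_ae (Lp.simpleFunc.toSimpleFunc_eq_toFun f)).1
    (SimpleFunc.memLp_of_isFiniteMeasure _ _ _)

/-- Two bounded extensions of the Bergman projection agree, as `L² ∩ L^p` is dense in `L^p`. -/
theorem ExtendsBergman.unique_top (hb : Bornology.IsBounded (Ω : Set (Fin n → ℂ))) (hp : p ≠ ∞)
    {T T' : (⊤ : Submodule ℂ (Lp ℂ p (lebesgueOn Ω))) →L[ℂ] bergmanSpace Ω p (lebesgueOn Ω)}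
    (hT : ExtendsBergman Ω ⊤ T) (hT' : ExtendsBergman Ω ⊤ T') : T = T' := by
  have h1 : (fun f : Lp ℂ p (lebesgueOn Ω) => T ⟨f, Submodule.mem_top⟩) =
      fun f => T' ⟨f, Submodule.mem_top⟩ := by
    refine Continuous.ext_on (dense_lpInterL2 hb hp)
      (T.continuous.comp (continuous_id.subtype_mk _))
      (T'.continuous.comp (continuous_id.subtype_mk _)) fun f hf => ?_
    have hf2 : MemLp f 2 (lebesgueOn Ω) := hf
    have h2 := hT (hf2.toLp f) Submodule.mem_top ⟨f, Submodule.mem_top⟩ hf2.coeFn_toLp.symm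
    have h3 := hT' (hf2.toLp f) Submodule.mem_top ⟨f, Submodule.mem_top⟩ hf2.coeFn_toLp.symm
    exact Subtype.ext (Lp.ext (h2.trans h3.symm))
  ext1 f
  exact congrFun h1 f

/-- An `L^p` estimate for the Bergman projection on `L² ∩ L^p` yields a bounded extension to
`L^p`. Its values are holomorphic since `A^p(Ω)` is closed. -/
theorem BergmanBoundedOn.exists_extendsBergman (hb : Bornology.IsBounded (Ω : Set (Fin n → ℂ)))
    (hp : p ≠ ∞) (hB : BergmanBoundedOn Ω p (lebesgueOn Ω) ⊤) :
    ∃ T : (⊤ : Submodule ℂ (Lp ℂ p (lebesgueOn Ω))) →L[ℂ] bergmanSpace Ω p (lebesgueOn Ω),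
      ExtendsBergman Ω ⊤ T := by
  obtain ⟨C, hC⟩ := hB
  have hcomplete : CompleteSpace (bergmanSpace Ω p (lebesgueOn Ω)) :=
    (isClosed_bergmanSpace Ω p).completeSpace_coe
  set B : Lp ℂ 2 (lebesgueOn Ω) → Lp ℂ 2 (lebesgueOn Ω) := fun f =>
    (bergmanProjection Ω f : Lp ℂ 2 (lebesgueOn Ω)) with hBdef
  have hf2 : ∀ f : lpInterL2 Ω p, MemLp (f : Lp ℂ p (lebesgueOn Ω)) 2 (lebesgueOn Ω) := fun f => f.2
  have hle : ∀ f : lpInterL2 Ω p, eLpNorm (B ((hf2 f).toLp _)) p (lebesgueOn Ω) ≤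
      C * eLpNorm (f : Lp ℂ p (lebesgueOn Ω)) p (lebesgueOn Ω) := fun f => by
    have h1 := hC ((hf2 f).toLp _) Submodule.mem_top
      ((memLp_congr_ae (hf2 f).coeFn_toLp).2 (Lp.memLp _))
    rwa [eLpNorm_congr_ae (hf2 f).coeFn_toLp] at h1
  have hBL : ∀ f : lpInterL2 Ω p, MemLp (B ((hf2 f).toLp _)) p (lebesgueOn Ω) := fun f =>
    ⟨Lp.aestronglyMeasurable _, (hle f).trans_lt
      (ENNReal.mul_lt_top ENNReal.coe_lt_top (Lp.eLpNorm_lt_top _))⟩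
  have hmem : ∀ f : lpInterL2 Ω p, (hBL f).toLp _ ∈ bergmanSpace Ω p (lebesgueOn Ω) := fun f => by
    obtain ⟨g, hg, hfg⟩ := (bergmanProjection Ω ((hf2 f).toLp _)).2
    exact ⟨g, hg, (hBL f).coeFn_toLp.trans hfg⟩
  let L : lpInterL2 Ω p →ₗ[ℂ] bergmanSpace Ω p (lebesgueOn Ω) :=
    { toFun := fun f => ⟨(hBL f).toLp _, hmem f⟩
      map_add' := fun f g => by
        refine Subtype.ext (Lp.ext ?_)
        change (hBL (f + g)).toLp _ =ᵐ[_] ⇑((hBL f).toLp _ + (hBL g).toLp _)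
        have h0 : (hf2 (f + g)).toLp _ = (hf2 f).toLp _ + (hf2 g).toLp _ := by
          refine Lp.ext ?_
          filter_upwards [(hf2 (f + g)).coeFn_toLp, (hf2 f).coeFn_toLp, (hf2 g).coeFn_toLp,
            Lp.coeFn_add ((hf2 f).toLp _) ((hf2 g).toLp _),
            Lp.coeFn_add (f : Lp ℂ p (lebesgueOn Ω)) g] with z h1 h2 h3 h4 h5
          rw [h1, h4, Pi.add_apply, h2, h3]
          exact h5
        have h0' : B ((hf2 (f + g)).toLp _) = B ((hf2 f).toLp _) + B ((hf2 g).toLp _) := by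
          rw [h0]
          simp only [hBdef, map_add, Submodule.coe_add]
        filter_upwards [(hBL (f + g)).coeFn_toLp, (hBL f).coeFn_toLp, (hBL g).coeFn_toLp,
          Lp.coeFn_add ((hBL f).toLp _) ((hBL g).toLp _),
          Lp.coeFn_add (B ((hf2 f).toLp _)) (B ((hf2 g).toLp _))] with z h1 h2 h3 h4 h5
        rw [h1, h4, Pi.add_apply, h2, h3, h0', h5, Pi.add_apply]
      map_smul' := fun c f => by
        refine Subtype.ext (Lp.ext ?_)
        change (hBL (c • f)).toLp _ =ᵐ[_] ⇑(c • (hBL f).toLp _)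
        have h0 : (hf2 (c • f)).toLp _ = c • (hf2 f).toLp _ := by
          refine Lp.ext ?_
          filter_upwards [(hf2 (c • f)).coeFn_toLp, (hf2 f).coeFn_toLp,
            Lp.coeFn_smul c ((hf2 f).toLp _),
            Lp.coeFn_smul c (f : Lp ℂ p (lebesgueOn Ω))] with z h1 h2 h3 h4
          rw [h1, h3, Pi.smul_apply, h2]
          exact h4
        have h0' : B ((hf2 (c • f)).toLp _) = c • B ((hf2 f).toLp _) := by
          rw [h0]
          simp only [hBdef, map_smul, Submodule.coe_smul]
        filter_upwards [(hBL (c • f)).coeFn_toLp, (hBL f).coeFn_toLp,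
          Lp.coeFn_smul c ((hBL f).toLp _),
          Lp.coeFn_smul c (B ((hf2 f).toLp _))] with z h1 h2 h3 h4
        rw [h1, h3, Pi.smul_apply, h2, h0', h4, Pi.smul_apply] }
  have hLnorm : ∀ f, ‖L f‖ ≤ C * ‖(lpInterL2 Ω p).subtype f‖ := fun f => by
    change ‖(hBL f).toLp _‖ ≤ C * ‖(f : Lp ℂ p (lebesgueOn Ω))‖
    rw [Lp.norm_toLp, Lp.norm_def, ← ENNReal.coe_toReal, ← ENNReal.toReal_mul]
    exact ENNReal.toReal_mono (ENNReal.mul_ne_top ENNReal.coe_ne_top (Lp.eLpNorm_ne_top _)) (hle f)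
  have hdense : DenseRange (lpInterL2 Ω p).subtype := by
    have := dense_lpInterL2 hb hp
    rwa [DenseRange, Submodule.coe_subtype, Subtype.range_coe]
  refine ⟨(L.extendOfNorm (lpInterL2 Ω p).subtype).comp (Submodule.subtypeL ⊤), ?_⟩
  intro f _ h hhf
  have hh : MemLp (h : Lp ℂ p (lebesgueOn Ω)) 2 (lebesgueOn Ω) :=
    (memLp_congr_ae hhf).2 (Lp.memLp f)
  have h1 : (L.extendOfNorm (lpInterL2 Ω p).subtype) (h : Lp ℂ p (lebesgueOn Ω)) = L ⟨h, hh⟩ :=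
    LinearMap.extendOfNorm_eq hdense ⟨C, hLnorm⟩ ⟨(h : Lp ℂ p (lebesgueOn Ω)), hh⟩
  have h2 : hh.toLp _ = f := Lp.ext (hh.coeFn_toLp.trans hhf)
  rw [ContinuousLinearMap.comp_apply, Submodule.subtypeL_apply, h1]
  have h3 := (hBL ⟨h, hh⟩).coeFn_toLp
  have h4 : B ((hf2 ⟨h, hh⟩).toLp _) = B f := congrArg B h2
  exact h3.trans (EventuallyEq.of_eq (congrArg (fun b : Lp ℂ 2 (lebesgueOn Ω) => ⇑b) h4))

end extension

/-! ### Transfer of estimates and of extensions along the pullback -/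

namespace IsQuotientType

variable {n : ℕ} {Ω₁ Ω₂ : TopologicalSpace.Opens (Fin n → ℂ)} {Φ : (Fin n → ℂ) → (Fin n → ℂ)}
  {Γ : Subgroup (Equiv.Perm (Fin n → ℂ))} {p : ℝ≥0∞} [hp1 : Fact (1 ≤ p)]

/-- The pullback of an `L²` function is an invariant `L²` function. -/
theorem exists_mem_invariantSpace (hc₁ : IsConnected (Ω₁ : Set (Fin n → ℂ)))
    (hc₂ : IsConnected (Ω₂ : Set (Fin n → ℂ))) (hΦ : IsQuotientType Ω₁ Ω₂ Φ Γ)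
    (k : Lp ℂ 2 (lebesgueOn Ω₂)) :
    ∃ K ∈ invariantSpace Γ 2 (lebesgueOn Ω₁), K =ᵐ[lebesgueOn Ω₁] sharpPullback Φ k := by
  have hL := (memLp_two_sharpPullback_iff (hΦ.pushesVolume hc₁ hc₂)
    (Lp.aestronglyMeasurable k)).2 (Lp.memLp k)
  refine ⟨hL.toLp _, (mem_invariantSpace_iff hΦ.le_aut rfl).2 fun σ hσ => ?_, hL.coeFn_toLp⟩
  refine hL.coeFn_toLp.trans (EventuallyEq.trans ?_ ((pushesVolume_of_mem_holomorphicAut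
    (hΦ.le_aut hσ)).sharpPullback_congr hL.coeFn_toLp).symm)
  filter_upwards [ae_restrict_mem Ω₁.isOpen.measurableSet] with z hz
  exact (hΦ.sharpPullback_sharpPullback hσ k hz).symm

/-- Every invariant `L²` function is the pullback of an `L²` function. -/
theorem exists_eq_sharpPullback (hc₁ : IsConnected (Ω₁ : Set (Fin n → ℂ)))
    (hc₂ : IsConnected (Ω₂ : Set (Fin n → ℂ))) (hΦ : IsQuotientType Ω₁ Ω₂ Φ Γ)
    {K : Lp ℂ 2 (lebesgueOn Ω₁)} (hK : K ∈ invariantSpace Γ 2 (lebesgueOn Ω₁)) :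
    ∃ k : Lp ℂ 2 (lebesgueOn Ω₂), K =ᵐ[lebesgueOn Ω₁] sharpPullback Φ k := by
  have hpush := hΦ.pushesVolume hc₁ hc₂
  obtain ⟨k, hk, hkK⟩ := hΦ.exists_sharpPullback_ae_eq hc₁ hc₂ (Lp.aestronglyMeasurable K)
    ((mem_invariantSpace_iff hΦ.le_aut rfl).1 hK)
  have hL : MemLp k 2 (lebesgueOn Ω₂) :=
    (memLp_two_sharpPullback_iff hpush hk.aestronglyMeasurable).1
      ((memLp_congr_ae hkK).2 (Lp.memLp K))
  exact ⟨hL.toLp k, hkK.symm.trans (hpush.sharpPullback_congr hL.coeFn_toLp).symm⟩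

/-- The estimates for the two projections are equivalent, with the same constant: by the projection
formula both sides get multiplied by `|Γ|^{1/p}` under the pullback. -/
theorem bergmanBoundedOn_iff (hc₁ : IsConnected (Ω₁ : Set (Fin n → ℂ)))
    (hc₂ : IsConnected (Ω₂ : Set (Fin n → ℂ)))
    (hb₂ : Bornology.IsBounded (Ω₂ : Set (Fin n → ℂ)))
    (hΦ : IsQuotientType Ω₁ Ω₂ Φ Γ) (hp : p ≠ ∞) :
    BergmanBoundedOn Ω₂ p (lebesgueOn Ω₂) ⊤ ↔
      BergmanBoundedOn Ω₁ p (jacobianMeasure Ω₁ Φ p) (invariantSpace Γ 2 (lebesgueOn Ω₁)) := by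
  have hp0 : p ≠ 0 := (zero_lt_one.trans_le hp1.out).ne'
  have hpush := hΦ.pushesVolume hc₁ hc₂
  have hae := hpush.ae_jacobianMeasure p
  set M : ℝ≥0∞ := (Nat.card Γ : ℝ≥0∞) ^ (1 / p.toReal) with hM
  have hM0 : M ≠ 0 := by
    rw [hM, Ne, ENNReal.rpow_eq_zero_iff]
    simp [hpush.pos.ne']
  have hMtop : M ≠ ∞ := ENNReal.rpow_ne_top_of_nonneg (by positivity) (by simp)
  have key : ∀ (C : ℝ≥0) (k : Lp ℂ 2 (lebesgueOn Ω₂)) (K : Lp ℂ 2 (lebesgueOn Ω₁)),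
      K =ᵐ[lebesgueOn Ω₁] sharpPullback Φ k →
      ((MemLp K p (jacobianMeasure Ω₁ Φ p) ↔ MemLp k p (lebesgueOn Ω₂)) ∧
      (eLpNorm (bergmanProjection Ω₁ K : Lp ℂ 2 (lebesgueOn Ω₁)) p (jacobianMeasure Ω₁ Φ p) ≤
          C * eLpNorm K p (jacobianMeasure Ω₁ Φ p) ↔
        eLpNorm (bergmanProjection Ω₂ k : Lp ℂ 2 (lebesgueOn Ω₂)) p (lebesgueOn Ω₂) ≤
          C * eLpNorm k p (lebesgueOn Ω₂))) := by
    intro C k K hK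
    have hB := hΦ.bergmanProjection_sharpPullback hc₁ hc₂ hb₂ hK
    have hK' : K =ᵐ[jacobianMeasure Ω₁ Φ p] sharpPullback Φ k := by
      rwa [EventuallyEq, hae]
    have hB' : (bergmanProjection Ω₁ K : Lp ℂ 2 (lebesgueOn Ω₁)) =ᵐ[jacobianMeasure Ω₁ Φ p]
        sharpPullback Φ (bergmanProjection Ω₂ k : Lp ℂ 2 (lebesgueOn Ω₂)) := by
      rwa [EventuallyEq, hae]
    refine ⟨(memLp_congr_ae hK').trans
      (hpush.memLp_sharpPullback_iff hp0 hp (Lp.aestronglyMeasurable k)), ?_⟩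
    rw [eLpNorm_congr_ae hK', eLpNorm_congr_ae hB',
      hpush.eLpNorm_sharpPullback hp0 hp (Lp.aestronglyMeasurable _),
      hpush.eLpNorm_sharpPullback hp0 hp (Lp.aestronglyMeasurable _), mul_left_comm,
      ENNReal.mul_le_mul_iff_right hM0 hMtop]
  constructor
  · rintro ⟨C, hC⟩
    refine ⟨C, fun K hK hKp => ?_⟩
    obtain ⟨k, hk⟩ := hΦ.exists_eq_sharpPullback hc₁ hc₂ hK
    obtain ⟨h1, h2⟩ := key C k K hk
    exact h2.2 (hC k Submodule.mem_top (h1.1 hKp))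
  · rintro ⟨C, hC⟩
    refine ⟨C, fun k _ hkp => ?_⟩
    obtain ⟨K, hK, hk⟩ := hΦ.exists_mem_invariantSpace hc₁ hc₂ k
    obtain ⟨h1, h2⟩ := key C k K hk
    exact h2.1 (hC K hK (h1.2 hkp))

/-- A function in `L^p(Ω₂)` is holomorphic if and only if its pullback is. -/
theorem mem_bergmanSpace_iff (hc₁ : IsConnected (Ω₁ : Set (Fin n → ℂ)))
    (hc₂ : IsConnected (Ω₂ : Set (Fin n → ℂ)))
    (hb₂ : Bornology.IsBounded (Ω₂ : Set (Fin n → ℂ)))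
    (hΦ : IsQuotientType Ω₁ Ω₂ Φ Γ) {f : Lp ℂ p (lebesgueOn Ω₂)}
    {F : Lp ℂ p (jacobianMeasure Ω₁ Φ p)} (hF : F =ᵐ[lebesgueOn Ω₁] sharpPullback Φ f) :
    f ∈ bergmanSpace Ω₂ p (lebesgueOn Ω₂) ↔ F ∈ bergmanSpace Ω₁ p (jacobianMeasure Ω₁ Φ p) := by
  have := isFiniteMeasure_lebesgueOn hb₂
  have hpush := hΦ.pushesVolume hc₁ hc₂
  have hae := hpush.ae_jacobianMeasure p
  constructor
  · rintro ⟨g, hg, hfg⟩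
    refine ⟨_, hpush.differentiableOn_sharpPullback hg, ?_⟩
    rw [EventuallyEq, hae]
    exact EventuallyEq.trans hF (hpush.sharpPullback_congr hfg)
  · rintro ⟨G, hG, hFG⟩
    rw [EventuallyEq, hae] at hFG
    exact hpush.exists_differentiableOn_of_sharpPullback hΦ.proper
      ((Lp.memLp f).integrable hp1.out) hG (hF.symm.trans hFG)

/-- Conjugation with an isomorphism `P` given by the pullback turns bounded extensions of one
projection into bounded extensions of the other, by the projection formula. -/
theorem extendsBergman_transfer (hc₁ : IsConnected (Ω₁ : Set (Fin n → ℂ)))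
    (hc₂ : IsConnected (Ω₂ : Set (Fin n → ℂ)))
    (hb₂ : Bornology.IsBounded (Ω₂ : Set (Fin n → ℂ)))
    (hΦ : IsQuotientType Ω₁ Ω₂ Φ Γ)
    (P : Lp ℂ p (lebesgueOn Ω₂) ≃L[ℂ] weightedInvariantLp Ω₁ Φ Γ p)
    (hP : ∀ f : Lp ℂ p (lebesgueOn Ω₂),
      (P f : Lp ℂ p (jacobianMeasure Ω₁ Φ p)) =ᵐ[lebesgueOn Ω₁] sharpPullback Φ f) :
    (∀ T₂ : (⊤ : Submodule ℂ (Lp ℂ p (lebesgueOn Ω₂))) →L[ℂ] bergmanSpace Ω₂ p (lebesgueOn Ω₂),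
      ExtendsBergman Ω₂ ⊤ T₂ →
      ∃ T₁ : weightedInvariantLp Ω₁ Φ Γ p →L[ℂ] weightedInvariantBergman Ω₁ Φ Γ p,
        ExtendsBergman Ω₁ (invariantSpace Γ 2 (lebesgueOn Ω₁)) T₁) ∧
    ∀ T₁ : weightedInvariantLp Ω₁ Φ Γ p →L[ℂ] weightedInvariantBergman Ω₁ Φ Γ p,
      ExtendsBergman Ω₁ (invariantSpace Γ 2 (lebesgueOn Ω₁)) T₁ →
      ∃ T₂ : (⊤ : Submodule ℂ (Lp ℂ p (lebesgueOn Ω₂))) →L[ℂ] bergmanSpace Ω₂ p (lebesgueOn Ω₂),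
        ExtendsBergman Ω₂ ⊤ T₂ ∧
        ∀ f : Lp ℂ p (lebesgueOn Ω₂),
          (P (T₂ ⟨f, Submodule.mem_top⟩ : Lp ℂ p (lebesgueOn Ω₂)) :
            Lp ℂ p (jacobianMeasure Ω₁ Φ p)) = (T₁ (P f) : Lp ℂ p (jacobianMeasure Ω₁ Φ p)) := by
  have hpush := hΦ.pushesVolume hc₁ hc₂
  constructor
  · intro T₂ hT₂
    let S : weightedInvariantLp Ω₁ Φ Γ p →L[ℂ] Lp ℂ p (jacobianMeasure Ω₁ Φ p) :=
      (weightedInvariantLp Ω₁ Φ Γ p).subtypeL.comp ((P : _ →L[ℂ] _).comp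
        ((bergmanSpace Ω₂ p (lebesgueOn Ω₂)).subtypeL.comp
          (T₂.comp ((P.symm : _ →L[ℂ] _).codRestrict ⊤ fun _ => Submodule.mem_top))))
    refine ⟨S.codRestrict _ fun h => ⟨(P _).2, ?_⟩, ?_⟩
    · exact (hΦ.mem_bergmanSpace_iff hc₁ hc₂ hb₂ (hP _)).1 (T₂ ⟨P.symm h, Submodule.mem_top⟩).2
    · intro K hK h hh
      obtain ⟨k, hk⟩ := hΦ.exists_eq_sharpPullback hc₁ hc₂ hK
      have h1 := hP (P.symm h)
      rw [P.apply_symm_apply] at h1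
      have h2 : (P.symm h : Lp ℂ p (lebesgueOn Ω₂)) =ᵐ[lebesgueOn Ω₂] k :=
        hpush.ae_eq_of_sharpPullback_ae_eq (Lp.aestronglyMeasurable _) (Lp.aestronglyMeasurable _)
          (h1.symm.trans (hh.trans hk))
      have h3 := hT₂ k Submodule.mem_top ⟨P.symm h, Submodule.mem_top⟩ h2
      exact (hP _).trans ((hpush.sharpPullback_congr h3).trans
        (hΦ.bergmanProjection_sharpPullback hc₁ hc₂ hb₂ hk).symm)
  · intro T₁ hT₁
    let S : (⊤ : Submodule ℂ (Lp ℂ p (lebesgueOn Ω₂))) →L[ℂ] Lp ℂ p (lebesgueOn Ω₂) :=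
      (P.symm : _ →L[ℂ] _).comp (((weightedInvariantBergman Ω₁ Φ Γ p).subtypeL.codRestrict
        (weightedInvariantLp Ω₁ Φ Γ p) fun h => h.2.1).comp (T₁.comp
          ((P : _ →L[ℂ] _).comp (Submodule.subtypeL ⊤))))
    have hS : ∀ f, (P (S f) : Lp ℂ p (jacobianMeasure Ω₁ Φ p)) =
        (T₁ (P f) : Lp ℂ p (jacobianMeasure Ω₁ Φ p)) := fun f => by
      change (P (P.symm ⟨(T₁ (P f) : Lp ℂ p (jacobianMeasure Ω₁ Φ p)), (T₁ (P f)).2.1⟩) :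
        Lp ℂ p (jacobianMeasure Ω₁ Φ p)) = _
      rw [P.apply_symm_apply]
    refine ⟨S.codRestrict _ fun f => ?_, ?_, fun f => hS ⟨f, Submodule.mem_top⟩⟩
    · rw [hΦ.mem_bergmanSpace_iff hc₁ hc₂ hb₂ (hP _), hS]
      exact (T₁ (P f)).2.2
    · intro k _ f hf
      obtain ⟨K, hK, hk⟩ := hΦ.exists_mem_invariantSpace hc₁ hc₂ k
      have h1 := hT₁ K hK (P f)
        ((hP f).trans ((hpush.sharpPullback_congr hf).trans hk.symm))
      rw [← hS] at h1
      exact hpush.ae_eq_of_sharpPullback_ae_eq (Lp.aestronglyMeasurable _)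
        (Lp.aestronglyMeasurable _) ((hP _).symm.trans (h1.trans
          (hΦ.bergmanProjection_sharpPullback hc₁ hc₂ hb₂ hk)))

end IsQuotientType

theorem theorem4p9 {n : ℕ} (Ω₁ Ω₂ : TopologicalSpace.Opens (Fin n → ℂ))
    (hc₁ : IsConnected (Ω₁ : Set (Fin n → ℂ))) (hc₂ : IsConnected (Ω₂ : Set (Fin n → ℂ)))
    (hb₁ : Bornology.IsBounded (Ω₁ : Set (Fin n → ℂ)))
    (hb₂ : Bornology.IsBounded (Ω₂ : Set (Fin n → ℂ)))
    (Φ : (Fin n → ℂ) → (Fin n → ℂ)) (Γ : Subgroup (Equiv.Perm (Fin n → ℂ)))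
    (hΦ : IsQuotientType Ω₁ Ω₂ Φ Γ) (p : ℝ≥0∞) [Fact (1 ≤ p)] (hp : p ≠ ∞) :
    (BergmanBoundedOn Ω₂ p (lebesgueOn Ω₂) ⊤ ↔
      BergmanBoundedOn Ω₁ p (jacobianMeasure Ω₁ Φ p) (invariantSpace Γ 2 (lebesgueOn Ω₁))) ∧
    (BergmanBoundedOn Ω₂ p (lebesgueOn Ω₂) ⊤ ∨
      BergmanBoundedOn Ω₁ p (jacobianMeasure Ω₁ Φ p) (invariantSpace Γ 2 (lebesgueOn Ω₁)) →
      -- the vertical arrows of the diagram: the unique bounded extensions of the projections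
      (∃! T₂ : (⊤ : Submodule ℂ (Lp ℂ p (lebesgueOn Ω₂))) →L[ℂ] bergmanSpace Ω₂ p (lebesgueOn Ω₂),
        ExtendsBergman Ω₂ ⊤ T₂) ∧
      (∃! T₁ : weightedInvariantLp Ω₁ Φ Γ p →L[ℂ] weightedInvariantBergman Ω₁ Φ Γ p,
        ExtendsBergman Ω₁ (invariantSpace Γ 2 (lebesgueOn Ω₁)) T₁) ∧
      -- the horizontal arrows: the isomorphism `P` is the pullback by `Φ`
      ∃ P : Lp ℂ p (lebesgueOn Ω₂) ≃L[ℂ] weightedInvariantLp Ω₁ Φ Γ p,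
        (∀ (f : Lp ℂ p (lebesgueOn Ω₂)) (g : (Fin n → ℂ) → ℂ), f =ᵐ[lebesgueOn Ω₂] g →
          (P f : Lp ℂ p (jacobianMeasure Ω₁ Φ p)) =ᵐ[jacobianMeasure Ω₁ Φ p]
            sharpPullback Φ g) ∧
        (∃ c : ℝ, 0 < c ∧ ∀ f : Lp ℂ p (lebesgueOn Ω₂), ‖P f‖ = c * ‖f‖) ∧
        (∀ f : Lp ℂ p (lebesgueOn Ω₂), f ∈ bergmanSpace Ω₂ p (lebesgueOn Ω₂) ↔
          (P f : Lp ℂ p (jacobianMeasure Ω₁ Φ p)) ∈ weightedInvariantBergman Ω₁ Φ Γ p) ∧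
        -- the diagram commutes
        ∀ (T₂ : (⊤ : Submodule ℂ (Lp ℂ p (lebesgueOn Ω₂))) →L[ℂ]
              bergmanSpace Ω₂ p (lebesgueOn Ω₂))
          (T₁ : weightedInvariantLp Ω₁ Φ Γ p →L[ℂ] weightedInvariantBergman Ω₁ Φ Γ p),
          ExtendsBergman Ω₂ ⊤ T₂ →
          ExtendsBergman Ω₁ (invariantSpace Γ 2 (lebesgueOn Ω₁)) T₁ →
          ∀ f : Lp ℂ p (lebesgueOn Ω₂),
            (P (T₂ ⟨f, Submodule.mem_top⟩ : Lp ℂ p (lebesgueOn Ω₂)) :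
                Lp ℂ p (jacobianMeasure Ω₁ Φ p)) =
              (T₁ (P f) : Lp ℂ p (jacobianMeasure Ω₁ Φ p))) := by
  have hiff := hΦ.bergmanBoundedOn_iff hc₁ hc₂ hb₂ (p := p) hp
  refine ⟨hiff, fun hB => ?_⟩
  have hB₂ : BergmanBoundedOn Ω₂ p (lebesgueOn Ω₂) ⊤ := hB.elim id hiff.2
  have hpush := hΦ.pushesVolume hc₁ hc₂
  have hae := hpush.ae_jacobianMeasure p
  obtain ⟨P, hP, hPnorm⟩ := hΦ.exists_pullbackEquiv hc₁ hc₂ p hp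
  obtain ⟨hfwd, hbwd⟩ := hΦ.extendsBergman_transfer hc₁ hc₂ hb₂ P hP
  obtain ⟨T, hT⟩ := hB₂.exists_extendsBergman hb₂ hp
  obtain ⟨S, hS⟩ := hfwd T hT
  have hcomm : ∀ (T₂ : (⊤ : Submodule ℂ (Lp ℂ p (lebesgueOn Ω₂))) →L[ℂ]
        bergmanSpace Ω₂ p (lebesgueOn Ω₂))
      (T₁ : weightedInvariantLp Ω₁ Φ Γ p →L[ℂ] weightedInvariantBergman Ω₁ Φ Γ p),
      ExtendsBergman Ω₂ ⊤ T₂ → ExtendsBergman Ω₁ (invariantSpace Γ 2 (lebesgueOn Ω₁)) T₁ →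
      ∀ f : Lp ℂ p (lebesgueOn Ω₂),
        (P (T₂ ⟨f, Submodule.mem_top⟩ : Lp ℂ p (lebesgueOn Ω₂)) :
          Lp ℂ p (jacobianMeasure Ω₁ Φ p)) = (T₁ (P f) : Lp ℂ p (jacobianMeasure Ω₁ Φ p)) := by
    intro T₂ T₁ hT₂ hT₁ f
    obtain ⟨T₂', hT₂', h⟩ := hbwd T₁ hT₁
    rw [ExtendsBergman.unique_top hb₂ hp hT₂ hT₂']
    exact h f
  refine ⟨⟨T, hT, fun T' hT' => ExtendsBergman.unique_top hb₂ hp hT' hT⟩,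
    ⟨S, hS, fun S' hS' => ?_⟩, P, fun f g hfg => ?_, hPnorm, fun f => ?_, hcomm⟩
  · ext1 h
    obtain ⟨f, rfl⟩ := P.surjective h
    exact Subtype.ext ((hcomm T S' hT hS' f).symm.trans (hcomm T S hT hS f))
  · rw [EventuallyEq, hae]
    exact (hP f).trans (hpush.sharpPullback_congr hfg)
  · rw [hΦ.mem_bergmanSpace_iff hc₁ hc₂ hb₂ (hP f), Submodule.mem_inf]
    exact (and_iff_right (P f).2).symm
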